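/- Let $d\ge 3$. For $\zeta\in\mathbb C^d$ put $p_\zeta(\xi)=-|\xi|^2+2i\,\zeta\cdot\xi$ for $\xi\in\mathbb R^d$ (with $\zeta\cdot\xi=\sum_j\zeta_j\xi_j$), and let $\dot X^{1/2}_\zeta$ be the space of those $u:\mathbb R^d\to\mathbb C$ (functions defining tempered distributions) whose Fourier transform $\hat u$ (normalized so that $\widehat{\nabla u}=i\xi\hat u$ and $\|\hat u\|_{L^2}=\|u\|_{L^2}$) is a function with $\|u\|_{\dot X^{1/2}_\zeta}:=\||p_\zeta|^{1/2}\hat u\|_{L^2}<\infty$. For $0\le\theta\le1$ let $W^{\theta,\infty}=W^{\theta,\infty}(\mathbb R^d)$ be normed by $\|F\|_{L^\infty}$ if $\theta=0$, by $\|F\|_{L^\infty}+\operatorname{ess\,sup}_{x\ne y}|F(x)-F(y)|/|x-y|^\theta$ if $0<\theta<1$, and by $\|F\|_{L^\infty}+\|\nabla F\|_{L^\infty}$ if $\theta=1$ (weak derivatives); let $W^{1+\theta,\infty}$ consist of the $f\in L^\infty$ having a weak gradient $\nabla f\in W^{\theta,\infty}$. Let $\gamma:\mathbb R^d\to\mathbb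 R$ satisfy $\gamma\ge c$ for some constant $c>0$ and be constant outside a ball $B$. Put $g=\gamma^{1/2}$ and, formally, $q=g^{-1}\Delta g$; multiplication by $q$ is defined weakly by $$\langle m_q u,v\rangle=-\int_{\mathbb R^d}\nabla g\cdot\nabla(g^{-1}uv)\,dx .$$ **Theorem.** (i) There is a function $\omega:\mathbb R\to\mathbb R$, depending only on $d$, with $\omega(\varepsilon)\to0$ as $\varepsilon\to0^+$ and $\omega(0)=0$, and for every ball $B$ there is a constant $C$ depending only on $d$ and $B$, such that the following holds. Let $\theta\in[0,1]$, let $\gamma\in W^{1+\theta,\infty}$ be bounded below by a positive constant and constant outside $B$, let $s>0$, let $\zeta_1,\zeta_2\in\mathbb C^d$ with $\zeta_i\cdot\zeta_i=0$ and $|\zeta_1|=|\zeta_2|=\sqrt2\,s$, and let $u\in\dot X^{1/2}_{\zeta_1}$, $v\in\dot X^{1/2}_{\zeta_2}$. Then $\nabla\log\gamma\in W^{\theta,\infty}$, the functions $g$ and $g^{-1}uv$ have locally integrable weak gradients, the integral defining $\langle m_qu,v\rangle$ converges absolutely, and $$|\langle m_q u,v\rangle|\le C\,\omega\big(\|\nabla\log\gamma\|_{W^{\theta,\infty}}\big)\,s^{-\theta}\,\|u\|_{\dot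 X^{1/2}_{\zeta_1}}\|v\|_{\dot X^{1/2}_{\zeta_2}} .$$ (ii) If $\gamma\in C^1(\mathbb R^d)$ is bounded below by a positive constant and constant outside a ball, then there is a function $o:\mathbb R\to\mathbb R$ with $o(s)\to0$ as $s\to\infty$ (depending on $\gamma$) such that, for all $s>0$ and all $\zeta_1,\zeta_2,u,v$ as in (i), $\langle m_qu,v\rangle$ is well defined in the same sense and $$|\langle m_q u,v\rangle|\le o(s)\,\|u\|_{\dot X^{1/2}_{\zeta_1}}\|v\|_{\dot X^{1/2}_{\zeta_2}} .$$ -/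

import Mathlib

open MeasureTheory Filter Topology
open scoped ContDiff SchwartzMap FourierTransform ENNReal

namespace CalderonLip

/-- The Euclidean space `ℝ^d`. -/
abbrev Rd (d : ℕ) : Type := EuclideanSpace ℝ (Fin d)

/-- `f'` is a weak (distributional) derivative of `f` on `ℝ^d`: both are locally integrable and
`∫ (∂_e φ) f = - ∫ φ (f' e)` for all test functions `φ ∈ C_c^∞` and all directions `e`. -/
structure HasWeakFDeriv {d : ℕ} {V : Type*} [NormedAddCommGroup V] [NormedSpace ℝ V]
    (f : Rd d → V) (f' : Rd d → Rd d →L[ℝ] V) : Prop where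
  locallyIntegrable : LocallyIntegrable f volume
  locallyIntegrable_deriv : LocallyIntegrable f' volume
  integral_eq : ∀ φ : Rd d → ℝ, ContDiff ℝ ∞ φ → HasCompactSupport φ → ∀ e : Rd d,
    ∫ x, (fderiv ℝ φ x e) • f x = - ∫ x, φ x • f' x e

open Classical in
/-- A weak derivative of `f` (unique up to a.e. equality) if there is one, and `0` otherwise. -/
noncomputable def weakFDeriv {d : ℕ} {V : Type*} [NormedAddCommGroup V] [NormedSpace ℝ V]
    (f : Rd d → V) : Rd d → Rd d →L[ℝ] V :=
  if h : ∃ f', HasWeakFDeriv f f' then h.choose else 0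

open Classical in
/-- The top order part of the norm of `W^{θ,∞}(ℝ^d)`, `0 ≤ θ ≤ 1`: nothing for `θ = 0`, the
`L^∞` norm of the weak derivative for `θ = 1` (`⊤` if there is none), and for `0 < θ < 1` the
Slobodeckij (Hölder) seminorm `ess sup |F x - F y| / |x - y|^θ`. -/
noncomputable def sobolevSeminorm {d : ℕ} {V : Type*} [NormedAddCommGroup V] [NormedSpace ℝ V]
    (θ : ℝ) (F : Rd d → V) : ℝ≥0∞ :=
  if θ = 0 then 0
  else if θ = 1 then
    ⨅ (F' : Rd d → Rd d →L[ℝ] V) (_ : HasWeakFDeriv F F'), eLpNorm F' ⊤ volume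
  else
    eLpNorm (fun p : Rd d × Rd d => ‖F p.1 - F p.2‖ / ‖p.1 - p.2‖ ^ θ) ⊤
      ((volume : Measure (Rd d)).prod volume)

/-- The norm of `W^{θ,∞}(ℝ^d)` for `0 ≤ θ ≤ 1`. -/
noncomputable def sobolevNorm {d : ℕ} {V : Type*} [NormedAddCommGroup V] [NormedSpace ℝ V]
    (θ : ℝ) (F : Rd d → V) : ℝ≥0∞ :=
  eLpNorm F ⊤ volume + sobolevSeminorm θ F

/-- `γ ∈ W^{1+θ,∞}(ℝ^d)` for `0 ≤ θ ≤ 1`: `γ ∈ L^∞`, and `γ` has a weak derivative, which lies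
in `W^{θ,∞}`. -/
def MemSobolevOneAdd {d : ℕ} (θ : ℝ) (γ : Rd d → ℝ) : Prop :=
  MemLp γ ⊤ volume ∧ ∃ γ', HasWeakFDeriv γ γ' ∧ sobolevNorm θ γ' < ⊤

/-- `γ` is bounded below by a positive constant and is constant outside the ball `B`
(almost everywhere, as befits elements of `L^∞`). -/
def IsConductivity {d : ℕ} (B : Set (Rd d)) (γ : Rd d → ℝ) : Prop :=
  (∃ c : ℝ, 0 < c ∧ ∀ᵐ x, c ≤ γ x) ∧ ∃ k : ℝ, ∀ᵐ x, x ∉ B → γ x = k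

/-- The symbol `p_ζ(ξ) = -|ξ|² + 2 i ζ·ξ` of `Δ + 2 ζ·∇`. -/
noncomputable def symbol {d : ℕ} (ζ : EuclideanSpace ℂ (Fin d)) (ξ : Rd d) : ℂ :=
  -((‖ξ‖ ^ 2 : ℝ) : ℂ) + 2 * Complex.I * ∑ j, ζ j * ((ξ j : ℝ) : ℂ)

/-- The function `U` is the Fourier transform, in the sense of tempered distributions, of the
function `u` (in Mathlib's normalization `𝓕 u (ξ) = ∫ exp(-2πi x·ξ) u(x) dx`). -/
def IsFourierTransform {d : ℕ} (u U : Rd d → ℂ) : Prop :=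
  ∀ φ : 𝓢(Rd d, ℂ), Integrable (fun x => u x * (𝓕 φ) x) volume ∧
    Integrable (fun ξ => U ξ * φ ξ) volume ∧
    ∫ x, u x * (𝓕 φ) x = ∫ ξ, U ξ * φ ξ

/-- The norm of `Ẋ^b_ζ`, i.e. the `L²` norm of `|p_ζ|^b û`; it is `⊤` unless `û` is a function
with `|p_ζ|^b û ∈ L²`. The factor `2π` in the symbol accounts for the normalization of the
Fourier transform, for which `∇` corresponds to `2πiξ`. -/
noncomputable def dotXNorm {d : ℕ} (ζ : EuclideanSpace ℂ (Fin d)) (b : ℝ) (u : Rd d → ℂ) :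
    ℝ≥0∞ :=
  ⨅ (U : Rd d → ℂ) (_ : IsFourierTransform u U),
    eLpNorm (fun ξ => ((‖symbol ζ ((2 * Real.pi) • ξ)‖ ^ b : ℝ) : ℂ) * U ξ) 2 volume

/-- The function `g⁻¹ u v` with `g = γ^{1/2}`. -/
noncomputable def testProduct {d : ℕ} (γ : Rd d → ℝ) (u v : Rd d → ℂ) (x : Rd d) : ℂ :=
  (((Real.sqrt (γ x))⁻¹ : ℝ) : ℂ) * (u x * v x)

/-- The integrand `∇g · ∇(g⁻¹ u v)` with `g = γ^{1/2}`, the gradients being weak ones. -/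
noncomputable def formIntegrand {d : ℕ} (γ : Rd d → ℝ) (u v : Rd d → ℂ) (x : Rd d) : ℂ :=
  ∑ j, ((weakFDeriv (fun y => Real.sqrt (γ y)) x (EuclideanSpace.single j 1) : ℝ) : ℂ) *
    weakFDeriv (testProduct γ u v) x (EuclideanSpace.single j 1)

/-- All the ingredients of the form `⟨m_q u, v⟩` make sense: `g = γ^{1/2}` and `g⁻¹ u v` are
weakly differentiable and `∇g · ∇(g⁻¹ u v)` is integrable. -/
def FormDefined {d : ℕ} (γ : Rd d → ℝ) (u v : Rd d → ℂ) : Prop :=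
  (∃ g', HasWeakFDeriv (fun y => Real.sqrt (γ y)) g') ∧
  (∃ h', HasWeakFDeriv (testProduct γ u v) h') ∧
  Integrable (formIntegrand γ u v) volume

/-- `⟨m_q u, v⟩ = - ∫ ∇g · ∇(g⁻¹ u v)`, where `g = γ^{1/2}` and (formally) `q = g⁻¹ Δ g`. -/
noncomputable def mqForm {d : ℕ} (γ : Rd d → ℝ) (u v : Rd d → ℂ) : ℂ :=
  - ∫ x, formIntegrand γ u v x

/-- `ζ·ζ = 0` (the bilinear product) and `|ζ| = √2 s`. -/
def IsPhase {d : ℕ} (s : ℝ) (ζ : EuclideanSpace ℂ (Fin d)) : Prop :=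
  ∑ j, ζ j * ζ j = 0 ∧ ‖ζ‖ = Real.sqrt 2 * s

end CalderonLip

open scoped LineDeriv Convolution

namespace CalderonLip

/-! With g = √γ the Leibniz rule gives ∇g·∇(g⁻¹uv) = ½ ∇log γ·∇(uv) − ¼ |∇log γ|² uv
(`formIntegrand_ae_eq`), so no second derivative of γ appears. Everything rests on L¹ bounds for uv
and ∇(uv) over a ball containing the support of ∇log γ.

The norm of u controls û only through a weight that vanishes on the characteristic set of the symbol
p: the intersection of a sphere of radius s with a hyperplane through its centre, of codimension
two. Multiplying u by a cutoff averages û over unit scale, and on that scale the mean of 1/|p| is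
O(min(1, 1/s)), uniformly in position (`exists_lintegral_ballWeight_mul_inv_symbol_le`). Near the
characteristic set |p| is at least of the order of s times the distance, and 1/distance is
integrable across codimension two; for small s the singularity is at worst like |ξ|⁻², which is
integrable since d ≥ 3. Both cases are settled by dominating 1/|p|, in an orthonormal frame adapted
to ζ, by a sum of products of integrable one-dimensional weights (`inv_le_dominator`). Duality turns
this into an L² norm O(min(1, 1/s)^½) for φu and O(max(1, s)^½) for its gradient
(`exists_local_bounds`). By Cauchy–Schwarz, uv is O(min(1, 1/s)) in L¹ of the ball, and ∇(uv) is
O(1), as gain and loss cancel (`exists_product_bounds`).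

If |∇log γ| ≤ M, the quadratic term is therefore O(M²/s). In the linear term ∇log γ is mollified at
scale 1/s (`exists_norm_integral_smul_fderiv_le`). With δ its oscillation at that scale, the error
of mollification is at most δ and meets ∇(uv); the mollified part has derivatives O(sδ), is
integrated by parts and meets uv, whose factor 1/s cancels the s. The total is O(δ + M²/s) for s ≥
1, and O(M + M²) for every s (`exists_norm_mqForm_le`).

A field in W^{θ,∞} of norm M has δ ≤ 2M s^{-θ}, and s⁻¹ ≤ s^{-θ} for s ≥ 1; for s ≤ 1 the crude
bound is enough because s^{-θ} ≥ 1. For γ ∈ C¹ the field ∇log γ is uniformly continuous, so δ → 0.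
-/

/-! ### One-dimensional weights and integrals of their products -/

/-- A weight on the line with an integrable singularity at the origin. -/
noncomputable def singWeight (t : ℝ) : ℝ≥0∞ := 1 + (ENNReal.ofReal |t|) ^ (-(3 / 4) : ℝ)

/-- An integrable weight on the line. -/
noncomputable def decayWeight (t : ℝ) : ℝ≥0∞ := ENNReal.ofReal (1 + t ^ 2)⁻¹

@[fun_prop]
theorem measurable_singWeight : Measurable singWeight := by
  unfold singWeight; fun_prop

@[fun_prop]
theorem measurable_decayWeight : Measurable decayWeight := by
  unfold decayWeight; fun_prop

theorem one_le_singWeight (t : ℝ) : 1 ≤ singWeight t := le_self_add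

theorem lintegral_abs_rpow_lt_top :
    ∫⁻ t in Set.Icc (-1 : ℝ) 1, (ENNReal.ofReal |t|) ^ (-(3 / 4) : ℝ) < ⊤ := by
  have h0 : ∫⁻ t in Set.Ioc (0 : ℝ) 1, (ENNReal.ofReal |t|) ^ (-(3 / 4) : ℝ) < ⊤ := by
    have h := (intervalIntegral.intervalIntegrable_rpow' (a := 0) (b := 1)
      (r := (-(3 / 4) : ℝ)) (by norm_num))
    rw [intervalIntegrable_iff_integrableOn_Ioc_of_le zero_le_one] at h
    refine lt_of_le_of_lt (le_of_eq ?_) h.2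
    refine setLIntegral_congr_fun measurableSet_Ioc fun t ht => ?_
    simp only
    rw [abs_of_pos ht.1, ENNReal.ofReal_rpow_of_pos ht.1, Real.enorm_of_nonneg]
    exact Real.rpow_nonneg ht.1.le _
  have h1 : ∫⁻ t in Set.Ico (-1 : ℝ) 0, (ENNReal.ofReal |t|) ^ (-(3 / 4) : ℝ) < ⊤ := by
    have : (fun x : ℝ => -x) ⁻¹' Set.Ioc (0 : ℝ) 1 = Set.Ico (-1 : ℝ) 0 := by
      ext x
      simp only [Set.mem_preimage, Set.mem_Ioc, Set.mem_Ico]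
      constructor <;> rintro ⟨a, b⟩ <;> constructor <;> linarith
    rw [← this]
    have h2 := (Measure.measurePreserving_neg (volume : Measure ℝ)).setLIntegral_comp_preimage
      (measurableSet_Ioc (a := (0 : ℝ)) (b := 1))
      (f := fun t => (ENNReal.ofReal |t|) ^ (-(3 / 4) : ℝ)) (by fun_prop)
    simp only [abs_neg] at h2
    rw [h2]; exact h0
  have hsub : Set.Icc (-1 : ℝ) 1 ⊆ (Set.Ico (-1 : ℝ) 0 ∪ {0}) ∪ Set.Ioc (0 : ℝ) 1 := by
    intro x hx
    rcases lt_trichotomy x 0 with h | h | h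
    · exact Or.inl (Or.inl ⟨hx.1, h⟩)
    · exact Or.inl (Or.inr h)
    · exact Or.inr ⟨h, hx.2⟩
  refine (lintegral_mono_set hsub).trans_lt ((lintegral_union_le _ _ _).trans_lt ?_)
  refine ENNReal.add_lt_top.2 ⟨(lintegral_union_le _ _ _).trans_lt ?_, h0⟩
  refine ENNReal.add_lt_top.2 ⟨h1, ?_⟩
  simp

theorem lintegral_decayWeight_lt_top : ∫⁻ t, decayWeight t < ⊤ := by
  have h := integrable_inv_one_add_sq.2
  refine lt_of_le_of_lt (le_of_eq ?_) h
  refine lintegral_congr fun t => ?_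
  rw [decayWeight, Real.enorm_of_nonneg (by positivity)]

theorem decayWeight_le_one (t : ℝ) : decayWeight t ≤ 1 := by
  rw [decayWeight, ← ENNReal.ofReal_one]
  refine ENNReal.ofReal_le_ofReal (inv_le_one_of_one_le₀ ?_)
  nlinarith [sq_nonneg t]

/-- Within distance 1 of `r` the decaying factor is at most 1 and the singularity is integrable;
farther away the singular factor is at most 2 and the decaying one is integrable. Translation
invariance makes both bounds uniform in `y` and `r`. -/
theorem exists_lintegral_decayWeight_mul_singWeight_le :
    ∃ C : ℝ≥0∞, C ≠ ⊤ ∧ ∀ y r : ℝ, ∫⁻ t, decayWeight (t - y) * singWeight (t - r) ≤ C := by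
  set g : ℝ → ℝ≥0∞ := (Set.Icc (-1 : ℝ) 1).indicator
    (fun t => (ENNReal.ofReal |t|) ^ (-(3 / 4) : ℝ)) with hg
  have hgm : Measurable g := by
    rw [hg]; exact Measurable.indicator (by fun_prop) measurableSet_Icc
  refine ⟨2 * (∫⁻ t, decayWeight t) + ∫⁻ t, g t, ?_, fun y r => ?_⟩
  · have h1 : ∫⁻ t, g t < ⊤ := by
      rw [hg, lintegral_indicator measurableSet_Icc]; exact lintegral_abs_rpow_lt_top
    have h2 := lintegral_decayWeight_lt_top
    exact ENNReal.add_ne_top.2 ⟨ENNReal.mul_ne_top (by norm_num) h2.ne, h1.ne⟩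
  have hp : ∀ t, decayWeight (t - y) * singWeight (t - r) ≤ 2 * decayWeight (t - y) + g (t - r) := by
    intro t
    by_cases h : |t - r| ≤ 1
    · have : g (t - r) = (ENNReal.ofReal |t - r|) ^ (-(3 / 4) : ℝ) := by
        exact Set.indicator_of_mem (Set.mem_Icc.2 (abs_le.1 h)) _
      rw [this, singWeight, mul_add, mul_one, two_mul]
      refine add_le_add le_self_add ?_
      exact mul_le_of_le_one_left' (decayWeight_le_one _)
    · refine le_trans ?_ le_self_add
      rw [mul_comm]
      gcongr
      rw [singWeight, ← one_add_one_eq_two]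
      gcongr
      rw [ENNReal.rpow_neg, ENNReal.inv_le_one]
      refine ENNReal.one_le_rpow ?_ (by norm_num)
      rw [ENNReal.one_le_ofReal]; linarith
  calc _ ≤ ∫⁻ t, (2 * decayWeight (t - y) + g (t - r)) := lintegral_mono hp
    _ = _ := by
      rw [lintegral_add_left (by fun_prop), lintegral_const_mul _ (by fun_prop),
        lintegral_sub_right_eq_self (fun t => decayWeight t) y,
        lintegral_sub_right_eq_self (fun t => g t) r]

theorem lintegral_fin_prod_le (C : ℝ≥0∞) : ∀ (n : ℕ) (h : Fin n → ℝ → ℝ≥0∞),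
    (∀ i, Measurable (h i)) → (∀ i, ∫⁻ t, h i t ≤ C) →
      ∫⁻ x : Fin n → ℝ, ∏ i, h i (x i) ≤ C ^ n := by
  intro n
  induction n with
  | zero => intro h _ _; simp [lintegral_const, volume_pi]
  | succ n ih =>
    intro h hm hC
    have e := (volume_preserving_piFinSuccAbove (fun _ : Fin (n + 1) => ℝ) 0)
    have : ∀ x : Fin (n + 1) → ℝ, ∏ i, h i (x i) =
        (fun p : ℝ × (Fin n → ℝ) => h 0 p.1 * ∏ i, h (Fin.succ i) (p.2 i))
          (MeasurableEquiv.piFinSuccAbove (fun _ : Fin (n + 1) => ℝ) 0 x) := by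
      intro x
      simp [Fin.prod_univ_succ, MeasurableEquiv.piFinSuccAbove, Fin.tail]
    simp_rw [this]
    have hm' : Measurable fun p : ℝ × (Fin n → ℝ) => h 0 p.1 * ∏ i, h (Fin.succ i) (p.2 i) := by
      refine ((hm 0).comp measurable_fst).mul (Finset.measurable_prod _ fun i _ => ?_)
      exact (hm _).comp ((measurable_pi_apply i).comp measurable_snd)
    rw [e.lintegral_comp hm']
    have hm2 : Measurable fun z : Fin n → ℝ => ∏ i, h (Fin.succ i) (z i) :=
      Finset.measurable_prod _ fun i _ => (hm _).comp (measurable_pi_apply i)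
    rw [Measure.volume_eq_prod, lintegral_prod_mul (hm 0).aemeasurable hm2.aemeasurable, pow_succ']
    exact mul_le_mul' (hC 0) (ih _ (fun i => hm _) fun i => hC _)

/-- Integrating first in the `j`-th variable freezes the moving singularity `r`, and the
one-dimensional bound does not depend on where it lies. What remains is a product of one-dimensional
integrals with singularities at 0. -/
theorem lintegral_removeNth_le {C : ℝ≥0∞}
    (hC : ∀ y r : ℝ, ∫⁻ t, decayWeight (t - y) * singWeight (t - r) ≤ C)
    {n : ℕ} (j : Fin (n + 1)) (y : Fin (n + 1) → ℝ) {r : (Fin n → ℝ) → ℝ} (hr : Measurable r) :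
    ∫⁻ x : Fin (n + 1) → ℝ, (∏ i, decayWeight (x i - y i)) *
      (singWeight (x j - r (j.removeNth x)) * ∏ i, singWeight (x (j.succAbove i))) ≤ C ^ (n + 1) := by
  have e := (volume_preserving_piFinSuccAbove (fun _ : Fin (n + 1) => ℝ) j)
  set F : ℝ × (Fin n → ℝ) → ℝ≥0∞ := fun p =>
    (decayWeight (p.1 - y j) * singWeight (p.1 - r p.2)) *
      ∏ i, (decayWeight (p.2 i - y (j.succAbove i)) * singWeight (p.2 i - 0)) with hF
  have : ∀ x : Fin (n + 1) → ℝ, (∏ i, decayWeight (x i - y i)) *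
      (singWeight (x j - r (j.removeNth x)) * ∏ i, singWeight (x (j.succAbove i))) =
        F (MeasurableEquiv.piFinSuccAbove (fun _ : Fin (n + 1) => ℝ) j x) := by
    intro x
    simp only [hF, Fin.prod_univ_succAbove _ j, MeasurableEquiv.piFinSuccAbove, Finset.prod_mul_distrib,
      sub_zero, MeasurableEquiv.coe_mk, Fin.insertNthEquiv, Equiv.coe_fn_mk, Fin.removeNth,
      Equiv.symm_mk]
    ring_nf
  simp_rw [this]
  have hm : Measurable F := by
    rw [hF]
    refine Measurable.mul ?_ (Finset.measurable_prod _ fun i _ => ?_)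
    · fun_prop
    · have : Measurable fun a : ℝ × (Fin n → ℝ) => a.2 i := (measurable_pi_apply i).comp measurable_snd
      fun_prop
  rw [e.lintegral_comp hm, Measure.volume_eq_prod, lintegral_prod_symm _ hm.aemeasurable]
  have h1 : ∀ z : Fin n → ℝ, ∫⁻ t, F (t, z) ≤
      C * ∏ i, (decayWeight (z i - y (j.succAbove i)) * singWeight (z i - 0)) := by
    intro z
    simp only [hF]
    rw [lintegral_mul_const _ (by fun_prop)]
    exact mul_le_mul' (hC _ _) le_rfl
  calc _ ≤ ∫⁻ z : Fin n → ℝ, C * ∏ i, (decayWeight (z i - y (j.succAbove i)) * singWeight (z i - 0)) :=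
        lintegral_mono h1
    _ = C * ∫⁻ z : Fin n → ℝ, ∏ i, (decayWeight (z i - y (j.succAbove i)) * singWeight (z i - 0)) := by
        rw [lintegral_const_mul]
        exact Finset.measurable_prod _ fun i _ => by
          have : Measurable fun a : (Fin n → ℝ) => a i := (measurable_pi_apply i)
          fun_prop
    _ ≤ _ := by
        rw [pow_succ']
        gcongr
        exact lintegral_fin_prod_le C n
          (fun i t => decayWeight (t - y (j.succAbove i)) * singWeight (t - 0))
          (fun i => by fun_prop) fun i => hC _ _

/-! ### Domination of the reciprocal symbol by products of weights -/

theorem rpow_le_singWeight {t m : ℝ} (h : |t| ≤ m) :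
    (ENNReal.ofReal m) ^ (-(3 / 4) : ℝ) ≤ singWeight t := by
  refine le_trans ?_ le_add_self
  rw [ENNReal.rpow_neg, ENNReal.rpow_neg]
  gcongr

theorem ofReal_pow_inv_le_singWeight {t μ : ℝ} (hμ : 0 < μ) (h : |t| ≤ μ ^ 4) :
    ENNReal.ofReal ((μ ^ 3)⁻¹) ≤ singWeight t := by
  refine le_trans (le_of_eq ?_) (rpow_le_singWeight h)
  rw [ENNReal.ofReal_rpow_of_pos (by positivity), ← Real.rpow_natCast μ 4, ← Real.rpow_mul hμ.le,
    ← Real.rpow_natCast μ 3, ← Real.rpow_neg hμ.le]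
  norm_num

/-- Writing lengths as fourth powers turns the exponent 3/4 into the integer power `μ ^ 3`. -/
theorem exists_pow_four {m : ℝ} (hm : 0 < m) : ∃ μ : ℝ, 0 < μ ∧ μ ^ 4 = m :=
  ⟨m ^ (1 / 4 : ℝ), by positivity, by
    rw [← Real.rpow_natCast, ← Real.rpow_mul hm.le]; norm_num⟩

theorem singWeight_zero : singWeight 0 = ⊤ := by
  simp [singWeight]

/-- For m ≤ 1 two factors give m^(-3/2) ≥ m⁻¹; for m ≥ 1 the summand 1 in the weight suffices. The
exponent 3/4 is below 1 for integrability, and above 2/3 so that three factors reach m⁻², as needed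
next. At m = 0 both sides are infinite. -/
theorem inv_le_singWeight_mul {m t t' : ℝ} (h : |t| ≤ m) (h' : |t'| ≤ m) :
    (ENNReal.ofReal m)⁻¹ ≤ singWeight t * singWeight t' := by
  rcases (abs_nonneg t).trans h |>.eq_or_lt with h0 | h0
  · have : t = 0 := abs_eq_zero.1 (le_antisymm (h0 ▸ h) (abs_nonneg _))
    rw [this, singWeight_zero, ENNReal.top_mul]
    · exact le_top
    · exact (one_pos.trans_le (one_le_singWeight _)).ne'
  rcases le_total 1 m with h1 | h1
  · refine le_trans ?_ (one_le_mul (one_le_singWeight t) (one_le_singWeight t'))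
    rw [ENNReal.inv_le_one, ENNReal.one_le_ofReal]; exact h1
  obtain ⟨μ, hμ, rfl⟩ := exists_pow_four h0
  have hμ1 : μ ≤ 1 := by
    by_contra! hc; exact absurd h1 (not_le.2 (one_lt_pow₀ hc (by norm_num)))
  refine le_trans ?_ (mul_le_mul' (ofReal_pow_inv_le_singWeight hμ h)
    (ofReal_pow_inv_le_singWeight hμ h'))
  rw [← ENNReal.ofReal_mul (by positivity), ← ENNReal.ofReal_inv_of_pos (by positivity)]
  refine ENNReal.ofReal_le_ofReal ?_
  rw [← mul_inv]
  refine inv_anti₀ (by positivity) ?_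
  rw [← pow_add]
  exact pow_le_pow_of_le_one hμ.le hμ1 (by norm_num)

theorem inv_sq_le_singWeight_mul {m t t' t'' : ℝ} (h : |t| ≤ m) (h' : |t'| ≤ m) (h'' : |t''| ≤ m) :
    (ENNReal.ofReal (m ^ 2))⁻¹ ≤ singWeight t * (singWeight t' * singWeight t'') := by
  rcases (abs_nonneg t).trans h |>.eq_or_lt with h0 | h0
  · have : t = 0 := abs_eq_zero.1 (le_antisymm (h0 ▸ h) (abs_nonneg _))
    rw [this, singWeight_zero, ENNReal.top_mul]
    · exact le_top
    · exact (one_pos.trans_le (one_le_mul (one_le_singWeight _) (one_le_singWeight _))).ne'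
  rcases le_total 1 m with h1 | h1
  · refine le_trans ?_ (one_le_mul (one_le_singWeight t)
      (one_le_mul (one_le_singWeight t') (one_le_singWeight t'')))
    rw [ENNReal.inv_le_one, ENNReal.one_le_ofReal]; exact one_le_pow₀ h1
  obtain ⟨μ, hμ, rfl⟩ := exists_pow_four h0
  have hμ1 : μ ≤ 1 := by
    by_contra! hc; exact absurd h1 (not_le.2 (one_lt_pow₀ hc (by norm_num)))
  refine le_trans ?_ (mul_le_mul' (ofReal_pow_inv_le_singWeight hμ h)
    (mul_le_mul' (ofReal_pow_inv_le_singWeight hμ h') (ofReal_pow_inv_le_singWeight hμ h'')))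
  rw [← ENNReal.ofReal_mul (by positivity), ← ENNReal.ofReal_mul (by positivity),
    ← ENNReal.ofReal_inv_of_pos (by positivity)]
  refine ENNReal.ofReal_le_ofReal ?_
  rw [← mul_inv, ← mul_inv]
  refine inv_anti₀ (by positivity) ?_
  rw [← pow_add, ← pow_add, ← pow_mul]
  exact pow_le_pow_of_le_one hμ.le hμ1 (by norm_num)

/-- The three factors give m^(-3/2) s^(-3/4) up to constants. Since m ≤ K s, half a power of m may
be traded for s, leaving m⁻¹ s^(-5/4), and s^(-5/4) ≥ s⁻¹ for s ≤ 1. The 8 comes from replacing 2ν⁴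
by (2ν)⁴. -/
theorem inv_mul_le_singWeight_mul {K m s t t' t'' : ℝ} (hK : 1 ≤ K) (hs : 0 < s) (hs1 : s ≤ 1)
    (hm : m ≤ K * s) (h : |t| ≤ m) (h' : |t'| ≤ m) (h'' : |t''| ≤ 2 * s) :
    (ENNReal.ofReal (m * s))⁻¹ ≤
      ENNReal.ofReal (8 * K ^ 2) * (singWeight t * (singWeight t' * singWeight t'')) := by
  rcases (abs_nonneg t).trans h |>.eq_or_lt with h0 | h0
  · have : t = 0 := abs_eq_zero.1 (le_antisymm (h0 ▸ h) (abs_nonneg _))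
    rw [this, singWeight_zero, ENNReal.top_mul, ENNReal.mul_top]
    · exact le_top
    · rw [← pos_iff_ne_zero, ENNReal.ofReal_pos]; positivity
    · exact (one_pos.trans_le (one_le_mul (one_le_singWeight _) (one_le_singWeight _))).ne'
  obtain ⟨μ, hμ, rfl⟩ := exists_pow_four h0
  obtain ⟨ν, hν, rfl⟩ := exists_pow_four hs
  have hν1 : ν ≤ 1 := by
    by_contra! hc; exact absurd hs1 (not_le.2 (one_lt_pow₀ hc (by norm_num)))
  have hμν : μ ≤ K * ν := by
    refine le_of_pow_le_pow_left₀ (n := 4) (by norm_num) (by positivity) (hm.trans ?_)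
    rw [mul_pow]
    gcongr
    exact le_self_pow₀ hK (by norm_num)
  have h2 : |t''| ≤ (2 * ν) ^ 4 := h''.trans (by
    rw [mul_pow]; gcongr; norm_num)
  refine le_trans ?_ (mul_le_mul' le_rfl (mul_le_mul' (ofReal_pow_inv_le_singWeight hμ h)
    (mul_le_mul' (ofReal_pow_inv_le_singWeight hμ h')
      (ofReal_pow_inv_le_singWeight (by positivity) h2))))
  rw [← ENNReal.ofReal_mul (by positivity), ← ENNReal.ofReal_mul (by positivity),
    ← ENNReal.ofReal_mul (by positivity), ← ENNReal.ofReal_inv_of_pos (by positivity)]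
  refine ENNReal.ofReal_le_ofReal ?_
  have e : 8 * K ^ 2 * ((μ ^ 3)⁻¹ * ((μ ^ 3)⁻¹ * ((2 * ν) ^ 3)⁻¹)) = K ^ 2 / (μ ^ 6 * ν ^ 3) := by
    field_simp; ring
  rw [e, ← one_div, div_le_div_iff₀ (by positivity) (by positivity)]
  calc 1 * (μ ^ 6 * ν ^ 3) = μ ^ 4 * μ ^ 2 * ν ^ 3 := by ring
    _ ≤ μ ^ 4 * (K * ν) ^ 2 * ν ^ 3 := by gcongr
    _ = K ^ 2 * (μ ^ 4 * ν ^ 4) * ν := by ring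
    _ ≤ K ^ 2 * (μ ^ 4 * ν ^ 4) * 1 := by gcongr
    _ = _ := by ring

/-- For c ≥ 0, factor t² − c = (t − √c)(t + √c): the factor in which both terms have the same sign
is at least |t|. For c < 0 the convention √c = 0 reduces the claim to t² ≤ t² − c. -/
theorem abs_mul_min_le_abs_sq_sub (t c : ℝ) :
    |t| * min |t - √c| |t + √c| ≤ |t ^ 2 - c| := by
  rcases le_total 0 c with hc | hc
  · obtain ⟨r, hr, hrc⟩ : ∃ r : ℝ, 0 ≤ r ∧ √c = r := ⟨_, Real.sqrt_nonneg c, rfl⟩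
    have : c = r ^ 2 := by rw [← hrc, Real.sq_sqrt hc]
    rw [hrc, this, sq_sub_sq, abs_mul]
    rcases le_total 0 t with ht | ht
    · rw [mul_comm (|t + r|), mul_comm]
      rw [abs_of_nonneg ht, abs_of_nonneg (by positivity : 0 ≤ t + r)]
      gcongr
      · exact min_le_left _ _
      · linarith
    · rw [mul_comm]
      refine mul_le_mul (min_le_right _ _) ?_ (abs_nonneg _) (abs_nonneg _)
      rw [abs_of_nonpos ht, abs_of_nonpos (by linarith)]; linarith
  · rw [Real.sqrt_eq_zero_of_nonpos hc, sub_zero, add_zero, min_self, ← sq, sq_abs,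
      abs_of_nonneg (by nlinarith [sq_nonneg t])]
    linarith

/-- A sum of products of one dimensional singular weights that dominates the reciprocal of the
symbol. -/
noncomputable def dominator {n : ℕ} (s : ℝ) (x : Fin (n + 1) → ℝ) : ℝ≥0∞ :=
  ∑ j : Fin (n + 1), ∑ ρ ∈ ({1, -1, 0} : Finset ℝ),
    singWeight (x j - ρ * √(s ^ 2 - ∑ i, (j.removeNth x i) ^ 2)) *
      ∏ i, singWeight (x (j.succAbove i))

/-- In the sum, ρ = ±1 places the singularity at the two points where a line in direction `j` meets
the sphere of radius `s`; ρ = 0 gives the plain product of weights in all coordinates. -/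
theorem le_dominator {n : ℕ} (s : ℝ) (x : Fin (n + 1) → ℝ) (j : Fin (n + 1)) {ρ : ℝ}
    (hρ : ρ ∈ ({1, -1, 0} : Finset ℝ)) :
    singWeight (x j - ρ * √(s ^ 2 - ∑ i, (j.removeNth x i) ^ 2)) *
      ∏ i, singWeight (x (j.succAbove i)) ≤ dominator s x := by
  refine le_trans ?_ (Finset.single_le_sum (fun _ _ => zero_le) (Finset.mem_univ j))
  exact Finset.single_le_sum (f := fun ρ => singWeight (x j - ρ * √(s ^ 2 -
    ∑ i, (j.removeNth x i) ^ 2)) * ∏ i, singWeight (x (j.succAbove i))) (fun _ _ => zero_le) hρ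

theorem prod_singWeight_le_dominator {n : ℕ} (s : ℝ) (x : Fin (n + 1) → ℝ) :
    ∏ i, singWeight (x i) ≤ dominator s x := by
  refine le_trans (le_of_eq ?_) (le_dominator s x 0 (ρ := 0) (by simp))
  rw [zero_mul, sub_zero, Fin.prod_univ_succAbove _ 0]

theorem one_le_dominator {n : ℕ} (s : ℝ) (x : Fin (n + 1) → ℝ) : 1 ≤ dominator s x :=
  (Finset.one_le_prod' fun _ _ => one_le_singWeight _).trans (prod_singWeight_le_dominator s x)

/-- Every coordinate is at most |x| in modulus, so any three of the weights already supply |x|⁻².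
This is one place where dimension at least three is needed. -/
theorem inv_sum_sq_le_prod_singWeight {n : ℕ} (hn : 2 ≤ n) (x : Fin (n + 1) → ℝ) :
    (ENNReal.ofReal (∑ i, x i ^ 2))⁻¹ ≤ ∏ i, singWeight (x i) := by
  obtain ⟨k, rfl⟩ : ∃ k, n = k + 2 := ⟨n - 2, by omega⟩
  have hle : ∀ i, |x i| ≤ √(∑ i, x i ^ 2) := fun i =>
    Real.abs_le_sqrt (Finset.single_le_sum (f := fun i => x i ^ 2) (fun _ _ => sq_nonneg _)
      (Finset.mem_univ i))
  have h := inv_sq_le_singWeight_mul (hle 0) (hle 1) (hle 2)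
  rw [Real.sq_sqrt (Finset.sum_nonneg fun _ _ => sq_nonneg _)] at h
  refine h.trans ?_
  rw [Fin.prod_univ_succ, Fin.prod_univ_succ, Fin.prod_univ_succ]
  refine mul_le_mul' le_rfl (mul_le_mul' le_rfl ?_)
  exact le_mul_of_one_le_right' (Finset.one_le_prod' fun _ _ => one_le_singWeight _)

theorem mul_singWeight_le_prod_succAbove {n : ℕ} {j a b : Fin (n + 1)} (x : Fin (n + 1) → ℝ)
    (ha : a ≠ j) (hb : b ≠ j) (hab : a ≠ b) :
    singWeight (x a) * singWeight (x b) ≤ ∏ i, singWeight (x (j.succAbove i)) := by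
  obtain ⟨a', rfl⟩ := Fin.exists_succAbove_eq ha
  obtain ⟨b', rfl⟩ := Fin.exists_succAbove_eq hb
  have hne : a' ≠ b' := fun h => hab (h ▸ rfl)
  rw [← Finset.prod_pair (f := fun i => singWeight (x (j.succAbove i))) hne]
  exact Finset.prod_le_prod_of_subset_of_one_le' (Finset.subset_univ _)
    fun _ _ _ => one_le_singWeight _

/-- Otherwise the sum of squares would be at most s²/64 + s²/4, which is less than 7s²/8. -/
theorem exists_large_coordinate {n : ℕ} {s : ℝ} (hs : 0 < s) {x : Fin (n + 1) → ℝ}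
    (h0 : |x 0| ≤ s / 8) (hσ : 7 / 8 * s ^ 2 ≤ ∑ i, x i ^ 2) :
    ∃ j, j ≠ 0 ∧ s / (2 * (n + 1)) ≤ |x j| := by
  by_contra! hc
  have h1 : ∀ i : Fin n, x i.succ ^ 2 ≤ s ^ 2 / (4 * (n + 1)) := by
    intro i
    have h2 := (hc i.succ (Fin.succ_ne_zero i)).le
    rw [← sq_abs]
    refine (pow_le_pow_left₀ (abs_nonneg _) h2 2).trans ?_
    rw [div_pow]
    refine div_le_div_of_nonneg_left (by positivity) (by positivity) ?_
    have : (0 : ℝ) ≤ n := by positivity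
    nlinarith
  rw [Fin.sum_univ_succ] at hσ
  have h3 : ∑ i : Fin n, x i.succ ^ 2 ≤ s ^ 2 / 4 := by
    refine (Finset.sum_le_sum fun i _ => h1 i).trans ?_
    rw [Finset.sum_const, Finset.card_univ, Fintype.card_fin, nsmul_eq_mul, ← mul_div_assoc,
      div_le_div_iff₀ (by positivity) (by norm_num)]
    nlinarith [sq_nonneg s]
  have h4 : x 0 ^ 2 ≤ s ^ 2 / 64 := by
    rw [← sq_abs]; exact (pow_le_pow_left₀ (abs_nonneg _) h0 2).trans (by rw [div_pow]; norm_num)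
  nlinarith [sq_pos_of_pos hs]

/-- `P` stands for the modulus of the symbol: it controls the defect from the sphere of radius s and
s times the distance to the hyperplane x₀ = 0. If P is small compared with s², the point is near the
sphere with a large coordinate `j ≠ 0`, and both distances, to the sphere along `j` and to the
hyperplane, are O(P/s). Two weights then yield s/P, which is the gain s⁻¹ sought. -/
theorem inv_le_dominator {n : ℕ} (hn : 2 ≤ n) {s P : ℝ} (hs : 0 < s) (x : Fin (n + 1) → ℝ)
    (hP1 : |∑ i, x i ^ 2 - s ^ 2| ≤ P) (hP2 : s * |x 0| ≤ P) :
    (ENNReal.ofReal P)⁻¹ ≤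
      ENNReal.ofReal (32 * (n + 1) ^ 3 * min 1 s⁻¹) * dominator s x := by
  have hn0 : (2 : ℝ) ≤ n := by exact_mod_cast hn
  have hD : (1 : ℝ) ≤ (n + 1) ^ 3 := one_le_pow₀ (by linarith)
  set σ := ∑ i, x i ^ 2 with hσ
  have hσ0 : 0 ≤ σ := Finset.sum_nonneg fun _ _ => sq_nonneg _
  -- Away from the characteristic set P ≥ s²/8. For s ≥ 1 this alone gives the gain 1/s; for s ≤ 1
  -- it gives |x|² ≤ 32 P, and the singularity |x|⁻² is handled by three weights.
  rcases le_or_gt (s ^ 2 / 8) P with hA | hB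
  · have hPpos : 0 < P := lt_of_lt_of_le (by positivity) hA
    rcases le_total 1 s with h1 | h1
    · rw [min_eq_right (inv_le_one_of_one_le₀ h1)]
      refine le_trans ?_ (le_mul_of_one_le_right' (one_le_dominator s x))
      rw [← ENNReal.ofReal_inv_of_pos hPpos]
      refine ENNReal.ofReal_le_ofReal ?_
      rw [← one_div, ← div_eq_mul_inv, div_le_div_iff₀ hPpos hs]
      nlinarith
    · rw [min_eq_left (one_le_inv₀ hs |>.2 h1), mul_one]
      have h2 : σ ≤ 32 * P := by
        rcases le_total (4 * s ^ 2) σ with h | h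
        · have := (le_abs_self _).trans hP1; nlinarith
        · linarith
      calc (ENNReal.ofReal P)⁻¹ = ENNReal.ofReal 32 * (ENNReal.ofReal (32 * P))⁻¹ := by
            rw [← ENNReal.ofReal_inv_of_pos hPpos, ← ENNReal.ofReal_inv_of_pos (by positivity),
              ← ENNReal.ofReal_mul (by norm_num)]
            congr 1; field_simp
        _ ≤ ENNReal.ofReal (32 * (n + 1) ^ 3) * (ENNReal.ofReal σ)⁻¹ := by
            gcongr
            linarith
        _ ≤ _ := by
            gcongr
            exact (inv_sum_sq_le_prod_singWeight hn x).trans (prod_singWeight_le_dominator s x)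
  · have hx0 : |x 0| ≤ s / 8 := by
      have : s * |x 0| ≤ s * (s / 8) := by nlinarith
      exact le_of_mul_le_mul_left this hs
    have hσl : 7 / 8 * s ^ 2 ≤ σ := by have := (neg_le_abs _).trans hP1; linarith
    have hσu : σ ≤ 9 / 8 * s ^ 2 := by have := (le_abs_self _).trans hP1; linarith
    obtain ⟨j, hj0, hj⟩ := exists_large_coordinate hs hx0 hσl
    set r := √(s ^ 2 - ∑ i, (j.removeNth x i) ^ 2) with hr
    have hσj : σ - s ^ 2 = x j ^ 2 - (s ^ 2 - ∑ i, (j.removeNth x i) ^ 2) := by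
      rw [hσ, Fin.sum_univ_succAbove _ j]
      simp only [Fin.removeNth]
      ring
    -- `m` bounds the distance to the sphere in direction `j`: P divided by the lower bound
    -- s/(2(n+1)) for |x j|.
    set m := 2 * (n + 1) * P / s with hm
    obtain ⟨ρ, hρ, hT⟩ : ∃ ρ ∈ ({1, -1, 0} : Finset ℝ), |x j - ρ * r| ≤ m := by
      have h3 := abs_mul_min_le_abs_sq_sub (x j) (s ^ 2 - ∑ i, (j.removeNth x i) ^ 2)
      rw [← hσj, ← hr] at h3
      have h4 : s / (2 * (n + 1)) * min |x j - r| |x j + r| ≤ P :=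
        (mul_le_mul_of_nonneg_right hj (le_min (abs_nonneg _) (abs_nonneg _))).trans (h3.trans hP1)
      have h5 : min |x j - r| |x j + r| ≤ m := by
        rw [hm, le_div_iff₀ hs]
        rw [div_mul_eq_mul_div, div_le_iff₀ (by positivity)] at h4
        linarith
      rcases min_le_iff.1 h5 with h | h
      · exact ⟨1, by simp, by simpa using h⟩
      · exact ⟨-1, by simp, by simpa using h⟩
    have hP0 : 0 ≤ P := (abs_nonneg _).trans hP1
    have hx0m : |x 0| ≤ m := by
      rw [hm, le_div_iff₀ hs]; nlinarith
    have hPm : P = m * s / (2 * (n + 1)) := by rw [hm]; field_simp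
    refine le_trans ?_ (mul_le_mul' le_rfl (le_dominator s x j hρ))
    rw [← hr]
    -- A third coordinate, besides 0 and `j`, exists because n + 1 ≥ 3. Its weight is used only for
    -- s ≤ 1.
    obtain ⟨k, hk⟩ : ∃ k : Fin (n + 1), k ∉ ({0, j} : Finset (Fin (n + 1))) := by
      by_contra! hc
      have := Finset.card_le_card (fun a _ => hc a : Finset.univ ⊆ ({0, j} : Finset (Fin (n + 1))))
      rw [Finset.card_univ, Fintype.card_fin] at this
      have := this.trans Finset.card_le_two
      omega
    simp only [Finset.mem_insert, Finset.mem_singleton, not_or] at hk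
    have hprod := mul_singWeight_le_prod_succAbove x hj0.symm hk.2 (Ne.symm hk.1)
    refine le_trans ?_ (mul_le_mul' le_rfl (mul_le_mul' le_rfl hprod))
    -- Used with a = s, to extract the factor s⁻¹ for large s, and with a = 1, to keep (m s)⁻¹ whole
    -- for small s.
    have hinv : ∀ a : ℝ, 0 < a → (ENNReal.ofReal P)⁻¹ = 
        ENNReal.ofReal (2 * (n + 1) / a) * (ENNReal.ofReal (m * s / a))⁻¹ := by
      intro a ha
      have h6 : P = a / (2 * (n + 1)) * (m * s / a) := by rw [hPm]; field_simp
      rw [h6, ENNReal.ofReal_mul (by positivity), ENNReal.mul_inv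
        (Or.inl (ENNReal.ofReal_pos.2 (by positivity)).ne') (Or.inl ENNReal.ofReal_ne_top),
        ← ENNReal.ofReal_inv_of_pos (by positivity), inv_div]
    rcases le_total 1 s with h1 | h1
    · rw [min_eq_right (inv_le_one_of_one_le₀ h1), hinv s hs, mul_div_cancel_right₀ _ hs.ne']
      refine mul_le_mul' (ENNReal.ofReal_le_ofReal ?_) ?_
      · rw [div_eq_mul_inv]
        gcongr
        · norm_num
        · exact le_self_pow₀ (by linarith) (by norm_num)
      · refine (inv_le_singWeight_mul hT hx0m).trans (mul_le_mul' le_rfl ?_)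
        exact le_mul_of_one_le_right' (one_le_singWeight _)
    · rw [min_eq_left (one_le_inv₀ hs |>.2 h1), hinv 1 one_pos, div_one, div_one, mul_one]
      have hxk : |x k| ≤ 2 * s := by
        refine abs_le_of_sq_le_sq ?_ (by positivity)
        have : x k ^ 2 ≤ σ := Finset.single_le_sum (f := fun i => x i ^ 2)
          (fun _ _ => sq_nonneg _) (Finset.mem_univ k)
        nlinarith
      have hmK : m ≤ (n + 1) * s := by
        rw [hm, div_le_iff₀ hs]; nlinarith
      refine (mul_le_mul' le_rfl (inv_mul_le_singWeight_mul (by linarith) hs h1 hmK hT hx0m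
        hxk)).trans ?_
      rw [← mul_assoc, ← ENNReal.ofReal_mul (by positivity)]
      refine mul_le_mul' (ENNReal.ofReal_le_ofReal ?_) le_rfl
      nlinarith

theorem measurable_dominator_term {n : ℕ} (s ρ : ℝ) (j : Fin (n + 1)) :
    Measurable fun x : Fin (n + 1) → ℝ =>
      singWeight (x j - ρ * √(s ^ 2 - ∑ i, (j.removeNth x i) ^ 2)) *
        ∏ i, singWeight (x (j.succAbove i)) := by
  have hpi : ∀ i : Fin (n + 1), Measurable fun x : Fin (n + 1) → ℝ => x i := measurable_pi_apply
  have h1 : Measurable fun x : Fin (n + 1) → ℝ => ρ * √(s ^ 2 - ∑ i, (j.removeNth x i) ^ 2) := by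
    have : Continuous fun x : Fin (n + 1) → ℝ => ρ * √(s ^ 2 - ∑ i, (x (j.succAbove i)) ^ 2) := by
      fun_prop
    exact this.measurable
  refine Measurable.mul ?_ (Finset.measurable_prod _ fun i _ => ?_)
  · exact measurable_singWeight.comp ((hpi j).sub h1)
  · exact measurable_singWeight.comp (hpi _)

theorem measurable_dominator {n : ℕ} (s : ℝ) : Measurable (dominator (n := n) s) :=
  Finset.measurable_sum _ fun j _ => Finset.measurable_sum _ fun ρ _ =>
    measurable_dominator_term s ρ j

theorem measurable_prod_decayWeight {n : ℕ} (y : Fin n → ℝ) :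
    Measurable fun x : Fin n → ℝ => ∏ i, decayWeight (x i - y i) :=
  Finset.measurable_prod _ fun i _ =>
    measurable_decayWeight.comp ((measurable_pi_apply i).sub_const _)

theorem exists_lintegral_prod_mul_dominator_le (n : ℕ) : ∃ C : ℝ≥0∞, C ≠ ⊤ ∧
    ∀ (s : ℝ) (y : Fin (n + 1) → ℝ),
      ∫⁻ x : Fin (n + 1) → ℝ, (∏ i, decayWeight (x i - y i)) * dominator s x ≤ C := by
  obtain ⟨C, hC, hb⟩ := exists_lintegral_decayWeight_mul_singWeight_le
  refine ⟨∑ _j : Fin (n + 1), ∑ _ρ ∈ ({1, -1, 0} : Finset ℝ), C ^ (n + 1), ?_, fun s y => ?_⟩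
  · exact ENNReal.sum_ne_top.2 fun _ _ => ENNReal.sum_ne_top.2 fun _ _ => ENNReal.pow_ne_top hC
  simp only [dominator, Finset.mul_sum]
  have hm : ∀ (j : Fin (n + 1)) (ρ : ℝ), Measurable fun x : Fin (n + 1) → ℝ =>
      (∏ i, decayWeight (x i - y i)) *
        (singWeight (x j - ρ * √(s ^ 2 - ∑ i, (j.removeNth x i) ^ 2)) *
          ∏ i, singWeight (x (j.succAbove i))) := fun j ρ =>
    (measurable_prod_decayWeight y).mul (measurable_dominator_term s ρ j)
  rw [lintegral_finsetSum _ fun j _ => Finset.measurable_sum _ fun ρ _ => hm j ρ]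
  refine Finset.sum_le_sum fun j _ => ?_
  rw [lintegral_finsetSum _ fun ρ _ => hm j ρ]
  refine Finset.sum_le_sum fun ρ _ => ?_
  refine lintegral_removeNth_le hb j y (r := fun z => ρ * √(s ^ 2 - ∑ i, z i ^ 2)) ?_
  have : Continuous fun z : Fin n → ℝ => ρ * √(s ^ 2 - ∑ i, z i ^ 2) := by fun_prop
  exact this.measurable

/-! ### The symbol in an orthonormal frame adapted to ζ -/

/-- The real part of a complex vector. -/
noncomputable def reVec {d : ℕ} (ζ : EuclideanSpace ℂ (Fin d)) : Rd d :=
  WithLp.toLp 2 fun j => (ζ j).re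

/-- The imaginary part of a complex vector. -/
noncomputable def imVec {d : ℕ} (ζ : EuclideanSpace ℂ (Fin d)) : Rd d :=
  WithLp.toLp 2 fun j => (ζ j).im

/-- The real and imaginary parts of ζ·ζ = 0 say that Re ζ and Im ζ have equal length and are
orthogonal; the norm of ζ fixes the length. -/
theorem IsPhase.norm_sq {d : ℕ} {s : ℝ} {ζ : EuclideanSpace ℂ (Fin d)} (h : IsPhase s ζ) :
    ‖reVec ζ‖ ^ 2 = s ^ 2 ∧ ‖imVec ζ‖ ^ 2 = s ^ 2 ∧ inner ℝ (reVec ζ) (imVec ζ) = 0 := by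
  obtain ⟨h1, h2⟩ := h
  have h3 : ‖ζ‖ ^ 2 = 2 * s ^ 2 := by
    rw [h2, mul_pow, Real.sq_sqrt (by norm_num)]
  rw [EuclideanSpace.norm_sq_eq] at h3
  simp only [Complex.sq_norm, Complex.normSq_apply, Finset.sum_add_distrib] at h3
  have h4 := congrArg Complex.re h1
  have h5 := congrArg Complex.im h1
  simp only [Complex.re_sum, Complex.im_sum, Complex.mul_re, Complex.mul_im, Complex.zero_re,
    Complex.zero_im, Finset.sum_sub_distrib, Finset.sum_add_distrib] at h4 h5
  rw [EuclideanSpace.real_norm_sq_eq, EuclideanSpace.real_norm_sq_eq, PiLp.inner_apply]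
  simp only [reVec, imVec, sq, RCLike.inner_apply, conj_trivial]
  have h6 : ∑ j, (ζ j).im * (ζ j).re = ∑ j, (ζ j).re * (ζ j).im :=
    Finset.sum_congr rfl fun _ _ => mul_comm _ _
  refine ⟨by nlinarith, by nlinarith, by linarith⟩

theorem symbol_re_im {d : ℕ} (ζ : EuclideanSpace ℂ (Fin d)) (ξ : Rd d) :
    (symbol ζ ξ).re = -(‖ξ‖ ^ 2 + 2 * inner ℝ (imVec ζ) ξ) ∧
      (symbol ζ ξ).im = 2 * inner ℝ (reVec ζ) ξ := by
  have h1 : (∑ j, ζ j * ((ξ j : ℝ) : ℂ)).re = inner ℝ (reVec ζ) ξ := by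
    rw [PiLp.inner_apply]
    simp only [Complex.re_sum, Complex.re_mul_ofReal, reVec, RCLike.inner_apply, conj_trivial]
    exact Finset.sum_congr rfl fun _ _ => mul_comm _ _
  have h2 : (∑ j, ζ j * ((ξ j : ℝ) : ℂ)).im = inner ℝ (imVec ζ) ξ := by
    rw [PiLp.inner_apply]
    simp only [Complex.im_sum, Complex.im_mul_ofReal, imVec, RCLike.inner_apply, conj_trivial]
    exact Finset.sum_congr rfl fun _ _ => mul_comm _ _
  unfold symbol
  constructor
  · rw [Complex.add_re, Complex.neg_re, Complex.ofReal_re, Complex.mul_re, Complex.mul_im,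
      Complex.mul_re, h1, h2]
    simp; ring
  · rw [Complex.add_im, Complex.neg_im, Complex.ofReal_im, Complex.mul_im, Complex.mul_im,
      Complex.mul_re, h1, h2]
    simp

/-- Completing the square with |Im ζ| = s, the real part of the symbol is s² − |ξ + Im ζ|². -/
theorem IsPhase.abs_norm_sq_sub_le {d : ℕ} {s : ℝ} {ζ : EuclideanSpace ℂ (Fin d)}
    (h : IsPhase s ζ) (ξ : Rd d) : |‖ξ + imVec ζ‖ ^ 2 - s ^ 2| ≤ ‖symbol ζ ξ‖ := by
  refine le_trans (le_of_eq ?_) (Complex.abs_re_le_norm _)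
  rw [(symbol_re_im ζ ξ).1, abs_neg, norm_add_sq_real, h.norm_sq.2.1, real_inner_comm]
  ring_nf

theorem abs_inner_reVec_le {d : ℕ} (ζ : EuclideanSpace ℂ (Fin d)) (ξ : Rd d) :
    |inner ℝ (reVec ζ) ξ| ≤ ‖symbol ζ ξ‖ := by
  refine le_trans ?_ (Complex.abs_im_le_norm _)
  rw [(symbol_re_im ζ ξ).2, abs_mul, abs_two]
  linarith [abs_nonneg (inner ℝ (reVec ζ) ξ)]

/-- A rotation invariant integrable weight on `ℝ^d`. -/
noncomputable def ballWeight {d : ℕ} (k : ℕ) (z : Rd d) : ℝ≥0∞ :=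
  ENNReal.ofReal (((1 + ‖z‖ ^ 2) ^ k)⁻¹)

@[fun_prop]
theorem measurable_ballWeight {d : ℕ} (k : ℕ) : Measurable (ballWeight (d := d) k) := by
  unfold ballWeight; fun_prop

theorem ballWeight_le_prod {d : ℕ} (e : OrthonormalBasis (Fin d) ℝ (Rd d)) (z : Rd d) :
    ballWeight d z ≤ ∏ i, decayWeight (e.repr z i) := by
  unfold ballWeight decayWeight
  rw [← ENNReal.ofReal_prod_of_nonneg fun i _ => by positivity, Finset.prod_inv_distrib]
  refine ENNReal.ofReal_le_ofReal (inv_anti₀ (Finset.prod_pos fun i _ => by positivity) ?_)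
  have h : ∏ i : Fin d, (1 + e.repr z i ^ 2) ≤ ∏ _i : Fin d, (1 + ‖z‖ ^ 2) := by
    refine Finset.prod_le_prod (fun i _ => by positivity) fun i _ => ?_
    rw [← e.repr.norm_map z, EuclideanSpace.real_norm_sq_eq]
    gcongr
    exact Finset.single_le_sum (f := fun i => e.repr z i ^ 2) (fun _ _ => sq_nonneg _)
      (Finset.mem_univ i)
  simpa using h

theorem continuous_symbol {d : ℕ} (ζ : EuclideanSpace ℂ (Fin d)) : Continuous (symbol ζ) := by
  unfold symbol; fun_prop

/-- In coordinates centred at −Im ζ along an orthonormal basis with first vector Re ζ / s, the real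
and imaginary parts of the symbol supply the two hypotheses of `inv_le_dominator`. This change of
variables preserves volume, and the weight is below a product of one-dimensional ones in every such
frame. -/
theorem exists_lintegral_ballWeight_mul_inv_symbol_le (d : ℕ) (hd : 3 ≤ d) :
    ∃ C : ℝ≥0∞, C ≠ ⊤ ∧ ∀ (s : ℝ), 0 < s → ∀ ζ : EuclideanSpace ℂ (Fin d), IsPhase s ζ →
      ∀ y : Rd d, ∫⁻ ξ, ballWeight d (ξ - y) * (ENNReal.ofReal ‖symbol ζ ξ‖)⁻¹ ≤
        C * ENNReal.ofReal (min 1 s⁻¹) := by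
  obtain ⟨n, rfl⟩ : ∃ n, d = n + 1 := ⟨d - 1, by omega⟩
  obtain ⟨C, hC, hb⟩ := exists_lintegral_prod_mul_dominator_le n
  refine ⟨ENNReal.ofReal (32 * (n + 1) ^ 3) * C, ENNReal.mul_ne_top ENNReal.ofReal_ne_top hC,
    fun s hs ζ hζ y => ?_⟩
  obtain ⟨h1, -, h3⟩ := hζ.norm_sq
  have h1' : ‖reVec ζ‖ = s := by
    rw [← abs_of_nonneg (norm_nonneg (reVec ζ)), ← abs_of_pos hs]; exact (sq_eq_sq_iff_abs_eq_abs _ _).1 h1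
  have hon : Orthonormal ℝ (({0} : Set (Fin (n + 1))).domRestrict
      fun _ : Fin (n + 1) => (s⁻¹ : ℝ) • reVec ζ) := by
    constructor
    · rintro ⟨i, hi⟩
      change ‖(s⁻¹ : ℝ) • reVec ζ‖ = 1
      rw [norm_smul, h1', Real.norm_of_nonneg (inv_pos.2 hs).le, inv_mul_cancel₀ hs.ne']
    · rintro ⟨i, hi⟩ ⟨j, hj⟩ hij
      exact absurd (Subtype.ext (hi.trans hj.symm)) hij
  obtain ⟨e, he⟩ := hon.exists_orthonormalBasis_extension_of_card_eq (by simp)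
  have he0 : e 0 = (s⁻¹ : ℝ) • reVec ζ := he 0 rfl
  set b := imVec ζ
  set X : Rd (n + 1) → Fin (n + 1) → ℝ := fun ξ i => e.repr (ξ + b) i with hX
  have hXmp : MeasurePreserving X volume volume :=
    (PiLp.volume_preserving_ofLp (Fin (n + 1))).comp
      ((e.measurePreserving_repr).comp (measurePreserving_add_right volume b))
  have hdom : Measurable fun x : Fin (n + 1) → ℝ => (∏ i, decayWeight (x i - X y i)) *
      dominator s x := by
    exact (measurable_prod_decayWeight _).mul (measurable_dominator s)
  have hpt : ∀ ξ, ballWeight (n + 1) (ξ - y) * (ENNReal.ofReal ‖symbol ζ ξ‖)⁻¹ ≤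
      ENNReal.ofReal (32 * (n + 1) ^ 3 * min 1 s⁻¹) *
        ((∏ i, decayWeight (X ξ i - X y i)) * dominator s (X ξ)) := by
    intro ξ
    have hw : ballWeight (n + 1) (ξ - y) ≤ ∏ i, decayWeight (X ξ i - X y i) := by
      refine (ballWeight_le_prod e (ξ - y)).trans (le_of_eq ?_)
      refine Finset.prod_congr rfl fun i _ => ?_
      simp only [hX, ← PiLp.sub_apply, ← map_sub, add_sub_add_right_eq_sub]
    have hP := inv_le_dominator (n := n) (P := ‖symbol ζ ξ‖) (by omega) hs (X ξ) ?_ ?_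
    · calc _ ≤ (∏ i, decayWeight (X ξ i - X y i)) *
            (ENNReal.ofReal (32 * (n + 1) ^ 3 * min 1 s⁻¹) * dominator s (X ξ)) :=
          mul_le_mul' hw hP
        _ = _ := by ring
    · have : ∑ i, X ξ i ^ 2 = ‖ξ + b‖ ^ 2 := by
        rw [← e.repr.norm_map (ξ + b), EuclideanSpace.real_norm_sq_eq]
      rw [this]; exact hζ.abs_norm_sq_sub_le ξ
    -- The shift by Im ζ does not affect the first coordinate, as Im ζ is orthogonal to Re ζ.
    · have : s * |X ξ 0| = |inner ℝ (reVec ζ) ξ| := by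
        simp only [hX, e.repr_apply_apply, he0, inner_smul_left, inner_add_right]
        rw [h3, mul_zero, add_zero, abs_mul, conj_trivial, abs_of_pos (inv_pos.2 hs), ← mul_assoc,
          mul_inv_cancel₀ hs.ne', one_mul]
      rw [this]; exact abs_inner_reVec_le ζ ξ
  calc _ ≤ ∫⁻ ξ, ENNReal.ofReal (32 * (n + 1) ^ 3 * min 1 s⁻¹) *
        ((∏ i, decayWeight (X ξ i - X y i)) * dominator s (X ξ)) := lintegral_mono hpt
    _ = ENNReal.ofReal (32 * (n + 1) ^ 3 * min 1 s⁻¹) *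
        ∫⁻ x : Fin (n + 1) → ℝ, (∏ i, decayWeight (x i - X y i)) * dominator s x := by
      rw [← hXmp.lintegral_comp hdom]
      exact lintegral_const_mul _ (hdom.comp hXmp.measurable)
    _ ≤ ENNReal.ofReal (32 * (n + 1) ^ 3 * min 1 s⁻¹) * C := mul_le_mul' le_rfl (hb s _)
    _ = _ := by rw [ENNReal.ofReal_mul (by positivity)]; ring

/-! ### Weighted Cauchy–Schwarz, and the symbol in the `2π` normalization -/

theorem eLpNorm_two_sq {α E : Type*} [MeasurableSpace α] [NormedAddCommGroup E] (μ : Measure α)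
    (f : α → E) : eLpNorm f 2 μ ^ 2 = ∫⁻ x, ‖f x‖ₑ ^ 2 ∂μ := by
  have h : (eLpNorm f 2 μ) ^ (2 : ℝ) = ∫⁻ x, ‖f x‖ₑ ^ (2 : ℝ) ∂μ := by
    simpa using eLpNorm_nnreal_pow_eq_lintegral (p := 2) (f := f) (μ := μ) (by norm_num)
  exact_mod_cast h

theorem lintegral_mul_sq_le {α : Type*} [MeasurableSpace α] {μ : Measure α} {f g : α → ℝ≥0∞}
    (hf : AEMeasurable f μ) (hg : AEMeasurable g μ) :
    (∫⁻ x, f x * g x ∂μ) ^ 2 ≤ (∫⁻ x, f x ^ 2 ∂μ) * ∫⁻ x, g x ^ 2 ∂μ := by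
  have h := ENNReal.lintegral_mul_le_Lp_mul_Lq μ Real.HolderConjugate.two_two hf hg
  simp only [Pi.mul_apply, ENNReal.rpow_two] at h
  refine (pow_le_pow_left' h 2).trans (le_of_eq ?_)
  rw [mul_pow, ← ENNReal.rpow_two, ← ENNReal.rpow_two, ← ENNReal.rpow_mul, ← ENNReal.rpow_mul]
  norm_num

theorem lintegral_weight_mul_sq_le {α : Type*} [MeasurableSpace α] {μ : Measure α}
    {w f : α → ℝ≥0∞} (hw : AEMeasurable w μ) (hf : AEMeasurable f μ) :
    (∫⁻ x, w x * f x ∂μ) ^ 2 ≤ (∫⁻ x, w x ∂μ) * ∫⁻ x, w x * f x ^ 2 ∂μ := by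
  have h := lintegral_mul_sq_le (μ := μ) (f := fun x => w x ^ (1 / 2 : ℝ))
    (g := fun x => w x ^ (1 / 2 : ℝ) * f x) (hw.pow_const _) ((hw.pow_const _).mul hf)
  have h1 : ∀ x, (w x ^ (1 / 2 : ℝ)) ^ 2 = w x := fun x => by
    rw [← ENNReal.rpow_natCast, ← ENNReal.rpow_mul]; norm_num
  simp only [mul_pow, h1, ← mul_assoc, ← sq] at h
  exact h

/-- The dilation by 2π only replaces ζ by ζ/(2π) and s by s/(2π), so the estimates above carry over
to this normalization of the Fourier transform. -/
theorem symbol_two_pi_smul {d : ℕ} (ζ : EuclideanSpace ℂ (Fin d)) (ξ : Rd d) :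
    symbol ζ ((2 * Real.pi) • ξ) =
      ((2 * Real.pi : ℝ) : ℂ) ^ 2 * symbol (((2 * Real.pi : ℝ) : ℂ)⁻¹ • ζ) ξ := by
  have hpi : ((2 * Real.pi : ℝ) : ℂ) ≠ 0 := by exact_mod_cast Real.two_pi_pos.ne'
  unfold symbol
  rw [norm_smul, Real.norm_of_nonneg Real.two_pi_pos.le]
  have h1 : ∑ j, ζ j * (((((2 * Real.pi) • ξ) j : ℝ)) : ℂ) =
      ((2 * Real.pi : ℝ) : ℂ) * ∑ j, ζ j * ((ξ j : ℝ) : ℂ) := by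
    rw [Finset.mul_sum]
    refine Finset.sum_congr rfl fun j _ => ?_
    rw [PiLp.smul_apply, smul_eq_mul, Complex.ofReal_mul]; ring
  have h2 : ∑ j, (((2 * Real.pi : ℝ) : ℂ)⁻¹ • ζ) j * ((ξ j : ℝ) : ℂ) =
      ((2 * Real.pi : ℝ) : ℂ)⁻¹ * ∑ j, ζ j * ((ξ j : ℝ) : ℂ) := by
    rw [Finset.mul_sum]
    refine Finset.sum_congr rfl fun j _ => ?_
    rw [PiLp.smul_apply, smul_eq_mul]; ring
  rw [h1, h2]
  generalize ((2 * Real.pi : ℝ)) = p at *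
  push_cast
  field_simp

theorem IsPhase.smul {d : ℕ} {s : ℝ} {ζ : EuclideanSpace ℂ (Fin d)} (h : IsPhase s ζ) {c : ℝ}
    (hc : 0 < c) : IsPhase (s / c) ((c : ℂ)⁻¹ • ζ) := by
  refine ⟨?_, ?_⟩
  · have : ∀ j, ((c : ℂ)⁻¹ • ζ) j * ((c : ℂ)⁻¹ • ζ) j = ((c : ℂ)⁻¹) ^ 2 * (ζ j * ζ j) := by
      intro j; rw [PiLp.smul_apply, smul_eq_mul]; ring
    simp_rw [this]
    rw [← Finset.mul_sum, h.1, mul_zero]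
  · rw [norm_smul, h.2, norm_inv, Complex.norm_real, Real.norm_of_nonneg hc.le]; ring

/-- The modulus of the symbol in the normalization of the Fourier transform of Mathlib. -/
noncomputable def absSymbol {d : ℕ} (ζ : EuclideanSpace ℂ (Fin d)) (ξ : Rd d) : ℝ≥0∞ :=
  ENNReal.ofReal ‖symbol ζ ((2 * Real.pi) • ξ)‖

@[fun_prop]
theorem measurable_absSymbol {d : ℕ} (ζ : EuclideanSpace ℂ (Fin d)) : Measurable (absSymbol ζ) := by
  have : Continuous fun ξ : Rd d => ‖symbol ζ ((2 * Real.pi) • ξ)‖ :=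
    ((continuous_symbol ζ).comp (continuous_const_smul _)).norm
  exact ENNReal.measurable_ofReal.comp this.measurable

theorem absSymbol_eq {d : ℕ} (ζ : EuclideanSpace ℂ (Fin d)) (ξ : Rd d) :
    absSymbol ζ ξ = ENNReal.ofReal ((2 * Real.pi) ^ 2) *
      ENNReal.ofReal ‖symbol (((2 * Real.pi : ℝ) : ℂ)⁻¹ • ζ) ξ‖ := by
  rw [absSymbol, symbol_two_pi_smul, norm_mul, ENNReal.ofReal_mul (norm_nonneg _), norm_pow,
    Complex.norm_real, Real.norm_of_nonneg Real.two_pi_pos.le]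

theorem exists_lintegral_inv_absSymbol_le (d : ℕ) (hd : 3 ≤ d) :
    ∃ C : ℝ≥0∞, C ≠ ⊤ ∧ ∀ (s : ℝ), 0 < s → ∀ ζ : EuclideanSpace ℂ (Fin d), IsPhase s ζ →
      ∀ y : Rd d, ∫⁻ ξ, ballWeight d (ξ - y) * (absSymbol ζ ξ)⁻¹ ≤
        C * ENNReal.ofReal (min 1 s⁻¹) := by
  obtain ⟨C, hC, hb⟩ := exists_lintegral_ballWeight_mul_inv_symbol_le d hd
  refine ⟨C, hC, fun s hs ζ hζ y => ?_⟩
  have hpi := Real.two_pi_pos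
  have h := hb _ (div_pos hs hpi) _ (hζ.smul hpi) y
  have h1 : ∀ ξ, ballWeight d (ξ - y) * (absSymbol ζ ξ)⁻¹ =
      ENNReal.ofReal ((2 * Real.pi) ^ 2)⁻¹ * (ballWeight d (ξ - y) *
        (ENNReal.ofReal ‖symbol (((2 * Real.pi : ℝ) : ℂ)⁻¹ • ζ) ξ‖)⁻¹) := by
    intro ξ
    rw [absSymbol_eq, ENNReal.mul_inv (Or.inl (ENNReal.ofReal_pos.2 (by positivity)).ne')
      (Or.inl ENNReal.ofReal_ne_top), ENNReal.ofReal_inv_of_pos (by positivity)]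
    ring
  simp_rw [h1]
  rw [lintegral_const_mul' _ _ ENNReal.ofReal_ne_top]
  refine (mul_le_mul' le_rfl h).trans ?_
  rw [mul_left_comm, ← ENNReal.ofReal_mul (by positivity)]
  refine mul_le_mul' le_rfl (ENNReal.ofReal_le_ofReal ?_)
  have hp1 : 1 ≤ 2 * Real.pi := by linarith [Real.pi_gt_three]
  rw [inv_div, inv_mul_le_iff₀ (by positivity), mul_min_of_nonneg _ _ (by positivity)]
  refine min_le_min ?_ ?_
  · rw [mul_one]; exact one_le_pow₀ hp1
  · rw [div_eq_mul_inv]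
    gcongr
    exact le_self_pow₀ hp1 (by norm_num)

theorem lintegral_ballWeight_lt_top (d : ℕ) : ∫⁻ z : Rd d, ballWeight (d + 1) z < ⊤ := by
  have h := (integrable_rpow_neg_one_add_norm_sq (E := Rd d) (μ := volume) (r := 2 * (d + 1))
    (by simp; linarith)).2
  refine lt_of_le_of_lt (le_of_eq ?_) h
  refine lintegral_congr fun z => ?_
  rw [ballWeight, Real.enorm_of_nonneg (by positivity)]
  congr 1
  simp only
  rw [neg_div, Real.rpow_neg (by positivity)]
  congr 1
  rw [mul_div_cancel_left₀ _ (by norm_num)]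
  exact_mod_cast (Real.rpow_natCast _ _).symm

/-- If 2π|ξ| ≥ 4s the symbol is elliptic: |2πξ|² − 2s|2πξ| is at least half of |2πξ|². Otherwise |ξ|
≤ s. -/
theorem IsPhase.norm_sq_mul_inv_absSymbol_le {d : ℕ} {s : ℝ} (hs : 0 < s)
    {ζ : EuclideanSpace ℂ (Fin d)} (h : IsPhase s ζ) (ξ : Rd d) :
    ENNReal.ofReal (‖ξ‖ ^ 2) * (absSymbol ζ ξ)⁻¹ ≤
      1 + ENNReal.ofReal (s ^ 2) * (absSymbol ζ ξ)⁻¹ := by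
  have hb : ‖imVec ζ‖ = s := by
    rw [← abs_of_nonneg (norm_nonneg (imVec ζ)), ← abs_of_pos hs]
    exact (sq_eq_sq_iff_abs_eq_abs _ _).1 h.norm_sq.2.1
  have hpi : 1 ≤ Real.pi := by linarith [Real.pi_gt_three]
  rcases le_total (4 * s) (2 * Real.pi * ‖ξ‖) with h1 | h1
  · refine le_trans ?_ le_self_add
    rw [← div_eq_mul_inv]
    refine ENNReal.div_le_of_le_mul ?_
    rw [one_mul, absSymbol]
    refine ENNReal.ofReal_le_ofReal ?_
    refine le_trans ?_ ((neg_le_abs _).trans (Complex.abs_re_le_norm _))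
    rw [(symbol_re_im ζ _).1, norm_smul, Real.norm_of_nonneg (by positivity)]
    have h2 := (neg_le_abs _).trans (abs_real_inner_le_norm (imVec ζ) ((2 * Real.pi) • ξ))
    rw [hb, norm_smul, Real.norm_of_nonneg (by positivity)] at h2
    nlinarith [norm_nonneg ξ, mul_le_mul_of_nonneg_right h1 (by positivity : 0 ≤ 2 * Real.pi * ‖ξ‖),
      mul_le_mul hpi hpi zero_le_one (by positivity), sq_nonneg ‖ξ‖,
      mul_nonneg (sub_nonneg.2 (mul_le_mul hpi hpi zero_le_one (by positivity))) (sq_nonneg ‖ξ‖)]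
  · refine le_trans ?_ le_add_self
    gcongr
    have : 6 * ‖ξ‖ ≤ 2 * Real.pi * ‖ξ‖ := by
      gcongr; linarith [Real.pi_gt_three]
    linarith

theorem ballWeight_mul_norm_sq_le {d : ℕ} (k : ℕ) (z : Rd d) :
    ballWeight (k + 1) z * ENNReal.ofReal (‖z‖ ^ 2) ≤ ballWeight k z := by
  unfold ballWeight
  rw [← ENNReal.ofReal_mul (by positivity)]
  refine ENNReal.ofReal_le_ofReal ?_
  rw [← div_eq_inv_mul, ← one_div, div_le_div_iff₀ (by positivity) (by positivity), pow_succ (1 + ‖z‖ ^ 2)]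
  nlinarith [show 0 < (1 + ‖z‖ ^ 2) ^ k by positivity]

theorem ballWeight_succ_le {d : ℕ} (k : ℕ) (z : Rd d) : ballWeight (k + 1) z ≤ ballWeight k z := by
  unfold ballWeight
  refine ENNReal.ofReal_le_ofReal (inv_anti₀ (by positivity) ?_)
  exact pow_le_pow_right₀ (by nlinarith [sq_nonneg ‖z‖]) (by omega)

/-- Split |y|² ≤ 2|ξ|² + 2|ξ − y|². One extra power of the weight absorbs |ξ − y|². For |ξ|² the
preceding ellipticity bound leaves an integrable term and s² times the earlier integral, and s²
min(1, 1/s) ≤ s. -/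
theorem exists_norm_sq_mul_lintegral_inv_absSymbol_le (d : ℕ) (hd : 3 ≤ d) :
    ∃ C : ℝ≥0∞, C ≠ ⊤ ∧ ∀ (s : ℝ), 0 < s → ∀ ζ : EuclideanSpace ℂ (Fin d), IsPhase s ζ →
      ∀ y : Rd d, ENNReal.ofReal (‖y‖ ^ 2) *
        ∫⁻ ξ, ballWeight (d + 1) (ξ - y) * (absSymbol ζ ξ)⁻¹ ≤ C * ENNReal.ofReal (max 1 s) := by
  obtain ⟨C, hC, hb⟩ := exists_lintegral_inv_absSymbol_le d hd
  set I := ∫⁻ z : Rd d, ballWeight (d + 1) z with hI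
  refine ⟨2 * I + 2 * C + 2 * C, ?_, fun s hs ζ hζ y => ?_⟩
  · have := (lintegral_ballWeight_lt_top d).ne
    have h2 : (2 : ℝ≥0∞) ≠ ⊤ := by norm_num
    exact ENNReal.add_ne_top.2 ⟨ENNReal.add_ne_top.2 ⟨ENNReal.mul_ne_top h2 this,
      ENNReal.mul_ne_top h2 hC⟩, ENNReal.mul_ne_top h2 hC⟩
  have hpt : ∀ ξ, ENNReal.ofReal (‖y‖ ^ 2) * (ballWeight (d + 1) (ξ - y) * (absSymbol ζ ξ)⁻¹) ≤
      2 * ballWeight (d + 1) (ξ - y) +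
      (2 * ENNReal.ofReal (s ^ 2) * (ballWeight d (ξ - y) * (absSymbol ζ ξ)⁻¹) +
        2 * (ballWeight d (ξ - y) * (absSymbol ζ ξ)⁻¹)) := by
    intro ξ
    set w := ballWeight (d + 1) (ξ - y)
    set w' := ballWeight d (ξ - y)
    set p := (absSymbol ζ ξ)⁻¹
    have h1 : ENNReal.ofReal (‖y‖ ^ 2) ≤
        2 * ENNReal.ofReal (‖ξ‖ ^ 2) + 2 * ENNReal.ofReal (‖ξ - y‖ ^ 2) := by
      have e2 : (2 : ℝ≥0∞) = ENNReal.ofReal 2 := by simp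
      simp only [e2]
      rw [← ENNReal.ofReal_mul (by norm_num),
        ← ENNReal.ofReal_mul (by norm_num), ← ENNReal.ofReal_add (by positivity) (by positivity)]
      refine ENNReal.ofReal_le_ofReal ?_
      have : ‖y‖ ≤ ‖ξ‖ + ‖ξ - y‖ := by
        have := norm_sub_le ξ (ξ - y); rwa [sub_sub_cancel] at this
      nlinarith [norm_nonneg y, sq_nonneg (‖ξ‖ - ‖ξ - y‖)]
    calc _ ≤ (2 * ENNReal.ofReal (‖ξ‖ ^ 2) + 2 * ENNReal.ofReal (‖ξ - y‖ ^ 2)) * (w * p) :=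
          mul_le_mul' h1 le_rfl
      _ = 2 * (w * (ENNReal.ofReal (‖ξ‖ ^ 2) * p)) +
          2 * (w * ENNReal.ofReal (‖ξ - y‖ ^ 2) * p) := by ring
      _ ≤ 2 * (w * (1 + ENNReal.ofReal (s ^ 2) * p)) + 2 * (w' * p) := by
          gcongr
          · exact hζ.norm_sq_mul_inv_absSymbol_le hs ξ
          · exact ballWeight_mul_norm_sq_le d _
      _ = 2 * w + (2 * ENNReal.ofReal (s ^ 2) * (w * p) + 2 * (w' * p)) := by ring
      _ ≤ _ := by
          gcongr
          exact ballWeight_succ_le d _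
  rw [← lintegral_const_mul' _ _ ENNReal.ofReal_ne_top]
  refine (lintegral_mono hpt).trans ?_
  rw [lintegral_add_left (by fun_prop), lintegral_add_left (by fun_prop),
    lintegral_const_mul _ (by fun_prop), lintegral_const_mul _ (by fun_prop),
    lintegral_const_mul _ (by fun_prop),
    lintegral_sub_right_eq_self (fun z => ballWeight (d + 1) z) y, ← hI, ← add_assoc, add_mul, add_mul]
  have hmin : min 1 s⁻¹ ≤ max 1 s := (min_le_left _ _).trans (le_max_left _ _)
  refine add_le_add (add_le_add ?_ ?_) ?_
  · exact le_mul_of_one_le_right' (ENNReal.one_le_ofReal.2 (le_max_left _ _))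
  · refine (mul_le_mul' le_rfl (hb s hs ζ hζ y)).trans ?_
    calc _ = 2 * C * (ENNReal.ofReal (s ^ 2) * ENNReal.ofReal (min 1 s⁻¹)) := by ring
      _ ≤ _ := by
        gcongr
        rw [← ENNReal.ofReal_mul (by positivity)]
        refine ENNReal.ofReal_le_ofReal ?_
        calc s ^ 2 * min 1 s⁻¹ ≤ s ^ 2 * s⁻¹ := by gcongr; exact min_le_right _ _
          _ = s := by field_simp
          _ ≤ _ := le_max_right _ _
  · refine (mul_le_mul' le_rfl (hb s hs ζ hζ y)).trans ?_
    rw [← mul_assoc]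
    gcongr

/-! ### Duality: localizing `u` by a Schwartz function -/

theorem exists_enorm_schwartz_le {d : ℕ} (Φ : 𝓢(Rd d, ℂ)) (k : ℕ) :
    ∃ C : ℝ≥0∞, C ≠ ⊤ ∧ ∀ z, ‖Φ z‖ₑ ≤ C * ballWeight k z := by
  set C := 2 ^ (2 * k) * (Finset.Iic (2 * k, 0)).sup
    (fun m => SchwartzMap.seminorm ℝ m.1 m.2) Φ with hC
  refine ⟨ENNReal.ofReal C, ENNReal.ofReal_ne_top, fun z => ?_⟩
  have h := SchwartzMap.one_add_le_sup_seminorm_apply (𝕜 := ℝ) (m := (2 * k, 0)) (k := 2 * k)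
    (n := 0) le_rfl le_rfl Φ z
  rw [norm_iteratedFDeriv_zero] at h
  have h2 : (1 + ‖z‖ ^ 2) ^ k * ‖Φ z‖ ≤ C := by
    refine le_trans ?_ h
    rw [pow_mul]
    gcongr
    nlinarith [norm_nonneg z]
  have hC0 : 0 ≤ C := le_trans (by positivity) h2
  rw [ballWeight, ← ENNReal.ofReal_mul hC0, ← ofReal_norm]
  refine ENNReal.ofReal_le_ofReal ?_
  rw [← div_eq_mul_inv, le_div_iff₀ (by positivity)]
  linarith

/-- A real test function, viewed as a complex valued Schwartz function. -/
noncomputable def testSchwartz {d : ℕ} (φ : Rd d → ℝ) (h1 : ContDiff ℝ ∞ φ)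
    (h2 : HasCompactSupport φ) : 𝓢(Rd d, ℂ) :=
  HasCompactSupport.toSchwartzMap (f := fun x => (φ x : ℂ))
    (h2.comp_left (g := fun t : ℝ => (t : ℂ)) Complex.ofReal_zero)
    (Complex.ofRealCLM.contDiff.comp h1)

@[simp]
theorem testSchwartz_apply {d : ℕ} (φ : Rd d → ℝ) (h1 : ContDiff ℝ ∞ φ)
    (h2 : HasCompactSupport φ) (x : Rd d) : testSchwartz φ h1 h2 x = (φ x : ℂ) := rfl

theorem exists_cutoff {d : ℕ} (K : Set (Rd d)) (hK : Bornology.IsBounded K) :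
    ∃ φ : Rd d → ℝ, ContDiff ℝ ∞ φ ∧ HasCompactSupport φ ∧ (∀ x ∈ K, φ x = 1) ∧
      ∀ x, 0 ≤ φ x ∧ φ x ≤ 1 := by
  obtain ⟨R, hR, hKR⟩ := hK.subset_closedBall_lt 0 0
  let b : ContDiffBump (0 : Rd d) := ⟨R, R + 1, hR, by linarith⟩
  exact ⟨b, b.contDiff, b.hasCompactSupport, fun x hx => b.one_of_mem_closedBall (hKR hx),
    fun x => ⟨b.nonneg, b.le_one⟩⟩

theorem locallyIntegrable_of_integrable_mul_schwartz {d : ℕ} {f : Rd d → ℂ}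
    (h : ∀ φ : 𝓢(Rd d, ℂ), Integrable fun x => f x * φ x) : LocallyIntegrable f volume := by
  rw [locallyIntegrable_iff]
  intro K hK
  obtain ⟨φ, h1, h2, h3, -⟩ := exists_cutoff K hK.isBounded
  refine (h (testSchwartz φ h1 h2)).integrableOn.congr_fun (fun x hx => ?_) hK.measurableSet
  simp [h3 x hx]

theorem IsFourierTransform.integrable_mul {d : ℕ} {u U : Rd d → ℂ} (h : IsFourierTransform u U)
    (φ : 𝓢(Rd d, ℂ)) : Integrable fun x => u x * φ x := by
  have := (h (𝓕⁻ φ)).1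
  rwa [FourierTransform.fourier_fourierInv_eq] at this

theorem IsFourierTransform.locallyIntegrable {d : ℕ} {u U : Rd d → ℂ}
    (h : IsFourierTransform u U) : LocallyIntegrable u volume ∧ LocallyIntegrable U volume :=
  ⟨locallyIntegrable_of_integrable_mul_schwartz h.integrable_mul,
    locallyIntegrable_of_integrable_mul_schwartz fun φ => (h φ).2.1⟩

theorem enorm_convolution_le {d : ℕ} (Φ Ψ : 𝓢(Rd d, ℂ)) (η : Rd d) :
    ‖SchwartzMap.convolution (ContinuousLinearMap.mul ℂ ℂ) Φ Ψ η‖ₑ ≤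
      ∫⁻ ξ, ‖Φ (η - ξ)‖ₑ * ‖Ψ ξ‖ₑ := by
  rw [SchwartzMap.convolution_apply, convolution_eq_swap]
  refine (enorm_integral_le_lintegral_enorm _).trans (le_of_eq ?_)
  simp [enorm_mul]

/-- Cauchy–Schwarz with the weight |Φ(η − y)| bounds |Φ ∗ Ψ|² by the mass of Φ times |Φ| ∗ |Ψ|².
Tonelli then transfers `p` to its average around `y`. -/
theorem lintegral_inv_mul_convolution_sq_le {d : ℕ} (Φ Ψ : 𝓢(Rd d, ℂ)) {p : Rd d → ℝ≥0∞}
    (hp : Measurable p) :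
    ∫⁻ η, p η * ‖SchwartzMap.convolution (ContinuousLinearMap.mul ℂ ℂ) Φ Ψ η‖ₑ ^ 2 ≤
      (∫⁻ z, ‖Φ z‖ₑ) * ∫⁻ y, ‖Ψ y‖ₑ ^ 2 * ∫⁻ ξ, ‖Φ (ξ - y)‖ₑ * p ξ := by
  have hΦ : Measurable fun z => ‖Φ z‖ₑ := Φ.continuous.measurable.enorm
  have hΨ : Measurable fun z => ‖Ψ z‖ₑ := Ψ.continuous.measurable.enorm
  have hΦ1 : ∀ η, Measurable fun y => ‖Φ (η - y)‖ₑ := fun η =>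
    hΦ.comp (measurable_const.sub measurable_id)
  have hΦ2 : Measurable fun q : Rd d × Rd d => ‖Φ (q.1 - q.2)‖ₑ :=
    hΦ.comp (measurable_fst.sub measurable_snd)
  have h1 : ∀ η, p η * ‖SchwartzMap.convolution (ContinuousLinearMap.mul ℂ ℂ) Φ Ψ η‖ₑ ^ 2 ≤
      (∫⁻ z, ‖Φ z‖ₑ) * ∫⁻ y, p η * (‖Φ (η - y)‖ₑ * ‖Ψ y‖ₑ ^ 2) := by
    intro η
    have e : ∫⁻ y, p η * (‖Φ (η - y)‖ₑ * ‖Ψ y‖ₑ ^ 2) = p η * ∫⁻ y, ‖Φ (η - y)‖ₑ * ‖Ψ y‖ₑ ^ 2 :=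
      lintegral_const_mul _ ((hΦ1 η).mul (hΨ.pow_const 2))
    rw [e, mul_left_comm]
    refine mul_le_mul' le_rfl ?_
    refine (pow_le_pow_left' (enorm_convolution_le Φ Ψ η) 2).trans ?_
    refine (lintegral_weight_mul_sq_le (hΦ1 η).aemeasurable hΨ.aemeasurable).trans ?_
    rw [lintegral_sub_left_eq_self (fun z => ‖Φ z‖ₑ) η]
  refine (lintegral_mono h1).trans ?_
  rw [lintegral_const_mul']
  swap
  · exact (Φ.integrable (μ := volume)).2.ne
  refine mul_le_mul' le_rfl ?_
  rw [lintegral_lintegral_swap]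
  swap
  · exact (((hp.comp measurable_fst).mul
      (hΦ2.mul ((hΨ.comp measurable_snd).pow_const 2)))).aemeasurable
  refine lintegral_mono fun y => ?_
  rw [← lintegral_const_mul']
  swap
  · simp
  refine lintegral_mono fun ξ => le_of_eq ?_
  ring

/-- The weighted norm of a Fourier transform that occurs in the definition of `Ẋ^{1/2}_ζ`. -/
noncomputable def weightedNorm {d : ℕ} (ζ : EuclideanSpace ℂ (Fin d)) (U : Rd d → ℂ) : ℝ≥0∞ :=
  eLpNorm (fun ξ => ((‖symbol ζ ((2 * Real.pi) • ξ)‖ ^ (1 / 2 : ℝ) : ℝ) : ℂ) * U ξ) 2 volume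

theorem weightedNorm_sq {d : ℕ} (ζ : EuclideanSpace ℂ (Fin d)) (U : Rd d → ℂ) :
    weightedNorm ζ U ^ 2 = ∫⁻ ξ, absSymbol ζ ξ * ‖U ξ‖ₑ ^ 2 := by
  rw [weightedNorm, eLpNorm_two_sq]
  refine lintegral_congr fun ξ => ?_
  rw [enorm_mul, mul_pow, absSymbol]
  congr 1
  rw [← ofReal_norm, Complex.norm_real, Real.norm_of_nonneg (by positivity),
    ← ENNReal.ofReal_pow (by positivity), ← Real.rpow_natCast, ← Real.rpow_mul (norm_nonneg _)]
  norm_num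

/-- Since φ·𝓕Ψ is the Fourier transform of 𝓕⁻¹φ ∗ Ψ, the pairing moves to the Fourier side. There
Cauchy–Schwarz splits it into |p|^½ U and |p|^(-½) times the convolution. -/
theorem IsFourierTransform.enorm_integral_sq_le {d : ℕ} {u U : Rd d → ℂ}
    (h : IsFourierTransform u U) {ζ : EuclideanSpace ℂ (Fin d)}
    (hP : ∀ᵐ ξ, absSymbol ζ ξ ≠ 0) (φ Ψ : 𝓢(Rd d, ℂ)) :
    ‖∫ x, u x * (φ x * (𝓕 Ψ) x)‖ₑ ^ 2 ≤ weightedNorm ζ U ^ 2 *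
      ((∫⁻ z, ‖(𝓕⁻ φ) z‖ₑ) * ∫⁻ y, ‖Ψ y‖ₑ ^ 2 *
        ∫⁻ ξ, ‖(𝓕⁻ φ) (ξ - y)‖ₑ * (absSymbol ζ ξ)⁻¹) := by
  set χ := SchwartzMap.convolution (ContinuousLinearMap.mul ℂ ℂ) (𝓕⁻ φ) Ψ with hχ
  have h1 : ∀ x, (𝓕 χ) x = φ x * (𝓕 Ψ) x := by
    intro x
    rw [hχ, SchwartzMap.fourier_convolution, FourierTransform.fourier_fourierInv_eq]
    simp
  have h2 := (h χ).2.2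
  simp only [h1] at h2
  rw [h2, weightedNorm_sq]
  have hU : AEMeasurable (fun ξ => ‖U ξ‖ₑ) :=
    h.locallyIntegrable.2.aestronglyMeasurable.enorm
  have hpm := measurable_absSymbol ζ
  have hχm : Measurable fun ξ => ‖χ ξ‖ₑ := χ.continuous.measurable.enorm
  calc ‖∫ ξ, U ξ * χ ξ‖ₑ ^ 2 ≤ (∫⁻ ξ, ‖U ξ * χ ξ‖ₑ) ^ 2 :=
        pow_le_pow_left' (enorm_integral_le_lintegral_enorm _) 2
    _ ≤ (∫⁻ ξ, ((absSymbol ζ ξ) ^ (1 / 2 : ℝ) * ‖U ξ‖ₑ) *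
          (((absSymbol ζ ξ)⁻¹) ^ (1 / 2 : ℝ) * ‖χ ξ‖ₑ)) ^ 2 := by
        refine pow_le_pow_left' (lintegral_mono_ae ?_) 2
        filter_upwards [hP] with ξ hξ
        rw [enorm_mul, ENNReal.inv_rpow]
        have h3 : (absSymbol ζ ξ) ^ (1 / 2 : ℝ) * ((absSymbol ζ ξ) ^ (1 / 2 : ℝ))⁻¹ = 1 := by
          refine ENNReal.mul_inv_cancel ?_ ?_
          · rw [ne_eq, ENNReal.rpow_eq_zero_iff]; push Not
            exact ⟨fun h => absurd h hξ, fun h => by norm_num⟩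
          · exact ENNReal.rpow_ne_top_of_nonneg (by norm_num) ENNReal.ofReal_ne_top
        calc ‖U ξ‖ₑ * ‖χ ξ‖ₑ = ((absSymbol ζ ξ) ^ (1 / 2 : ℝ) *
              ((absSymbol ζ ξ) ^ (1 / 2 : ℝ))⁻¹) * (‖U ξ‖ₑ * ‖χ ξ‖ₑ) := by rw [h3, one_mul]
          _ ≤ _ := le_of_eq (by ring)
    _ ≤ (∫⁻ ξ, absSymbol ζ ξ * ‖U ξ‖ₑ ^ 2) * ∫⁻ ξ, (absSymbol ζ ξ)⁻¹ * ‖χ ξ‖ₑ ^ 2 := by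
        refine (lintegral_mul_sq_le (f := fun ξ => (absSymbol ζ ξ) ^ (1 / 2 : ℝ) * ‖U ξ‖ₑ)
          (g := fun ξ => ((absSymbol ζ ξ)⁻¹) ^ (1 / 2 : ℝ) * ‖χ ξ‖ₑ) ((hpm.pow_const _).aemeasurable.mul hU)
          ((hpm.inv.pow_const _).mul hχm).aemeasurable).trans (le_of_eq ?_)
        have h4 : ∀ a : ℝ≥0∞, (a ^ (1 / 2 : ℝ)) ^ 2 = a := fun a => by
          rw [← ENNReal.rpow_natCast, ← ENNReal.rpow_mul]; norm_num
        simp only [mul_pow, h4]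
    _ ≤ _ := by
        gcongr
        exact lintegral_inv_mul_convolution_sq_le _ _ hpm.inv

/-- The reciprocal has a finite integral against a positive weight, so it is finite almost
everywhere. -/
theorem IsPhase.ae_absSymbol_ne_zero {d : ℕ} (hd : 3 ≤ d) {s : ℝ} (hs : 0 < s)
    {ζ : EuclideanSpace ℂ (Fin d)} (hζ : IsPhase s ζ) : ∀ᵐ ξ, absSymbol ζ ξ ≠ 0 := by
  obtain ⟨C, hC, hb⟩ := exists_lintegral_inv_absSymbol_le d hd
  have h := (hb s hs ζ hζ 0).trans_lt (ENNReal.mul_lt_top hC.lt_top ENNReal.ofReal_lt_top)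
  filter_upwards [ae_lt_top (by fun_prop) h.ne] with ξ hξ h0
  rw [h0, ENNReal.inv_zero, ENNReal.mul_top] at hξ
  · exact absurd hξ (lt_irrefl _)
  · rw [ballWeight, ne_eq, ENNReal.ofReal_eq_zero, not_le]; positivity

/-- The norm is an infimum over representatives of û; a bound valid for each of them passes to the
infimum. -/
theorem le_mul_dotXNorm {d : ℕ} {ζ : EuclideanSpace ℂ (Fin d)} {u : Rd d → ℂ}
    (hu : dotXNorm ζ (1 / 2) u < ⊤) {a c : ℝ≥0∞} (hc : c ≠ ⊤)
    (h : ∀ U, IsFourierTransform u U → a ≤ weightedNorm ζ U * c) :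
    a ≤ dotXNorm ζ (1 / 2) u * c := by
  rw [← ENNReal.div_le_iff_le_mul (Or.inr hu.ne) (Or.inl hc)]
  exact le_iInf₂ fun U hU => ENNReal.div_le_of_le_mul (h U hU)

theorem exists_isFourierTransform {d : ℕ} {ζ : EuclideanSpace ℂ (Fin d)} {b : ℝ} {u : Rd d → ℂ}
    (hu : dotXNorm ζ b u < ⊤) : ∃ U, IsFourierTransform u U := by
  by_contra! hc
  simp [dotXNorm, hc] at hu

/-- Density of Schwartz functions in L² extends the functional, and the Riesz representation theorem
supplies the function. -/
theorem exists_memLp_of_norm_le {d : ℕ} (l : 𝓢(Rd d, ℂ) →ₗ[ℂ] ℂ) {A : ℝ} (hA : 0 ≤ A)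
    (h : ∀ ψ : 𝓢(Rd d, ℂ), ‖l ψ‖ ≤ A * ‖ψ.toLp 2 volume‖) :
    ∃ f : Rd d → ℂ, MemLp f 2 volume ∧ eLpNorm f 2 volume ≤ ENNReal.ofReal A ∧
      ∀ ψ : 𝓢(Rd d, ℂ), l ψ = ∫ x, f x * ψ x := by
  set e : 𝓢(Rd d, ℂ) →ₗ[ℂ] Lp ℂ 2 (volume : Measure (Rd d)) :=
    (SchwartzMap.toLpCLM ℂ ℂ 2 volume).toLinearMap with he
  have hdense : DenseRange e := SchwartzMap.denseRange_toLpCLM (p := 2) (by norm_num)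
  set T := l.extendOfNorm e
  have hT : ∀ ψ, T (e ψ) = l ψ := LinearMap.extendOfNorm_eq hdense ⟨A, h⟩
  have hTn : ‖T‖ ≤ A := ContinuousLinearMap.opNorm_le_bound _ hA
    (LinearMap.norm_extendOfNorm_apply_le hdense A h)
  set w := (InnerProductSpace.toDual ℂ (Lp ℂ 2 (volume : Measure (Rd d)))).symm T with hw
  have hwn : ‖w‖ ≤ A := by rw [hw, LinearIsometryEquiv.norm_map]; exact hTn
  -- The pairing is bilinear while the inner product is conjugate linear in its first argument,
  -- hence the conjugate of the Riesz vector.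
  refine ⟨fun x => (starRingEnd ℂ) (w x), (Lp.memLp w).star, ?_, fun ψ => ?_⟩
  · have : eLpNorm (fun x => (starRingEnd ℂ) (w x)) 2 volume = eLpNorm w 2 volume :=
      eLpNorm_congr_norm_ae (Eventually.of_forall fun x => by simp)
    rw [this, ← Lp.enorm_def, ← ofReal_norm]
    exact ENNReal.ofReal_le_ofReal hwn
  · rw [← hT ψ, ← InnerProductSpace.toDual_symm_apply, ← hw, L2.inner_def]
    refine integral_congr_ae ?_
    filter_upwards [SchwartzMap.coeFn_toLp ψ 2 volume] with x hx
    simp only [he, ContinuousLinearMap.coe_coe, SchwartzMap.toLpCLM_apply, hx, RCLike.inner_apply]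
    ring

theorem eLpNorm_fourierInv_eq {d : ℕ} (ψ : 𝓢(Rd d, ℂ)) :
    eLpNorm (𝓕⁻ ψ : 𝓢(Rd d, ℂ)) 2 volume = eLpNorm ψ 2 volume := by
  have h := SchwartzMap.norm_fourier_toL2_eq (𝓕⁻ ψ : 𝓢(Rd d, ℂ))
  rw [FourierTransform.fourier_fourierInv_eq, SchwartzMap.norm_toLp, SchwartzMap.norm_toLp] at h
  exact ((ENNReal.toReal_eq_toReal_iff' (SchwartzMap.eLpNorm_lt_top _ 2 volume).ne
    (SchwartzMap.eLpNorm_lt_top _ 2 volume).ne).1 h).symm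

/-- The operator `Λ` lets one argument serve twice: the identity yields φu, and a directional
derivative yields, up to sign, a partial derivative of φu. The hypothesis `hΛ` is the bound for the
Fourier multiplier that arises in each case. -/
theorem exists_memLp_pairing {d : ℕ} (hd : 3 ≤ d) (φ : 𝓢(Rd d, ℂ))
    (Λ : 𝓢(Rd d, ℂ) →ₗ[ℂ] 𝓢(Rd d, ℂ)) {κ : ℝ≥0∞} (hκ : κ ≠ ⊤) {s : ℝ} (hs : 0 < s)
    {ζ : EuclideanSpace ℂ (Fin d)} (hζ : IsPhase s ζ)
    (hΛ : ∀ ψ : 𝓢(Rd d, ℂ), ∫⁻ y, ‖(𝓕⁻ (Λ ψ)) y‖ₑ ^ 2 *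
        ∫⁻ ξ, ‖(𝓕⁻ φ) (ξ - y)‖ₑ * (absSymbol ζ ξ)⁻¹ ≤ κ * ∫⁻ y, ‖(𝓕⁻ ψ) y‖ₑ ^ 2)
    {u : Rd d → ℂ} (hu : dotXNorm ζ (1 / 2) u < ⊤) :
    ∃ f : Rd d → ℂ, MemLp f 2 volume ∧ eLpNorm f 2 volume ≤
      dotXNorm ζ (1 / 2) u * ((∫⁻ z, ‖(𝓕⁻ φ) z‖ₑ) * κ) ^ (1 / 2 : ℝ) ∧
      ∀ ψ : 𝓢(Rd d, ℂ), ∫ x, u x * (φ x * (Λ ψ) x) = ∫ x, f x * ψ x := by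
  obtain ⟨U₀, hU₀⟩ := exists_isFourierTransform hu
  set B : ContinuousLinearMap (RingHom.id ℂ) ℂ (ℂ →L[ℂ] ℂ) := ContinuousLinearMap.mul ℂ ℂ
  have hint : ∀ χ : 𝓢(Rd d, ℂ), Integrable fun x => u x * (φ x * χ x) := fun χ => by
    simpa [B] using hU₀.integrable_mul (SchwartzMap.pairing B φ χ)
  let l : 𝓢(Rd d, ℂ) →ₗ[ℂ] ℂ :=
    { toFun := fun ψ => ∫ x, u x * (φ x * (Λ ψ) x)
      map_add' := fun ψ₁ ψ₂ => by
        rw [← integral_add (hint _) (hint _)]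
        refine integral_congr_ae (Eventually.of_forall fun x => ?_)
        simp only [map_add, add_apply]; ring
      map_smul' := fun c ψ => by
        rw [RingHom.id_apply, ← integral_smul]
        refine integral_congr_ae (Eventually.of_forall fun x => ?_)
        simp only [map_smul, smul_apply, smul_eq_mul]; ring }
  set M := (∫⁻ z, ‖(𝓕⁻ φ) z‖ₑ) * κ with hM
  have hM' : M ≠ ⊤ := ENNReal.mul_ne_top ((𝓕⁻ φ).integrable (μ := volume)).2.ne hκ
  have hM2 : M ^ (1 / 2 : ℝ) ≠ ⊤ := ENNReal.rpow_ne_top_of_nonneg (by norm_num) hM'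
  have hA : dotXNorm ζ (1 / 2) u * M ^ (1 / 2 : ℝ) ≠ ⊤ := ENNReal.mul_ne_top hu.ne hM2
  have hbound : ∀ ψ : 𝓢(Rd d, ℂ), ‖l ψ‖ₑ ≤
      dotXNorm ζ (1 / 2) u * (M ^ (1 / 2 : ℝ) * eLpNorm ψ 2 volume) := by
    intro ψ
    refine le_mul_dotXNorm hu
      (ENNReal.mul_ne_top hM2 (SchwartzMap.eLpNorm_lt_top ψ 2 volume).ne) fun U hU => ?_
    have h1 := hU.enorm_integral_sq_le (hζ.ae_absSymbol_ne_zero hd hs) φ (𝓕⁻ (Λ ψ))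
    rw [FourierTransform.fourier_fourierInv_eq] at h1
    have h2 : ‖l ψ‖ₑ ^ 2 ≤ (weightedNorm ζ U * (M ^ (1 / 2 : ℝ) * eLpNorm ψ 2 volume)) ^ 2 := by
      refine h1.trans ?_
      rw [mul_pow, mul_pow, ← ENNReal.rpow_natCast (M ^ (1 / 2 : ℝ)), ← ENNReal.rpow_mul,
        ← eLpNorm_fourierInv_eq ψ, eLpNorm_two_sq]
      refine mul_le_mul' le_rfl ?_
      refine (mul_le_mul' le_rfl (hΛ ψ)).trans (le_of_eq ?_)
      norm_num [hM]
      ring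
    exact (ENNReal.pow_le_pow_left_iff (by norm_num)).1 h2
  obtain ⟨f, hf1, hf2, hf3⟩ := exists_memLp_of_norm_le l
    (A := (dotXNorm ζ (1 / 2) u * M ^ (1 / 2 : ℝ)).toReal) ENNReal.toReal_nonneg (fun ψ => by
      rw [SchwartzMap.norm_toLp, ← ENNReal.toReal_mul, ← toReal_enorm]
      refine ENNReal.toReal_mono (ENNReal.mul_ne_top hA (SchwartzMap.eLpNorm_lt_top ψ 2 volume).ne) ?_
      rw [mul_assoc]; exact hbound ψ)
  rw [ENNReal.ofReal_toReal hA] at hf2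
  exact ⟨f, hf1, hf2, hf3⟩

theorem exists_pairing_bounds (d : ℕ) (hd : 3 ≤ d) (φ : 𝓢(Rd d, ℂ)) :
    ∃ C : ℝ, 0 ≤ C ∧ ∀ s : ℝ, 0 < s → ∀ ζ : EuclideanSpace ℂ (Fin d), IsPhase s ζ →
      ∀ u : Rd d → ℂ, dotXNorm ζ (1 / 2) u < ⊤ →
      (∃ f : Rd d → ℂ, MemLp f 2 volume ∧
        eLpNorm f 2 volume ≤ ENNReal.ofReal (C * √(min 1 s⁻¹)) * dotXNorm ζ (1 / 2) u ∧
        ∀ ψ : 𝓢(Rd d, ℂ), ∫ x, u x * (φ x * ψ x) = ∫ x, f x * ψ x) ∧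
      ∀ e : Rd d, ‖e‖ ≤ 1 → ∃ f : Rd d → ℂ, MemLp f 2 volume ∧
        eLpNorm f 2 volume ≤ ENNReal.ofReal (C * √(max 1 s)) * dotXNorm ζ (1 / 2) u ∧
        ∀ ψ : 𝓢(Rd d, ℂ), ∫ x, u x * (φ x * (∂_{e} ψ) x) = ∫ x, f x * ψ x := by
  obtain ⟨C₁, hC₁, hb₁⟩ := exists_lintegral_inv_absSymbol_le d hd
  obtain ⟨C₂, hC₂, hb₂⟩ := exists_norm_sq_mul_lintegral_inv_absSymbol_le d hd
  obtain ⟨D₁, hD₁, hw₁⟩ := exists_enorm_schwartz_le (𝓕⁻ φ) d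
  obtain ⟨D₂, hD₂, hw₂⟩ := exists_enorm_schwartz_le (𝓕⁻ φ) (d + 1)
  set I := ∫⁻ z, ‖(𝓕⁻ φ) z‖ₑ with hI
  have hI' : I ≠ ⊤ := ((𝓕⁻ φ).integrable (μ := volume)).2.ne
  set q : ℝ≥0∞ := ENNReal.ofReal ((2 * Real.pi) ^ 2)
  set M := I * (D₁ * C₁ + q * (D₂ * C₂)) with hM
  have hM' : M ≠ ⊤ := ENNReal.mul_ne_top hI' (ENNReal.add_ne_top.2 ⟨ENNReal.mul_ne_top hD₁ hC₁,
    ENNReal.mul_ne_top ENNReal.ofReal_ne_top (ENNReal.mul_ne_top hD₂ hC₂)⟩)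
  have hM2 : M ^ (1 / 2 : ℝ) ≠ ⊤ := ENNReal.rpow_ne_top_of_nonneg (by norm_num) hM'
  have hsqrt : ∀ m : ℝ, 0 ≤ m → ∀ K : ℝ≥0∞, I * K ≤ M →
      (I * (K * ENNReal.ofReal m)) ^ (1 / 2 : ℝ) ≤ ENNReal.ofReal ((M ^ (1 / 2 : ℝ)).toReal * √m) := by
    intro m hm K hK
    rw [← mul_assoc, ENNReal.mul_rpow_of_nonneg _ _ (by norm_num),
      ENNReal.ofReal_mul ENNReal.toReal_nonneg, ENNReal.ofReal_toReal hM2, Real.sqrt_eq_rpow,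
      ENNReal.ofReal_rpow_of_nonneg hm (by norm_num)]
    gcongr
  refine ⟨(M ^ (1 / 2 : ℝ)).toReal, ENNReal.toReal_nonneg, fun s hs ζ hζ u hu => ⟨?_, ?_⟩⟩
  · have hm : 0 ≤ min 1 s⁻¹ := le_min zero_le_one (inv_nonneg.2 hs.le)
    obtain ⟨f, hf1, hf2, hf3⟩ := exists_memLp_pairing hd φ LinearMap.id
      (κ := D₁ * C₁ * ENNReal.ofReal (min 1 s⁻¹)) (ENNReal.mul_ne_top
        (ENNReal.mul_ne_top hD₁ hC₁) ENNReal.ofReal_ne_top) hs hζ (by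
      intro ψ
      rw [← lintegral_const_mul' _ _ (ENNReal.mul_ne_top
        (ENNReal.mul_ne_top hD₁ hC₁) ENNReal.ofReal_ne_top)]
      refine lintegral_mono fun y => ?_
      rw [LinearMap.id_apply, mul_comm]
      refine mul_le_mul' ?_ le_rfl
      calc _ ≤ ∫⁻ ξ, D₁ * (ballWeight d (ξ - y) * (absSymbol ζ ξ)⁻¹) :=
            lintegral_mono fun ξ => by
              rw [← mul_assoc]; exact mul_le_mul' (hw₁ _) le_rfl
        _ ≤ _ := by
            rw [lintegral_const_mul' _ _ hD₁, mul_assoc]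
            exact mul_le_mul' le_rfl (hb₁ s hs ζ hζ y)) hu
    · refine ⟨f, hf1, hf2.trans ?_, hf3⟩
      rw [mul_comm]
      gcongr
      refine hsqrt _ hm _ ?_
      rw [hM]; exact mul_le_mul' le_rfl le_self_add
  · intro e he
    have hκ : q * (D₂ * C₂) * ENNReal.ofReal (max 1 s) ≠ ⊤ := ENNReal.mul_ne_top
      (ENNReal.mul_ne_top ENNReal.ofReal_ne_top (ENNReal.mul_ne_top hD₂ hC₂)) ENNReal.ofReal_ne_top
    obtain ⟨f, hf1, hf2, hf3⟩ := exists_memLp_pairing hd φ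
      (LineDeriv.lineDerivOpCLM ℂ 𝓢(Rd d, ℂ) e).toLinearMap hκ hs hζ (by
      intro ψ
      rw [← lintegral_const_mul' _ _ hκ]
      refine lintegral_mono fun y => ?_
      -- On the Fourier side the derivative costs a factor 2π|y|; its square meets the estimate with
      -- ‖y‖², which gives max(1, s) in place of min(1, 1/s).
      have hψ : ‖(𝓕⁻ (∂_{e} ψ)) y‖ₑ ≤
          ENNReal.ofReal (2 * Real.pi) * (ENNReal.ofReal ‖y‖ * ‖(𝓕⁻ ψ) y‖ₑ) := by
        have ht : (fun x : Rd d => inner ℝ x e).HasTemperateGrowth := by fun_prop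
        rw [SchwartzMap.fourierInv_lineDerivOp_eq, smul_apply,
          SchwartzMap.smulLeftCLM_apply_apply ht]
        rw [← ofReal_norm, ← ofReal_norm, ← ENNReal.ofReal_mul (norm_nonneg y),
          ← ENNReal.ofReal_mul Real.two_pi_pos.le]
        refine ENNReal.ofReal_le_ofReal ?_
        have h1 : ‖-(2 * (Real.pi : ℂ) * Complex.I)‖ = 2 * Real.pi := by
          rw [norm_neg, norm_mul, norm_mul, Complex.norm_I, Complex.norm_real,
            Real.norm_of_nonneg Real.pi_pos.le]; simp
        rw [norm_smul, norm_smul, h1]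
        gcongr
        refine (norm_inner_le_norm (𝕜 := ℝ) y e).trans ?_
        exact mul_le_of_le_one_right (norm_nonneg _) he
      calc _ ≤ (ENNReal.ofReal (2 * Real.pi) * (ENNReal.ofReal ‖y‖ * ‖(𝓕⁻ ψ) y‖ₑ)) ^ 2 *
            ∫⁻ ξ, D₂ * (ballWeight (d + 1) (ξ - y) * (absSymbol ζ ξ)⁻¹) := by
            refine mul_le_mul' (pow_le_pow_left' hψ 2) (lintegral_mono fun ξ => ?_)
            rw [← mul_assoc]; exact mul_le_mul' (hw₂ _) le_rfl
        _ = q * D₂ * (ENNReal.ofReal (‖y‖ ^ 2) *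
              ∫⁻ ξ, ballWeight (d + 1) (ξ - y) * (absSymbol ζ ξ)⁻¹) * ‖(𝓕⁻ ψ) y‖ₑ ^ 2 := by
            rw [lintegral_const_mul' _ _ hD₂, mul_pow, mul_pow,
              ← ENNReal.ofReal_pow (norm_nonneg y), ← ENNReal.ofReal_pow (by positivity)]
            ring
        _ ≤ q * D₂ * (C₂ * ENNReal.ofReal (max 1 s)) * ‖(𝓕⁻ ψ) y‖ₑ ^ 2 := by
            exact mul_le_mul' (mul_le_mul' le_rfl (hb₂ s hs ζ hζ y)) le_rfl
        _ = _ := by ring) hu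
    · refine ⟨f, hf1, hf2.trans ?_, hf3⟩
      rw [mul_comm]
      gcongr
      refine hsqrt _ (le_max_of_le_left zero_le_one) _ ?_
      rw [hM]; exact mul_le_mul' le_rfl le_add_self

/-! ### Local L² bounds for `u` and its weak gradient -/

theorem fderiv_testSchwartz {d : ℕ} {φ : Rd d → ℝ} (h1 : ContDiff ℝ ∞ φ)
    (h2 : HasCompactSupport φ) (e x : Rd d) :
    (∂_{e} (testSchwartz φ h1 h2)) x = ((fderiv ℝ φ x e : ℝ) : ℂ) := by
  rw [SchwartzMap.lineDerivOp_apply_eq_fderiv]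
  have h : HasFDerivAt (testSchwartz φ h1 h2) (Complex.ofRealCLM.comp (fderiv ℝ φ x)) x :=
    Complex.ofRealCLM.hasFDerivAt.comp x ((h1.differentiable (by simp)) x).hasFDerivAt
  rw [h.fderiv]; rfl

theorem clm_eq_sum {d : ℕ} {V : Type*} [NormedAddCommGroup V] [NormedSpace ℝ V]
    (T : Rd d →L[ℝ] V) (e : Rd d) : T e = ∑ j, e j • T (EuclideanSpace.single j 1) := by
  conv_lhs => rw [← (EuclideanSpace.basisFun (Fin d) ℝ).sum_repr e]
  simp

/-- The `ℂ`-valued linear form on `ℝ^d` with given values on the standard basis. -/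
noncomputable def clmOfCoords {d : ℕ} (c : Fin d → ℂ) : Rd d →L[ℝ] ℂ :=
  ∑ j, (EuclideanSpace.proj j : Rd d →L[ℝ] ℝ).smulRight (c j)

theorem clmOfCoords_apply {d : ℕ} (c : Fin d → ℂ) (e : Rd d) :
    clmOfCoords c e = ∑ j, e j • c j := by
  simp [clmOfCoords]

theorem integrable_clmOfCoords {d : ℕ} {μ : Measure (Rd d)} {h : Fin d → Rd d → ℂ}
    (hh : ∀ j, Integrable (h j) μ) : Integrable (fun x => clmOfCoords fun j => h j x) μ := by
  have hj : ∀ j, Integrable (fun x => (EuclideanSpace.proj j : Rd d →L[ℝ] ℝ).smulRight (h j x)) μ :=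
    fun j => by
      have := (ContinuousLinearMap.smulRightL ℝ (Rd d) ℂ
        (EuclideanSpace.proj j : Rd d →L[ℝ] ℝ)).integrable_comp (φ := h j) (μ := μ) (hh j)
      exact this
  have := integrable_finsetSum (μ := μ) (f := fun j x =>
    (EuclideanSpace.proj j : Rd d →L[ℝ] ℝ).smulRight (h j x)) Finset.univ (fun j _ => hj j)
  exact this

theorem hasWeakFDeriv_of_partial {d : ℕ} {f : Rd d → ℂ} {h : Fin d → Rd d → ℂ}
    (hf : LocallyIntegrable f volume) (hh : ∀ j, LocallyIntegrable (h j) volume)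
    (hint : ∀ φ : Rd d → ℝ, ContDiff ℝ ∞ φ → HasCompactSupport φ → ∀ j,
      ∫ x, (fderiv ℝ φ x (EuclideanSpace.single j 1)) • f x = - ∫ x, φ x • h j x) :
    HasWeakFDeriv f fun x => clmOfCoords fun j => h j x where
  locallyIntegrable := hf
  locallyIntegrable_deriv := by
    rw [locallyIntegrable_iff]
    intro K hK
    exact integrable_clmOfCoords fun j => (hh j).integrableOn_isCompact hK
  integral_eq := by
    intro φ h1 h2 e
    have hi1 : ∀ j, Integrable fun x => e j • ((fderiv ℝ φ x (EuclideanSpace.single j 1)) • f x) := by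
      intro j
      refine (hf.integrable_smul_left_of_hasCompactSupport ?_ ?_).smul (e j)
      · exact (h1.continuous_fderiv (by simp)).clm_apply continuous_const
      · exact (h2.fderiv_apply (𝕜 := ℝ) _)
    have hi2 : ∀ j, Integrable fun x => e j • (φ x • h j x) := fun j =>
      ((hh j).integrable_smul_left_of_hasCompactSupport h1.continuous h2).smul (e j)
    calc ∫ x, (fderiv ℝ φ x e) • f x
        = ∫ x, ∑ j, e j • ((fderiv ℝ φ x (EuclideanSpace.single j 1)) • f x) := by
          refine integral_congr_ae (Eventually.of_forall fun x => ?_)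
          simp only
          rw [clm_eq_sum (fderiv ℝ φ x) e, Finset.sum_smul]
          simp only [smul_assoc]
      _ = - ∑ j, ∫ x, e j • (φ x • h j x) := by
          rw [integral_finsetSum _ fun j _ => hi1 j, ← Finset.sum_neg_distrib]
          refine Finset.sum_congr rfl fun j _ => ?_
          rw [integral_smul, hint φ h1 h2 j, integral_smul, smul_neg]
      _ = _ := by
          rw [← integral_finsetSum _ fun j _ => hi2 j]
          congr 1
          refine integral_congr_ae (Eventually.of_forall fun x => ?_)
          simp only [clmOfCoords_apply, Finset.smul_sum]
          exact Finset.sum_congr rfl fun j _ => smul_comm (e j) (φ x) (h j x)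

theorem norm_clmOfCoords_le {d : ℕ} (c : Fin d → ℂ) : ‖clmOfCoords c‖ ≤ ∑ j, ‖c j‖ := by
  refine ContinuousLinearMap.opNorm_le_bound _ (Finset.sum_nonneg fun _ _ => norm_nonneg _) ?_
  intro e
  rw [clmOfCoords_apply, Finset.sum_mul]
  refine norm_sum_le_of_le _ fun j _ => ?_
  rw [norm_smul, mul_comm]
  exact mul_le_mul_of_nonneg_left (PiLp.norm_apply_le e j) (norm_nonneg _)

/-- The L² functions representing the pairings agree, by testing against smooth functions, with φu
and with minus its partial derivatives. -/
theorem exists_local_bounds (d : ℕ) (hd : 3 ≤ d) (φ : 𝓢(Rd d, ℂ)) :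
    ∃ C : ℝ, 0 ≤ C ∧ ∀ s : ℝ, 0 < s → ∀ ζ : EuclideanSpace ℂ (Fin d), IsPhase s ζ →
      ∀ u : Rd d → ℂ, dotXNorm ζ (1 / 2) u < ⊤ →
      MemLp (fun x => u x * φ x) 2 volume ∧
      eLpNorm (fun x => u x * φ x) 2 volume ≤
        ENNReal.ofReal (C * √(min 1 s⁻¹)) * dotXNorm ζ (1 / 2) u ∧
      ∃ G : Rd d → Rd d →L[ℝ] ℂ, HasWeakFDeriv (fun x => u x * φ x) G ∧ MemLp G 2 volume ∧
        eLpNorm G 2 volume ≤ ENNReal.ofReal (C * √(max 1 s)) * dotXNorm ζ (1 / 2) u := by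
  obtain ⟨C₁, hC₁, hb₁⟩ := exists_pairing_bounds d hd φ
  -- The factor d comes from summing the d partial derivatives.
  refine ⟨max C₁ (d * C₁), hC₁.trans (le_max_left _ _), fun s hs ζ hζ u hu => ?_⟩
  obtain ⟨U, hU⟩ := exists_isFourierTransform hu
  obtain ⟨⟨f, hf1, hf2, hf3⟩, hder⟩ := hb₁ s hs ζ hζ u hu
  have hloc : LocallyIntegrable (fun x => u x * φ x) volume :=
    locallyIntegrable_of_integrable_mul_schwartz fun ψ => by
      simpa [mul_assoc] using hU.integrable_mul
        (SchwartzMap.pairing (ContinuousLinearMap.mul ℂ ℂ) φ ψ)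
  have hae : (fun x => u x * φ x) =ᵐ[volume] f := by
    refine ae_eq_of_integral_contDiff_smul_eq hloc (hf1.locallyIntegrable (by norm_num)) ?_
    intro g h1 h2
    have h := hf3 (testSchwartz g h1 h2)
    simp only [testSchwartz_apply] at h
    calc _ = ∫ x, u x * (φ x * (g x : ℂ)) := by
          refine integral_congr_ae (Eventually.of_forall fun x => ?_)
          simp only [Complex.real_smul]; ring
      _ = _ := by
          rw [h]
          refine integral_congr_ae (Eventually.of_forall fun x => ?_)
          simp only [Complex.real_smul]; ring
  refine ⟨hf1.ae_eq hae.symm, ?_, ?_⟩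
  · rw [eLpNorm_congr_ae hae]
    refine hf2.trans ?_
    gcongr
    exact le_max_left _ _
  choose! F hF1 hF2 hF3 using fun j : Fin d => hder (EuclideanSpace.single j 1) (by simp)
  have hG : HasWeakFDeriv (fun x => u x * φ x) fun x => clmOfCoords fun j => -F j x := by
    refine hasWeakFDeriv_of_partial hloc
      (fun j => ((hF1 j).locallyIntegrable (by norm_num)).neg) fun g h1 h2 j => ?_
    have h := hF3 j (testSchwartz g h1 h2)
    simp only [testSchwartz_apply, fderiv_testSchwartz] at h
    calc _ = ∫ x, u x * (φ x * ((fderiv ℝ g x (EuclideanSpace.single j 1) : ℝ) : ℂ)) := by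
          refine integral_congr_ae (Eventually.of_forall fun x => ?_)
          simp only [Complex.real_smul]; ring
      _ = _ := by
          rw [h, ← integral_neg]
          refine integral_congr_ae (Eventually.of_forall fun x => ?_)
          simp only [Complex.real_smul]; ring
  have hGn : eLpNorm (fun x => clmOfCoords fun j => -F j x) 2 volume ≤
      ENNReal.ofReal (max C₁ (d * C₁) * √(max 1 s)) * dotXNorm ζ (1 / 2) u := by
    calc _ ≤ eLpNorm (∑ j, fun x => ‖F j x‖) 2 volume := by
          refine eLpNorm_mono_real fun x => (norm_clmOfCoords_le _).trans (le_of_eq ?_)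
          simp
      _ ≤ ∑ j, eLpNorm (fun x => ‖F j x‖) 2 volume :=
          eLpNorm_sum_le (fun j _ => (hF1 j).1.norm) (by norm_num)
      _ ≤ ∑ _j : Fin d, ENNReal.ofReal (C₁ * √(max 1 s)) * dotXNorm ζ (1 / 2) u := by
          refine Finset.sum_le_sum fun j _ => ?_
          rw [eLpNorm_norm]; exact hF2 j
      _ = ENNReal.ofReal (d * C₁ * √(max 1 s)) * dotXNorm ζ (1 / 2) u := by
          rw [Finset.sum_const, Finset.card_univ, Fintype.card_fin, nsmul_eq_mul, mul_assoc (d : ℝ),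
            ENNReal.ofReal_mul (p := (d : ℝ)) (by positivity), ENNReal.ofReal_natCast, mul_assoc]
      _ ≤ _ := by
          gcongr
          exact le_max_right _ _
  refine ⟨_, hG, ⟨hG.locallyIntegrable_deriv.aestronglyMeasurable, ?_⟩, hGn⟩
  exact hGn.trans_lt (ENNReal.mul_lt_top ENNReal.ofReal_lt_top hu)

/-! ### Weak derivatives: uniqueness, mollification, Lipschitz representatives -/

section WeakDerivative

variable {d : ℕ} {V : Type*} [NormedAddCommGroup V] [NormedSpace ℝ V]

theorem HasWeakFDeriv.congr_ae {f g : Rd d → V} {f' g' : Rd d → Rd d →L[ℝ] V}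
    (h : HasWeakFDeriv f f') (hfg : f =ᵐ[volume] g) (hfg' : f' =ᵐ[volume] g') :
    HasWeakFDeriv g g' where
  locallyIntegrable := h.locallyIntegrable.congr hfg
  locallyIntegrable_deriv := h.locallyIntegrable_deriv.congr hfg'
  integral_eq := by
    intro φ h1 h2 e
    have e1 : ∫ x, (fderiv ℝ φ x e) • g x = ∫ x, (fderiv ℝ φ x e) • f x :=
      integral_congr_ae (by filter_upwards [hfg] with x hx; rw [hx])
    have e2 : ∫ x, φ x • g' x e = ∫ x, φ x • f' x e :=
      integral_congr_ae (by filter_upwards [hfg'] with x hx; rw [hx])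
    rw [e1, e2, h.integral_eq φ h1 h2 e]

theorem fderiv_eq_zero_of_notMem_tsupport {φ : Rd d → ℝ} {x : Rd d} (hx : x ∉ tsupport φ) :
    fderiv ℝ φ x = 0 := by
  by_contra h
  exact hx (support_fderiv_subset ℝ h)

theorem integrable_fderiv_smul {f : Rd d → V} (hf : LocallyIntegrable f volume) {φ : Rd d → ℝ}
    (h1 : ContDiff ℝ ∞ φ) (h2 : HasCompactSupport φ) (e : Rd d) :
    Integrable fun x => (fderiv ℝ φ x e) • f x :=
  hf.integrable_smul_left_of_hasCompactSupport
    ((h1.continuous_fderiv (by simp)).clm_apply continuous_const) (h2.fderiv_apply (𝕜 := ℝ) e)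

theorem integrable_smul_clm_apply {f' : Rd d → Rd d →L[ℝ] V} (hf : LocallyIntegrable f' volume)
    {φ : Rd d → ℝ} (h1 : Continuous φ) (h2 : HasCompactSupport φ) (e : Rd d) :
    Integrable fun x => φ x • f' x e :=
  (hf.integrable_smul_left_of_hasCompactSupport h1 h2).apply_continuousLinearMap e

/-- A test function supported in `O`, and its derivative, see only points where f and g agree, so
the derivatives have equal pairings; the fundamental lemma of the calculus of variations on `O`
concludes. -/
theorem HasWeakFDeriv.ae_eq_on [CompleteSpace V] {f g : Rd d → V} {f' g' : Rd d → Rd d →L[ℝ] V}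
    (hf : HasWeakFDeriv f f') (hg : HasWeakFDeriv g g') {O : Set (Rd d)} (hO : IsOpen O)
    (hfg : ∀ᵐ x, x ∈ O → f x = g x) : ∀ᵐ x, x ∈ O → f' x = g' x := by
  have hloc : LocallyIntegrable (fun x => f' x - g' x) volume :=
    hf.locallyIntegrable_deriv.sub hg.locallyIntegrable_deriv
  have h := hO.ae_eq_zero_of_integral_contDiff_smul_eq_zero (hloc.locallyIntegrableOn O) ?_
  · filter_upwards [h] with x hx hxO using sub_eq_zero.1 (hx hxO)
  intro φ h1 h2 h3
  ext e
  have hI := hloc.integrable_smul_left_of_hasCompactSupport h1.continuous h2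
  rw [ContinuousLinearMap.integral_apply hI]
  simp only [smul_apply, sub_apply, smul_sub, zero_apply]
  rw [integral_sub (integrable_smul_clm_apply hf.locallyIntegrable_deriv h1.continuous h2 e)
    (integrable_smul_clm_apply hg.locallyIntegrable_deriv h1.continuous h2 e), sub_eq_zero,
    ← neg_inj, ← hf.integral_eq φ h1 h2 e, ← hg.integral_eq φ h1 h2 e]
  refine integral_congr_ae ?_
  filter_upwards [hfg] with x hx
  by_cases hxO : x ∈ O
  · rw [hx hxO]
  · rw [fderiv_eq_zero_of_notMem_tsupport fun hx' => hxO (h3 hx'), zero_apply, zero_smul, zero_smul]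

theorem HasWeakFDeriv.weakFDeriv_ae_eq [CompleteSpace V] {f : Rd d → V}
    {f' : Rd d → Rd d →L[ℝ] V} (h : HasWeakFDeriv f f') : weakFDeriv f =ᵐ[volume] f' := by
  have hex : ∃ f', HasWeakFDeriv f f' := ⟨f', h⟩
  have : HasWeakFDeriv f (weakFDeriv f) := by
    rw [weakFDeriv, dif_pos hex]; exact hex.choose_spec
  filter_upwards [this.ae_eq_on h isOpen_univ (by simp)] with x hx using hx trivial

theorem hasWeakFDeriv_of_contDiff {f : Rd d → V} (hf : ContDiff ℝ 1 f) :
    HasWeakFDeriv f (fderiv ℝ f) where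
  locallyIntegrable := hf.continuous.locallyIntegrable
  locallyIntegrable_deriv := (hf.continuous_fderiv (by simp)).locallyIntegrable
  integral_eq := by
    intro φ h1 h2 e
    rw [integral_smul_fderiv_eq_neg_fderiv_smul_of_integrable, neg_neg]
    · exact integrable_fderiv_smul hf.continuous.locallyIntegrable h1 h2 e
    · exact integrable_smul_clm_apply (hf.continuous_fderiv (by simp)).locallyIntegrable
        h1.continuous h2 e
    · exact hf.continuous.locallyIntegrable.integrable_smul_left_of_hasCompactSupport
        h1.continuous h2
    · exact fun x _ => (h1.differentiable (by simp)) x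
    · exact fun x _ => (hf.differentiable (by simp)) x

/-- The convolution of a function with a real kernel. -/
noncomputable def mollify (ρ : Rd d → ℝ) (f : Rd d → V) (x : Rd d) : V := ∫ t, ρ (x - t) • f t

theorem mollify_eq_convolution (ρ : Rd d → ℝ) (f : Rd d → V) :
    mollify ρ f = ρ ⋆[ContinuousLinearMap.lsmul ℝ ℝ, volume] f := by
  ext x; rw [convolution_eq_swap]; rfl

theorem contDiff_comp_const_sub {ρ : Rd d → ℝ} (h1 : ContDiff ℝ ∞ ρ) (x : Rd d) :
    ContDiff ℝ ∞ fun t => ρ (x - t) :=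
  h1.comp (contDiff_const.sub contDiff_id)

theorem hasCompactSupport_comp_const_sub {ρ : Rd d → ℝ} (h2 : HasCompactSupport ρ) (x : Rd d) :
    HasCompactSupport fun t => ρ (x - t) :=
  h2.comp_homeomorph (Homeomorph.subLeft x)

theorem contDiff_mollify {ρ : Rd d → ℝ} (h1 : ContDiff ℝ ∞ ρ) (h2 : HasCompactSupport ρ)
    {f : Rd d → V} (hf : LocallyIntegrable f volume) : ContDiff ℝ ∞ (mollify ρ f) := by
  rw [mollify_eq_convolution]
  exact h2.contDiff_convolution_left _ h1 hf

theorem fderiv_mollify_apply [CompleteSpace V] {ρ : Rd d → ℝ} (h1 : ContDiff ℝ ∞ ρ)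
    (h2 : HasCompactSupport ρ) {f : Rd d → V} (hf : LocallyIntegrable f volume) (x e : Rd d) :
    fderiv ℝ (mollify ρ f) x e = ∫ t, (fderiv ℝ ρ (x - t) e) • f t := by
  have h := h2.hasFDerivAt_convolution_left (ContinuousLinearMap.lsmul ℝ ℝ)
    (h1.of_le (by simp)) hf x
  rw [← mollify_eq_convolution] at h
  rw [h.fderiv, convolution_eq_swap, ContinuousLinearMap.integral_apply]
  · rfl
  exact ((h2.fderiv (𝕜 := ℝ)).convolutionExists_left _ (h1.continuous_fderiv (by simp)) hf
    x).integrable_swap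

/-- For fixed x the function t ↦ ρ(x − t) is itself a test function; the sign from differentiating
in t cancels the one in the definition of the weak derivative. -/
theorem HasWeakFDeriv.fderiv_mollify [CompleteSpace V] {ρ : Rd d → ℝ} (h1 : ContDiff ℝ ∞ ρ)
    (h2 : HasCompactSupport ρ) {f : Rd d → V} {f' : Rd d → Rd d →L[ℝ] V}
    (hf : HasWeakFDeriv f f') (x : Rd d) : fderiv ℝ (mollify ρ f) x = mollify ρ f' x := by
  ext e
  have h3 := contDiff_comp_const_sub h1 x
  have h4 := hasCompactSupport_comp_const_sub h2 x
  rw [fderiv_mollify_apply h1 h2 hf.locallyIntegrable, mollify, ContinuousLinearMap.integral_apply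
    (hf.locallyIntegrable_deriv.integrable_smul_left_of_hasCompactSupport h3.continuous h4)]
  simp only [smul_apply]
  rw [← neg_neg (∫ t, ρ (x - t) • f' t e), ← hf.integral_eq _ h3 h4 e, ← integral_neg]
  refine integral_congr_ae (Eventually.of_forall fun t => ?_)
  have h5 : HasFDerivAt (fun t => ρ (x - t)) ((fderiv ℝ ρ (x - t)).comp
      (-ContinuousLinearMap.id ℝ (Rd d))) t :=
    ((h1.differentiable (by simp)) (x - t)).hasFDerivAt.comp t ((hasFDerivAt_id t).const_sub x)
  simp only [h5.fderiv]
  simp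

/-- A sequence of smooth bumps that shrinks to the origin. -/
noncomputable def shrinkingBump (d : ℕ) (n : ℕ) : ContDiffBump (0 : Rd d) where
  rIn := 1 / (2 * ((n : ℝ) + 1))
  rOut := 1 / ((n : ℝ) + 1)
  rIn_pos := by positivity
  rIn_lt_rOut := by
    apply one_div_lt_one_div_of_lt (by positivity)
    have : (0 : ℝ) ≤ n := by positivity
    linarith

/-- The normalization of `shrinkingBump`. -/
noncomputable def approxDelta (d : ℕ) (n : ℕ) : Rd d → ℝ := (shrinkingBump d n).normed volume

theorem contDiff_approxDelta (d n : ℕ) : ContDiff ℝ ∞ (approxDelta d n) :=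
  (shrinkingBump d n).contDiff_normed

theorem hasCompactSupport_approxDelta (d n : ℕ) : HasCompactSupport (approxDelta d n) :=
  (shrinkingBump d n).hasCompactSupport_normed

theorem approxDelta_nonneg (d n : ℕ) (x : Rd d) : 0 ≤ approxDelta d n x :=
  (shrinkingBump d n).nonneg_normed x

theorem integral_approxDelta (d n : ℕ) : ∫ x, approxDelta d n x = 1 :=
  (shrinkingBump d n).integral_normed

theorem integral_comp_const_sub (ρ : Rd d → ℝ) (x : Rd d) : ∫ t, ρ (x - t) = ∫ t, ρ t :=
  integral_sub_left_eq_self ρ volume x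

theorem ae_tendsto_mollify [CompleteSpace V] {f : Rd d → V} (hf : LocallyIntegrable f volume) :
    ∀ᵐ x, Tendsto (fun n => mollify (approxDelta d n) f x) atTop (𝓝 (f x)) := by
  -- The ratio of outer to inner radius is 2 throughout; its boundedness is what Lebesgue
  -- differentiation requires.
  have h := ContDiffBump.ae_convolution_tendsto_right_of_locallyIntegrable (K := 2)
    (φ := shrinkingBump d) (l := atTop) (μ := (volume : Measure (Rd d))) (g := f)
    tendsto_one_div_add_atTop_nhds_zero_nat (Eventually.of_forall fun n => by
      simp only [shrinkingBump]
      exact le_of_eq (by field_simp)) hf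
  simpa only [mollify_eq_convolution, approxDelta] using h

theorem norm_mollify_le {ρ : Rd d → ℝ} (h0 : ∀ x, 0 ≤ ρ x) (hi : ∫ x, ρ x = 1) {f : Rd d → V}
    {M : ℝ} (hM : ∀ᵐ x, ‖f x‖ ≤ M) (x : Rd d) : ‖mollify ρ f x‖ ≤ M := by
  have hρ : Integrable ρ := by
    by_contra h; rw [integral_undef h] at hi; exact zero_ne_one hi
  have hint : Integrable fun t => ρ (x - t) * M := (hρ.comp_sub_left x).mul_const M
  refine (norm_integral_le_of_norm_le hint ?_).trans (le_of_eq ?_)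
  · filter_upwards [hM] with t ht
    rw [norm_smul, Real.norm_of_nonneg (h0 _)]
    exact mul_le_mul_of_nonneg_left ht (h0 _)
  · rw [integral_mul_const, integral_comp_const_sub, hi, one_mul]

theorem le_mollify {ρ : Rd d → ℝ} (h0 : ∀ x, 0 ≤ ρ x) (hi : ∫ x, ρ x = 1) (h1 : Continuous ρ)
    (h2 : HasCompactSupport ρ) {f : Rd d → ℝ} (hf : LocallyIntegrable f volume)
    {c : ℝ} (hc : ∀ᵐ x, c ≤ f x) (x : Rd d) : c ≤ mollify ρ f x := by
  have hρ : Integrable ρ := by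
    by_contra h; rw [integral_undef h] at hi; exact zero_ne_one hi
  have hint : Integrable fun t => ρ (x - t) * c := (hρ.comp_sub_left x).mul_const c
  have hint2 : Integrable fun t => ρ (x - t) • f t :=
    hf.integrable_smul_left_of_hasCompactSupport (h1.comp (continuous_const.sub continuous_id))
      (h2.comp_homeomorph (Homeomorph.subLeft x))
  have h := integral_mono_ae hint hint2 (by
    filter_upwards [hc] with t ht
    exact mul_le_mul_of_nonneg_left ht (h0 _))
  rwa [integral_mul_const, integral_comp_const_sub, hi, one_mul] at h

/-- Mollifications have gradient at most M, hence are M-Lipschitz by the mean value inequality. The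
inequality survives at all points where they converge to f, a set of full measure. -/
theorem HasWeakFDeriv.exists_lipschitz [CompleteSpace V] {f : Rd d → V}
    {f' : Rd d → Rd d →L[ℝ] V} (hf : HasWeakFDeriv f f') {M : ℝ} (hM : ∀ᵐ x, ‖f' x‖ ≤ M) :
    ∃ S : Set (Rd d), (∀ᵐ x, x ∈ S) ∧ ∀ x ∈ S, ∀ y ∈ S, ‖f x - f y‖ ≤ M * ‖x - y‖ := by
  refine ⟨{x | Tendsto (fun n => mollify (approxDelta d n) f x) atTop (𝓝 (f x))},
    ae_tendsto_mollify hf.locallyIntegrable, fun x hx y hy => ?_⟩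
  simp only [Set.mem_ofPred_eq] at hx hy
  refine le_of_tendsto (hx.sub hy).norm (Eventually.of_forall fun n => ?_)
  have h1 := contDiff_approxDelta d n
  have h2 := hasCompactSupport_approxDelta d n
  have hd : Differentiable ℝ (mollify (approxDelta d n) f) :=
    (contDiff_mollify h1 h2 hf.locallyIntegrable).differentiable (by simp)
  refine Convex.norm_image_sub_le_of_norm_fderiv_le (𝕜 := ℝ) (s := Set.univ) (fun z _ => hd z)
    (fun z _ => ?_) convex_univ (Set.mem_univ y) (Set.mem_univ x)
  rw [hf.fderiv_mollify h1 h2]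
  exact norm_mollify_le (approxDelta_nonneg d n) (integral_approxDelta d n) hM z

end WeakDerivative

/-! ### Product rule, chain rule and gluing for weak derivatives -/

section WeakDerivativeCalculus

variable {d : ℕ} {V : Type*} [NormedAddCommGroup V] [NormedSpace ℝ V]

theorem locallyIntegrable_of_norm_le {W : Type*} [NormedAddCommGroup W] {f : Rd d → V}
    {g : Rd d → W} (hf : LocallyIntegrable f volume) (hg : AEStronglyMeasurable g volume) {M : ℝ}
    (h : ∀ᵐ x, ‖g x‖ ≤ M * ‖f x‖) : LocallyIntegrable g volume := by
  refine (hf.smul M).mono hg ?_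
  filter_upwards [h] with x hx
  rw [Pi.smul_apply, norm_smul]
  exact hx.trans (mul_le_mul_of_nonneg_right (le_abs_self M) (norm_nonneg _))

theorem aestronglyMeasurable_smulRight {f' : Rd d → Rd d →L[ℝ] ℝ} {F : Rd d → V}
    (hf : AEStronglyMeasurable f' volume) (hF : AEStronglyMeasurable F volume) :
    AEStronglyMeasurable (fun x => (f' x).smulRight (F x)) volume :=
  (ContinuousLinearMap.smulRightL ℝ (Rd d) V).aestronglyMeasurable_comp₂ hf hF

/-- The product rule for a bounded function with bounded weak derivative and an arbitrary weakly
differentiable function. -/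
theorem HasWeakFDeriv.smul_of_bounded [CompleteSpace V] {f : Rd d → ℝ} {f' : Rd d → Rd d →L[ℝ] ℝ}
    {F : Rd d → V} {F' : Rd d → Rd d →L[ℝ] V} (hf : HasWeakFDeriv f f') (hF : HasWeakFDeriv F F')
    {M M' : ℝ} (hM : ∀ᵐ x, ‖f x‖ ≤ M) (hM' : ∀ᵐ x, ‖f' x‖ ≤ M') :
    HasWeakFDeriv (fun x => f x • F x) (fun x => f x • F' x + (f' x).smulRight (F x)) where
  locallyIntegrable := by
    refine locallyIntegrable_of_norm_le hF.locallyIntegrable (M := M) (hf.locallyIntegrable.aestronglyMeasurable.smul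
      hF.locallyIntegrable.aestronglyMeasurable) ?_
    filter_upwards [hM] with x hx
    rw [norm_smul]; gcongr
  locallyIntegrable_deriv := by
    refine LocallyIntegrable.add (f := fun x => f x • F' x) ?_ ?_
    · refine locallyIntegrable_of_norm_le hF.locallyIntegrable_deriv (M := M)
        (hf.locallyIntegrable.aestronglyMeasurable.smul
          hF.locallyIntegrable_deriv.aestronglyMeasurable) ?_
      filter_upwards [hM] with x hx
      rw [norm_smul]; gcongr
    · refine locallyIntegrable_of_norm_le hF.locallyIntegrable (M := M') (aestronglyMeasurable_smulRight
        hf.locallyIntegrable_deriv.aestronglyMeasurable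
          hF.locallyIntegrable.aestronglyMeasurable) ?_
      filter_upwards [hM'] with x hx
      rw [ContinuousLinearMap.norm_smulRight_apply]; gcongr
  integral_eq := by
    intro φ h1 h2 e
    set fn : ℕ → Rd d → ℝ := fun n => mollify (approxDelta d n) f with hfn
    have hs : ∀ n, ContDiff ℝ ∞ (fn n) := fun n =>
      contDiff_mollify (contDiff_approxDelta d n) (hasCompactSupport_approxDelta d n)
        hf.locallyIntegrable
    have hfd : ∀ n x, fderiv ℝ (fn n) x = mollify (approxDelta d n) f' x := fun n x =>
      hf.fderiv_mollify (contDiff_approxDelta d n) (hasCompactSupport_approxDelta d n) x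
    have hb : ∀ n x, ‖fn n x‖ ≤ M := fun n x =>
      norm_mollify_le (approxDelta_nonneg d n) (integral_approxDelta d n) hM x
    have hb' : ∀ n x, ‖fderiv ℝ (fn n) x‖ ≤ M' := fun n x => by
      rw [hfd]
      exact norm_mollify_le (approxDelta_nonneg d n) (integral_approxDelta d n) hM' x
    have ht := ae_tendsto_mollify hf.locallyIntegrable
    have ht' := ae_tendsto_mollify hf.locallyIntegrable_deriv
    have hI1 := integrable_fderiv_smul hF.locallyIntegrable h1 h2 e
    have hI2 := hF.locallyIntegrable.integrable_smul_left_of_hasCompactSupport h1.continuous h2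
    have hI3 := integrable_smul_clm_apply hF.locallyIntegrable_deriv h1.continuous h2 e
    have hFm := hF.locallyIntegrable.aestronglyMeasurable
    -- The smooth function fₙφ is an admissible test function for F. The uniform bounds on fₙ and
    -- its derivative then allow passage to the limit by dominated convergence.
    have hkey : ∀ n, ∫ x, fn n x • ((fderiv ℝ φ x e) • F x) =
        - (∫ x, (fderiv ℝ (fn n) x e) • (φ x • F x)) - ∫ x, fn n x • (φ x • F' x e) := by
      intro n
      have h := hF.integral_eq (fun x => fn n x * φ x) ((hs n).mul h1) h2.mul_left e
      have e1 : ∀ x, (fderiv ℝ (fun x => fn n x * φ x) x e) • F x =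
          fn n x • ((fderiv ℝ φ x e) • F x) + (fderiv ℝ (fn n) x e) • (φ x • F x) := by
        intro x
        rw [fderiv_fun_mul ((hs n).differentiable (by simp) x) (h1.differentiable (by simp) x)]
        simp only [add_apply, smul_apply, smul_eq_mul, add_smul, smul_smul]
        rw [mul_comm (φ x)]
      simp only [e1, mul_smul] at h
      rw [integral_add] at h
      · rw [eq_sub_iff_add_eq, eq_neg_iff_add_eq_zero, add_right_comm, h]; simp
      · exact hI1.bdd_smul M (hs n).continuous.aestronglyMeasurable (Eventually.of_forall (hb n))
      · refine hI2.bdd_smul (M' * ‖e‖) ?_ (Eventually.of_forall fun x => ?_)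
        · exact (((hs n).continuous_fderiv (by simp)).clm_apply
            continuous_const).aestronglyMeasurable
        · exact (ContinuousLinearMap.le_opNorm _ _).trans (by gcongr; exact hb' n x)
    have l1 : Tendsto (fun n => ∫ x, fn n x • ((fderiv ℝ φ x e) • F x)) atTop
        (𝓝 (∫ x, f x • ((fderiv ℝ φ x e) • F x))) := by
      refine tendsto_integral_of_dominated_convergence (fun x => M * ‖(fderiv ℝ φ x e) • F x‖)
        (fun n => (hs n).continuous.aestronglyMeasurable.smul hI1.1) (hI1.norm.const_mul M)
        (fun n => Eventually.of_forall fun x => ?_) ?_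
      · rw [norm_smul]; gcongr; exact hb n x
      · filter_upwards [ht] with x hx using hx.smul_const _
    have l2 : Tendsto (fun n => ∫ x, (fderiv ℝ (fn n) x e) • (φ x • F x)) atTop
        (𝓝 (∫ x, (f' x e) • (φ x • F x))) := by
      refine tendsto_integral_of_dominated_convergence (fun x => M' * ‖e‖ * ‖φ x • F x‖)
        (fun n => ?_) (hI2.norm.const_mul _) (fun n => Eventually.of_forall fun x => ?_) ?_
      · exact (((hs n).continuous_fderiv (by simp)).clm_apply
          continuous_const).aestronglyMeasurable.smul hI2.1
      · rw [norm_smul]; gcongr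
        exact (ContinuousLinearMap.le_opNorm _ _).trans (by gcongr; exact hb' n x)
      · filter_upwards [ht'] with x hx
        simp only [hfd]
        exact (((ContinuousLinearMap.apply ℝ ℝ e).continuous.tendsto _).comp hx).smul_const _
    have l3 : Tendsto (fun n => ∫ x, fn n x • (φ x • F' x e)) atTop
        (𝓝 (∫ x, f x • (φ x • F' x e))) := by
      refine tendsto_integral_of_dominated_convergence (fun x => M * ‖φ x • F' x e‖)
        (fun n => (hs n).continuous.aestronglyMeasurable.smul hI3.1) (hI3.norm.const_mul M)
        (fun n => Eventually.of_forall fun x => ?_) ?_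
      · rw [norm_smul]; gcongr; exact hb n x
      · filter_upwards [ht] with x hx using hx.smul_const _
    have hlim := tendsto_nhds_unique l1 ((l2.neg.sub l3).congr fun n => (hkey n).symm)
    have hf'e : ∀ᵐ x, ‖f' x e‖ ≤ M' * ‖e‖ := by
      filter_upwards [hM'] with x hx
      exact (ContinuousLinearMap.le_opNorm _ _).trans (by gcongr)
    have hf'm : AEStronglyMeasurable (fun x => f' x e) volume :=
      hf.locallyIntegrable_deriv.aestronglyMeasurable.apply_continuousLinearMap e
    calc ∫ x, (fderiv ℝ φ x e) • (f x • F x) = ∫ x, f x • ((fderiv ℝ φ x e) • F x) := by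
          simp only [smul_comm (f _)]
      _ = -((∫ x, f x • (φ x • F' x e)) + ∫ x, (f' x e) • (φ x • F x)) := by
          rw [hlim]; abel
      _ = _ := by
          have k1 : Integrable fun x => f x • (φ x • F' x e) :=
            hI3.bdd_smul M hf.locallyIntegrable.aestronglyMeasurable hM
          have k2 : Integrable fun x => (f' x e) • (φ x • F x) :=
            hI2.bdd_smul (M' * ‖e‖) hf'm hf'e
          rw [← integral_add k1 k2]
          congr 1
          refine integral_congr_ae (Eventually.of_forall fun x => ?_)
          simp only [add_apply, smul_apply, ContinuousLinearMap.smulRight_apply, smul_add]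
          rw [smul_comm (φ x), smul_comm (φ x)]

/-- The chain rule for a function with values in a compact interval of positive numbers and with
bounded weak derivative. -/
theorem HasWeakFDeriv.comp_of_bounded {f : Rd d → ℝ} {f' : Rd d → Rd d →L[ℝ] ℝ}
    (hf : HasWeakFDeriv f f') {c M M' : ℝ} (hc0 : 0 < c) (hc : ∀ᵐ x, c ≤ f x)
    (hM : ∀ᵐ x, ‖f x‖ ≤ M) (hM' : ∀ᵐ x, ‖f' x‖ ≤ M') {Φ Φ' : ℝ → ℝ}
    (hΦ : ContDiffOn ℝ 1 Φ (Set.Ioi 0)) (hΦ' : ∀ t, 0 < t → HasDerivAt Φ (Φ' t) t) :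
    HasWeakFDeriv (fun x => Φ (f x)) (fun x => Φ' (f x) • f' x) := by
  have hΦc : ContinuousOn Φ (Set.Ioi 0) := hΦ.continuousOn
  have hΦ'c : ContinuousOn Φ' (Set.Ioi 0) :=
    (hΦ.continuousOn_deriv_of_isOpen isOpen_Ioi le_rfl).congr fun t ht => (hΦ' t ht).deriv.symm
  have hIcc : Set.Icc c M ⊆ Set.Ioi 0 := fun t ht => hc0.trans_le ht.1
  obtain ⟨A, hA⟩ := isCompact_Icc.exists_bound_of_continuousOn (hΦc.mono hIcc)
  obtain ⟨A', hA'⟩ := isCompact_Icc.exists_bound_of_continuousOn (hΦ'c.mono hIcc)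
  set fn : ℕ → Rd d → ℝ := fun n => mollify (approxDelta d n) f with hfn
  have hs : ∀ n, ContDiff ℝ ∞ (fn n) := fun n =>
    contDiff_mollify (contDiff_approxDelta d n) (hasCompactSupport_approxDelta d n)
      hf.locallyIntegrable
  have hfd : ∀ n x, fderiv ℝ (fn n) x = mollify (approxDelta d n) f' x := fun n x =>
    hf.fderiv_mollify (contDiff_approxDelta d n) (hasCompactSupport_approxDelta d n) x
  -- Averages of f stay in [c, M], where Φ and Φ' are bounded; so Φ ∘ fₙ is C¹ and dominated
  -- convergence applies.
  have hmem : ∀ n x, fn n x ∈ Set.Icc c M := fun n x =>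
    ⟨le_mollify (approxDelta_nonneg d n) (integral_approxDelta d n)
      (contDiff_approxDelta d n).continuous (hasCompactSupport_approxDelta d n)
      hf.locallyIntegrable hc x,
      (le_abs_self _).trans
        (norm_mollify_le (approxDelta_nonneg d n) (integral_approxDelta d n) hM x)⟩
  have hb' : ∀ n x, ‖fderiv ℝ (fn n) x‖ ≤ M' := fun n x => by
    rw [hfd]
    exact norm_mollify_le (approxDelta_nonneg d n) (integral_approxDelta d n) hM' x
  have ht := ae_tendsto_mollify hf.locallyIntegrable
  have ht' := ae_tendsto_mollify hf.locallyIntegrable_deriv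
  have hmem' : ∀ᵐ x, f x ∈ Set.Icc c M := by
    filter_upwards [hc, hM] with x h1 h2 using ⟨h1, (le_abs_self _).trans h2⟩
  have hA'0 : ∀ᵐ x, ‖Φ' (f x)‖ ≤ A' := hmem'.mono fun x hx => hA' _ hx
  have hmeas : ∀ Ψ : ℝ → ℝ, ContinuousOn Ψ (Set.Ioi 0) → (∀ n, Continuous fun x => Ψ (fn n x)) ∧
      (∀ᵐ x, Tendsto (fun n => Ψ (fn n x)) atTop (𝓝 (Ψ (f x)))) := by
    intro Ψ hΨ
    refine ⟨fun n => hΨ.comp_continuous (hs n).continuous fun x => hIcc (hmem n x), ?_⟩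
    filter_upwards [ht, hmem'] with x hx hx'
    exact ((hΨ.continuousAt (Ioi_mem_nhds (hIcc hx'))).tendsto.comp hx)
  obtain ⟨hΦn, hΦt⟩ := hmeas Φ hΦc
  obtain ⟨hΦ'n, hΦ't⟩ := hmeas Φ' hΦ'c
  have hΦm : AEStronglyMeasurable (fun x => Φ (f x)) volume :=
    aestronglyMeasurable_of_tendsto_ae atTop (fun n => (hΦn n).aestronglyMeasurable) hΦt
  have hΦ'm : AEStronglyMeasurable (fun x => Φ' (f x)) volume :=
    aestronglyMeasurable_of_tendsto_ae atTop (fun n => (hΦ'n n).aestronglyMeasurable) hΦ't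
  have hone : LocallyIntegrable (fun _ : Rd d => (1 : ℝ)) volume := locallyIntegrable_const 1
  have hDfn : ∀ n x, HasFDerivAt (fun y => Φ (fn n y)) (Φ' (fn n x) • fderiv ℝ (fn n) x) x :=
    fun n x => (hΦ' _ (hIcc (hmem n x))).comp_hasFDerivAt x
      ((hs n).differentiable (by simp) x).hasFDerivAt
  have hC1 : ∀ n, ContDiff ℝ 1 fun y => Φ (fn n y) := fun n =>
    hΦ.comp_contDiff ((hs n).of_le (by simp)) fun x => hIcc (hmem n x)
  refine ⟨locallyIntegrable_of_norm_le hone (M := A) hΦm ?_,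
    locallyIntegrable_of_norm_le hone (M := A' * M')
    (hΦ'm.smul hf.locallyIntegrable_deriv.aestronglyMeasurable) ?_, ?_⟩
  · filter_upwards [hmem'] with x hx
    simpa using hA _ hx
  · filter_upwards [hA'0, hM'] with x h1 h2
    rw [norm_smul, norm_one, mul_one]
    exact mul_le_mul h1 h2 (norm_nonneg _) ((norm_nonneg _).trans h1)
  intro φ h1 h2 e
  have hI1 : Integrable fun x => fderiv ℝ φ x e := by
    simpa using integrable_fderiv_smul hone h1 h2 e
  have hI2 : Integrable φ := h1.continuous.integrable_of_hasCompactSupport h2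
  have hkey := fun n => (hasWeakFDeriv_of_contDiff (hC1 n)).integral_eq φ h1 h2 e
  have l1 : Tendsto (fun n => ∫ x, (fderiv ℝ φ x e) • Φ (fn n x)) atTop
      (𝓝 (∫ x, (fderiv ℝ φ x e) • Φ (f x))) := by
    refine tendsto_integral_of_dominated_convergence (fun x => ‖fderiv ℝ φ x e‖ * A)
      (fun n => hI1.1.smul (hΦn n).aestronglyMeasurable) (hI1.norm.mul_const A)
      (fun n => Eventually.of_forall fun x => ?_) ?_
    · rw [norm_smul]; gcongr; exact hA _ (hmem n x)
    · filter_upwards [hΦt] with x hx using hx.const_smul _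
  have l2 : Tendsto (fun n => ∫ x, φ x • fderiv ℝ (fun y => Φ (fn n y)) x e) atTop
      (𝓝 (∫ x, φ x • (Φ' (f x) • f' x) e)) := by
    refine tendsto_integral_of_dominated_convergence (fun x => ‖φ x‖ * (A' * M' * ‖e‖))
      (fun n => hI2.1.smul ?_) (hI2.norm.mul_const _) (fun n => Eventually.of_forall fun x => ?_) ?_
    · exact (((hC1 n).continuous_fderiv (by simp)).clm_apply
        continuous_const).aestronglyMeasurable
    · rw [norm_smul, (hDfn n x).fderiv]
      gcongr
      refine (ContinuousLinearMap.le_opNorm _ _).trans ?_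
      rw [norm_smul]
      gcongr
      · exact (norm_nonneg _).trans (hA' _ (hmem n x))
      · exact hA' _ (hmem n x)
      · exact hb' n x
    · filter_upwards [hΦ't, ht'] with x hx hx'
      simp only [(hDfn _ x).fderiv, hfd]
      exact (((ContinuousLinearMap.apply ℝ ℝ e).continuous.tendsto _).comp
        (hx.smul hx')).const_smul _
  exact tendsto_nhds_unique l1 (l2.neg.congr fun n => (hkey n).symm)

theorem locallyIntegrable_of_local {E : Type*} [NormedAddCommGroup E] {f : Rd d → E}
    (h : ∀ n : ℕ, ∃ g : Rd d → E, LocallyIntegrable g volume ∧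
      ∀ᵐ x, x ∈ Metric.ball (0 : Rd d) n → g x = f x) : LocallyIntegrable f volume := by
  intro x
  obtain ⟨n, hn⟩ := exists_nat_gt ‖x‖
  obtain ⟨g, hg, hgf⟩ := h n
  obtain ⟨s, hs, hsi⟩ := hg x
  refine ⟨s ∩ Metric.ball (0 : Rd d) n, inter_mem hs (Metric.isOpen_ball.mem_nhds
    (mem_ball_zero_iff.2 hn)), ?_⟩
  have h1 : IntegrableOn g (s ∩ Metric.ball (0 : Rd d) n) := hsi.mono_set Set.inter_subset_left
  refine h1.congr ?_
  have h2 := ae_restrict_of_ae (s := s ∩ Metric.ball (0 : Rd d) n) hgf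
  have h3 : ∀ᵐ y ∂(volume.restrict (s ∩ Metric.ball (0 : Rd d) n)),
      y ∈ Metric.ball (0 : Rd d) n :=
    ae_mono (Measure.restrict_mono Set.inter_subset_right le_rfl)
      (ae_restrict_mem Metric.isOpen_ball.measurableSet)
  filter_upwards [h2, h3] with y hy hy' using hy hy'

/-- Local weak derivatives can be glued. -/
theorem exists_hasWeakFDeriv_of_local [CompleteSpace V] {f : Rd d → V}
    (h : ∀ n : ℕ, ∃ g : Rd d → V, ∃ g' : Rd d → Rd d →L[ℝ] V, HasWeakFDeriv g g' ∧
      ∀ x ∈ Metric.ball (0 : Rd d) n, g x = f x) :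
    ∃ f', HasWeakFDeriv f f' := by
  choose g g' hg hgf using h
  -- The index ⌊‖x‖⌋ + 1 exceeds ‖x‖, so x lies in the ball whose derivative is selected.
  set F : Rd d → Rd d →L[ℝ] V := fun x => g' (⌊‖x‖⌋₊ + 1) x with hF
  have hcompat : ∀ᵐ x, ∀ m n : ℕ, x ∈ Metric.ball (0 : Rd d) m → x ∈ Metric.ball (0 : Rd d) n →
      g' m x = g' n x := by
    refine ae_all_iff.2 fun m => ae_all_iff.2 fun n => ?_
    filter_upwards [(hg m).ae_eq_on (hg n) (Metric.isOpen_ball.inter Metric.isOpen_ball)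
      (Eventually.of_forall fun x hx => (hgf m x hx.1).trans (hgf n x hx.2).symm)] with x hx h1 h2
      using hx ⟨h1, h2⟩
  have hFn : ∀ n : ℕ, ∀ᵐ x, x ∈ Metric.ball (0 : Rd d) n → F x = g' n x := by
    intro n
    filter_upwards [hcompat] with x hx hxn
    refine hx _ _ ?_ hxn
    rw [mem_ball_zero_iff]
    exact_mod_cast Nat.lt_floor_add_one ‖x‖
  refine ⟨F, locallyIntegrable_of_local fun n => ⟨g n, (hg n).locallyIntegrable,
    Eventually.of_forall (hgf n)⟩, locallyIntegrable_of_local fun n => ⟨g' n,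
    (hg n).locallyIntegrable_deriv, (hFn n).mono fun x hx hxn => (hx hxn).symm⟩, ?_⟩
  intro φ h1 h2 e
  obtain ⟨R, hR⟩ := h2.isCompact.isBounded.subset_ball (0 : Rd d)
  obtain ⟨n, hn⟩ := exists_nat_ge R
  have hsub : tsupport φ ⊆ Metric.ball (0 : Rd d) n := hR.trans (Metric.ball_subset_ball hn)
  have e1 : ∫ x, (fderiv ℝ φ x e) • f x = ∫ x, (fderiv ℝ φ x e) • g n x := by
    refine integral_congr_ae (Eventually.of_forall fun x => ?_)
    by_cases hx : x ∈ tsupport φ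
    · simp only [hgf n x (hsub hx)]
    · simp only [fderiv_eq_zero_of_notMem_tsupport hx, zero_apply, zero_smul]
  have e2 : ∫ x, φ x • F x e = ∫ x, φ x • g' n x e := by
    refine integral_congr_ae ?_
    filter_upwards [hFn n] with x hx
    by_cases hx' : x ∈ tsupport φ
    · simp only [hx (hsub hx')]
    · simp only [image_eq_zero_of_notMem_tsupport hx', zero_smul]
  rw [e1, e2, (hg n).integral_eq φ h1 h2 e]

end WeakDerivativeCalculus

/-! ### Mollification in L² and the product rule for L² functions -/

section SquareIntegrable

variable {d : ℕ} {V : Type*} [NormedAddCommGroup V] [NormedSpace ℝ V]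

/-- The kernel is a probability density: Cauchy–Schwarz against it, then Tonelli. -/
theorem eLpNorm_mollify_le {ρ : Rd d → ℝ} (h0 : ∀ x, 0 ≤ ρ x) (hi : ∫ x, ρ x = 1)
    (hc : Continuous ρ) {f : Rd d → V} (hf : AEStronglyMeasurable f volume) :
    eLpNorm (mollify ρ f) 2 volume ≤ eLpNorm f 2 volume := by
  have hρ : Integrable ρ := by
    by_contra h; rw [integral_undef h] at hi; exact zero_ne_one hi
  have hw : ∫⁻ t, ENNReal.ofReal (ρ t) = 1 := by
    rw [← ofReal_integral_eq_lintegral_ofReal hρ (Eventually.of_forall h0), hi, ENNReal.ofReal_one]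
  have hpt : ∀ x, ‖mollify ρ f x‖ₑ ^ 2 ≤ ∫⁻ t, ENNReal.ofReal (ρ (x - t)) * ‖f t‖ₑ ^ 2 := by
    intro x
    have h1 : ‖mollify ρ f x‖ₑ ≤ ∫⁻ t, ENNReal.ofReal (ρ (x - t)) * ‖f t‖ₑ := by
      refine (enorm_integral_le_lintegral_enorm _).trans (le_of_eq ?_)
      refine lintegral_congr fun t => ?_
      rw [enorm_smul, Real.enorm_of_nonneg (h0 _)]
    refine (pow_le_pow_left' h1 2).trans ((lintegral_weight_mul_sq_le ?_ hf.enorm).trans ?_)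
    · exact ((hc.comp (continuous_const.sub continuous_id)).measurable.ennreal_ofReal).aemeasurable
    · rw [lintegral_sub_left_eq_self (fun t => ENNReal.ofReal (ρ t)), hw, one_mul]
  have hsq : eLpNorm (mollify ρ f) 2 volume ^ 2 ≤ eLpNorm f 2 volume ^ 2 := by
    rw [eLpNorm_two_sq, eLpNorm_two_sq]
    refine (lintegral_mono hpt).trans (le_of_eq ?_)
    rw [lintegral_lintegral_swap]
    · refine lintegral_congr fun t => ?_
      rw [lintegral_mul_const _ (by fun_prop), lintegral_sub_right_eq_self
        (fun t => ENNReal.ofReal (ρ t)), hw, one_mul]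
    · refine AEMeasurable.mul (f := fun p : Rd d × Rd d => ENNReal.ofReal (ρ (p.1 - p.2)))
        (g := fun p : Rd d × Rd d => ‖f p.2‖ₑ ^ 2) ?_ ?_
      · exact (hc.comp (continuous_fst.sub continuous_snd)).measurable.ennreal_ofReal.aemeasurable
      · exact (hf.comp_snd.enorm).pow_const 2
  exact (ENNReal.pow_le_pow_left_iff two_ne_zero).1 hsq

theorem mollify_sub {ρ : Rd d → ℝ} (h1 : Continuous ρ) (h2 : HasCompactSupport ρ) {f g : Rd d → V}
    (hf : LocallyIntegrable f volume) (hg : LocallyIntegrable g volume) :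
    mollify ρ (f - g) = mollify ρ f - mollify ρ g := by
  ext x
  have h3 : Continuous fun t => ρ (x - t) := h1.comp (continuous_const.sub continuous_id)
  have h4 : HasCompactSupport fun t => ρ (x - t) := hasCompactSupport_comp_const_sub h2 x
  simp only [mollify, Pi.sub_apply, smul_sub]
  exact integral_sub (hf.integrable_smul_left_of_hasCompactSupport h3 h4)
    (hg.integrable_smul_left_of_hasCompactSupport h3 h4)

/-- The kernels are supported in the unit ball, so all differences live in one ball of radius R + 1
and are bounded by 2A; almost everywhere convergence is then dominated. -/
theorem tendsto_eLpNorm_mollify_of_continuous [CompleteSpace V] {g : Rd d → V} (hg : Continuous g)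
    (hg2 : HasCompactSupport g) :
    Tendsto (fun n => eLpNorm (mollify (approxDelta d n) g - g) 2 volume) atTop (𝓝 0) := by
  obtain ⟨A, hA⟩ := hg2.exists_bound_of_continuous hg
  obtain ⟨R, hR⟩ := hg2.isCompact.isBounded.subset_ball (0 : Rd d)
  have hA0 : 0 ≤ A := (norm_nonneg _).trans (hA 0)
  set K : Set (Rd d) := Metric.ball (0 : Rd d) (R + 1)
  have hsupp : ∀ n, ∀ x ∉ K, mollify (approxDelta d n) g x - g x = 0 := by
    intro n x hx
    have hx0 : g x = 0 := image_eq_zero_of_notMem_tsupport fun h =>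
      hx (Metric.ball_subset_ball (by linarith) (hR h))
    rw [hx0, sub_zero, mollify]
    refine integral_eq_zero_of_ae (Eventually.of_forall fun t => ?_)
    by_cases ht : t ∈ tsupport g
    · have h3 : approxDelta d n (x - t) = 0 := by
        by_contra h
        have h4 : x - t ∈ Metric.ball (0 : Rd d) (shrinkingBump d n).rOut := by
          rw [← (shrinkingBump d n).support_normed_eq (μ := volume)]; exact h
        have h5 : (shrinkingBump d n).rOut ≤ 1 := by
          simp only [shrinkingBump]
          rw [div_le_one (by positivity)]
          have : (0 : ℝ) ≤ n := by positivity
          linarith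
        have h6 := hR ht
        rw [mem_ball_zero_iff] at h4 h6
        apply hx
        rw [mem_ball_zero_iff]
        calc ‖x‖ = ‖(x - t) + t‖ := by rw [sub_add_cancel]
          _ ≤ ‖x - t‖ + ‖t‖ := norm_add_le _ _
          _ < R + 1 := by linarith
      simp [h3]
    · simp [image_eq_zero_of_notMem_tsupport ht]
  have hlim : Tendsto (fun n => ∫⁻ x, ‖(mollify (approxDelta d n) g - g) x‖ₑ ^ 2) atTop (𝓝 0) := by
    have h := tendsto_lintegral_of_dominated_convergence' (μ := (volume : Measure (Rd d)))
      (F := fun n x => ‖(mollify (approxDelta d n) g - g) x‖ₑ ^ 2) (f := fun _ => 0)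
      (K.indicator fun _ => ENNReal.ofReal (2 * A) ^ 2) (fun n => ?_)
      (fun n => Eventually.of_forall fun x => ?_) ?_ ?_
    · simpa using h
    · have : Continuous (mollify (approxDelta d n) g) :=
        (contDiff_mollify (contDiff_approxDelta d n) (hasCompactSupport_approxDelta d n)
          hg.locallyIntegrable).continuous
      exact ((this.sub hg).enorm.measurable.pow_const 2).aemeasurable
    · by_cases hx : x ∈ K
      · rw [Set.indicator_of_mem hx]
        refine pow_le_pow_left' ?_ 2
        rw [← ofReal_norm]
        refine ENNReal.ofReal_le_ofReal ?_
        refine (norm_sub_le _ _).trans ?_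
        have := norm_mollify_le (approxDelta_nonneg d n) (integral_approxDelta d n)
          (Eventually.of_forall hA) x
        linarith [hA x]
      · simp only [Pi.sub_apply, hsupp n x hx]; simp
    · rw [lintegral_indicator Metric.isOpen_ball.measurableSet, lintegral_const]
      refine ENNReal.mul_ne_top (by finiteness) ?_
      rw [Measure.restrict_apply_univ]
      exact measure_ball_lt_top.ne
    · filter_upwards [ae_tendsto_mollify hg.locallyIntegrable] with x hx
      have h1 := (hx.sub_const (g x)).enorm
      rw [sub_self, enorm_zero] at h1
      simpa [Function.comp_def] using (ENNReal.continuous_pow 2).continuousAt.tendsto.comp h1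
  have h2 := (ENNReal.continuous_rpow_const (y := 1 / 2)).tendsto (0 : ℝ≥0∞)
  have h3 := h2.comp hlim
  rw [ENNReal.zero_rpow_of_pos (by norm_num)] at h3
  refine h3.congr fun n => ?_
  simp only [Function.comp_apply]
  rw [← eLpNorm_two_sq, ← ENNReal.rpow_natCast, ← ENNReal.rpow_mul]
  norm_num

/-- Approximation by a continuous compactly supported function, mollification being a contraction of
L². -/
theorem tendsto_eLpNorm_mollify [CompleteSpace V] {f : Rd d → V} (hf : MemLp f 2 volume) :
    Tendsto (fun n => eLpNorm (mollify (approxDelta d n) f - f) 2 volume) atTop (𝓝 0) := by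
  rw [ENNReal.tendsto_nhds_zero]
  intro ε hε
  have hε3 : ε / 3 ≠ 0 := (ENNReal.div_pos hε.ne' (by norm_num)).ne'
  obtain ⟨g, hgs, hfg, hgc, hg⟩ := hf.exists_hasCompactSupport_eLpNorm_sub_le
    (by norm_num) hε3
  have h := (ENNReal.tendsto_nhds_zero.1 (tendsto_eLpNorm_mollify_of_continuous hgc hgs)) (ε / 3)
    (pos_iff_ne_zero.2 hε3)
  filter_upwards [h] with n hn
  have hfl : LocallyIntegrable f volume := hf.locallyIntegrable (by norm_num)
  have hcm : ∀ {k : Rd d → V}, LocallyIntegrable k volume →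
      AEStronglyMeasurable (mollify (approxDelta d n) k) volume := fun hk =>
    (contDiff_mollify (contDiff_approxDelta d n) (hasCompactSupport_approxDelta d n)
      hk).continuous.aestronglyMeasurable
  have e1 : mollify (approxDelta d n) f - f = mollify (approxDelta d n) (f - g) +
      ((mollify (approxDelta d n) g - g) - (f - g)) := by
    rw [mollify_sub (contDiff_approxDelta d n).continuous (hasCompactSupport_approxDelta d n) hfl
      hgc.locallyIntegrable]
    abel
  have hfgm : AEStronglyMeasurable (f - g) volume := hf.1.sub hg.1
  have hgm := (hcm hgc.locallyIntegrable).sub hg.1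
  rw [e1]
  calc _ ≤ ε / 3 + (ε / 3 + ε / 3) := by
        refine (eLpNorm_add_le (hcm (hfl.sub hgc.locallyIntegrable)) (hgm.sub hfgm)
          (by norm_num)).trans (add_le_add ?_ ?_)
        · exact (eLpNorm_mollify_le (approxDelta_nonneg d n) (integral_approxDelta d n)
            (contDiff_approxDelta d n).continuous hfgm).trans hfg
        · exact (eLpNorm_sub_le hgm hfgm (by norm_num)).trans (add_le_add hn hfg)
    _ = ε := by rw [← add_assoc, ENNReal.add_thirds]

theorem tendsto_integral_mul_mollify {A f : Rd d → ℂ} (hA : MemLp A 2 volume)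
    (hf : MemLp f 2 volume) :
    Tendsto (fun n => ∫ x, A x * mollify (approxDelta d n) f x) atTop (𝓝 (∫ x, A x * f x)) := by
  have hmm : ∀ n, MemLp (mollify (approxDelta d n) f) 2 volume := fun n =>
    ⟨(contDiff_mollify (contDiff_approxDelta d n) (hasCompactSupport_approxDelta d n)
      (hf.locallyIntegrable (by norm_num))).continuous.aestronglyMeasurable,
      (eLpNorm_mollify_le (approxDelta_nonneg d n) (integral_approxDelta d n)
        (contDiff_approxDelta d n).continuous hf.1).trans_lt hf.2⟩
  refine tendsto_integral_of_L1 _ (hA.1.mul hf.1)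
    (Eventually.of_forall fun n => hA.integrable_mul (hmm n)) ?_
  have hb : ∀ n, ∫⁻ x, ‖A x * mollify (approxDelta d n) f x - A x * f x‖ₑ ≤
      eLpNorm A 2 volume * eLpNorm (mollify (approxDelta d n) f - f) 2 volume := by
    intro n
    have h1 : (∫⁻ x, ‖A x‖ₑ * ‖(mollify (approxDelta d n) f - f) x‖ₑ) ^ 2 ≤
        (eLpNorm A 2 volume * eLpNorm (mollify (approxDelta d n) f - f) 2 volume) ^ 2 := by
      rw [mul_pow, eLpNorm_two_sq, eLpNorm_two_sq]
      exact lintegral_mul_sq_le hA.1.enorm ((hmm n).1.sub hf.1).enorm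
    refine le_trans (le_of_eq ?_) ((ENNReal.pow_le_pow_left_iff two_ne_zero).1 h1)
    refine lintegral_congr fun x => ?_
    rw [← mul_sub, enorm_mul, Pi.sub_apply]
  have h2 := ENNReal.Tendsto.const_mul (tendsto_eLpNorm_mollify hf)
    (Or.inr hA.2.ne) (a := eLpNorm A 2 volume)
  rw [mul_zero] at h2
  exact tendsto_of_tendsto_of_tendsto_of_le_of_le tendsto_const_nhds h2 (fun _ => zero_le) hb

/-- Weak derivatives are defined with real test functions; complex ones follow by splitting into
real and imaginary parts. -/
theorem HasWeakFDeriv.integral_mul_eq {U : Rd d → ℂ} {G : Rd d → Rd d →L[ℝ] ℂ}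
    (hU : HasWeakFDeriv U G) {ψ : Rd d → ℂ} (h1 : ContDiff ℝ ∞ ψ) (h2 : HasCompactSupport ψ)
    (e : Rd d) : ∫ x, fderiv ℝ ψ x e * U x = - ∫ x, ψ x * G x e := by
  have key : ∀ T : ℂ →L[ℝ] ℝ, ∫ x, ((T (fderiv ℝ ψ x e) : ℝ) : ℂ) * U x =
      - ∫ x, ((T (ψ x) : ℝ) : ℂ) * G x e ∧
      (Integrable fun x => ((T (fderiv ℝ ψ x e) : ℝ) : ℂ) * U x) ∧
      Integrable fun x => ((T (ψ x) : ℝ) : ℂ) * G x e := by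
    intro T
    have hT1 : ContDiff ℝ ∞ fun x => T (ψ x) := T.contDiff.comp h1
    have hT2 : HasCompactSupport fun x => T (ψ x) := h2.comp_left (g := T) (map_zero T)
    have h := hU.integral_eq _ hT1 hT2 e
    have h3 := integrable_fderiv_smul hU.locallyIntegrable hT1 hT2 e
    have h4 := integrable_smul_clm_apply hU.locallyIntegrable_deriv hT1.continuous hT2 e
    have e1 : ∀ x, fderiv ℝ (fun x => T (ψ x)) x e = T (fderiv ℝ ψ x e) := by
      intro x
      have := (T.hasFDerivAt (x := ψ x)).comp x (h1.differentiable (by simp) x).hasFDerivAt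
      rw [show (fun x => T (ψ x)) = T ∘ ψ from rfl, this.fderiv]; rfl
    simp only [e1, Complex.real_smul] at h h3 h4
    exact ⟨h, h3, h4⟩
  obtain ⟨a1, a2, a3⟩ := key Complex.reCLM
  obtain ⟨b1, b2, b3⟩ := key Complex.imCLM
  have e1 : ∀ z w : ℂ, z * w = ((Complex.reCLM z : ℝ) : ℂ) * w +
      Complex.I * (((Complex.imCLM z : ℝ) : ℂ) * w) := by
    intro z w
    conv_lhs => rw [← Complex.re_add_im z]
    simp only [Complex.reCLM_apply, Complex.imCLM_apply]; ring
  simp only [e1 (fderiv ℝ ψ _ e), e1 (ψ _)]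
  rw [integral_add a2 (b2.const_mul _), integral_add a3 (b3.const_mul _), integral_const_mul,
    integral_const_mul, a1, b1]
  ring

/-- The product rule for square integrable functions with square integrable weak derivatives. -/
theorem HasWeakFDeriv.mul_of_memLp {U W : Rd d → ℂ} {G H : Rd d → Rd d →L[ℝ] ℂ}
    (hU : HasWeakFDeriv U G) (hW : HasWeakFDeriv W H) (hU2 : MemLp U 2 volume)
    (hG2 : MemLp G 2 volume) (hW2 : MemLp W 2 volume) (hH2 : MemLp H 2 volume) :
    HasWeakFDeriv (fun x => U x * W x) (fun x => U x • H x + W x • G x) := by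
  have hint : Integrable fun x => U x * W x := hU2.integrable_mul hW2
  have i1 : Integrable fun x => U x • H x := by
    have : MemLp (fun x => U x • H x) 1 volume := hH2.smul hU2
    exact memLp_one_iff_integrable.1 this
  have i2 : Integrable fun x => W x • G x := by
    have : MemLp (fun x => W x • G x) 1 volume := hG2.smul hW2
    exact memLp_one_iff_integrable.1 this
  refine ⟨hint.locallyIntegrable, (Integrable.add (f := fun x => U x • H x) i1 i2).locallyIntegrable,
    fun φ h1 h2 e => ?_⟩
  -- Only W is mollified: φWₙ is an admissible test function for U. Strong L² convergence of Wₙ and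
  -- its derivative against fixed L² factors gives the limit.
  set Wn : ℕ → Rd d → ℂ := fun n => mollify (approxDelta d n) W with hWn
  have hs : ∀ n, ContDiff ℝ ∞ (Wn n) := fun n =>
    contDiff_mollify (contDiff_approxDelta d n) (hasCompactSupport_approxDelta d n)
      hW.locallyIntegrable
  have hHe : MemLp (fun x => H x e) 2 volume :=
    (ContinuousLinearMap.apply ℝ ℂ e).comp_memLp' hH2
  have hGe : MemLp (fun x => G x e) 2 volume :=
    (ContinuousLinearMap.apply ℝ ℂ e).comp_memLp' hG2
  have hfd : ∀ n x, fderiv ℝ (Wn n) x e = mollify (approxDelta d n) (fun t => H t e) x := by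
    intro n x
    have h3 := contDiff_comp_const_sub (contDiff_approxDelta d n) x
    have h4 := hasCompactSupport_comp_const_sub (hasCompactSupport_approxDelta d n) x
    rw [hW.fderiv_mollify (contDiff_approxDelta d n) (hasCompactSupport_approxDelta d n), mollify,
      ContinuousLinearMap.integral_apply
      (hW.locallyIntegrable_deriv.integrable_smul_left_of_hasCompactSupport h3.continuous h4)]
    rfl
  obtain ⟨a, ha⟩ := h2.exists_bound_of_continuous h1.continuous
  have hφ'c : Continuous fun x => fderiv ℝ φ x e :=
    (h1.continuous_fderiv (by simp)).clm_apply continuous_const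
  obtain ⟨b, hb⟩ := (h2.fderiv_apply (𝕜 := ℝ) e).exists_bound_of_continuous hφ'c
  have hmem : ∀ {χ : Rd d → ℝ} {c : ℝ} {f : Rd d → ℂ}, Continuous χ → (∀ x, ‖χ x‖ ≤ c) →
      MemLp f 2 volume → MemLp (fun x => (χ x : ℂ) * f x) 2 volume := by
    intro χ c f h3 h4 hf
    refine hf.of_le_mul (c := c) ((Complex.continuous_ofReal.comp h3).aestronglyMeasurable.mul hf.1)
      (Eventually.of_forall fun x => ?_)
    rw [norm_mul, Complex.norm_real]
    exact mul_le_mul_of_nonneg_right (h4 x) (norm_nonneg _)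
  have m1 := hmem hφ'c hb hU2
  have m2 := hmem h1.continuous ha hU2
  have m3 := hmem h1.continuous ha hGe
  have l1 := tendsto_integral_mul_mollify m1 hW2
  have l2 := tendsto_integral_mul_mollify m2 hHe
  have l3 := tendsto_integral_mul_mollify m3 hW2
  have hmm : ∀ n {f : Rd d → ℂ}, MemLp f 2 volume → MemLp (mollify (approxDelta d n) f) 2 volume :=
    fun n f hf =>
    ⟨(contDiff_mollify (contDiff_approxDelta d n) (hasCompactSupport_approxDelta d n)
      (hf.locallyIntegrable (by norm_num))).continuous.aestronglyMeasurable,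
      (eLpNorm_mollify_le (approxDelta_nonneg d n) (integral_approxDelta d n)
        (contDiff_approxDelta d n).continuous hf.1).trans_lt hf.2⟩
  have hkey : ∀ n, ∫ x, ((fderiv ℝ φ x e : ℝ) : ℂ) * U x * mollify (approxDelta d n) W x =
      - (∫ x, (φ x : ℂ) * U x * mollify (approxDelta d n) (fun t => H t e) x) -
        ∫ x, (φ x : ℂ) * G x e * mollify (approxDelta d n) W x := by
    intro n
    have hφC : ContDiff ℝ ∞ fun x => (φ x : ℂ) := Complex.ofRealCLM.contDiff.comp h1
    have h := hU.integral_mul_eq (ψ := fun x => (φ x : ℂ) * Wn n x) (hφC.mul (hs n))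
      (h2.comp_left (g := Complex.ofReal) Complex.ofReal_zero).mul_right e
    have e1 : ∀ x, fderiv ℝ (fun x => (φ x : ℂ) * Wn n x) x e * U x =
        ((fderiv ℝ φ x e : ℝ) : ℂ) * U x * mollify (approxDelta d n) W x +
          (φ x : ℂ) * U x * mollify (approxDelta d n) (fun t => H t e) x := by
      intro x
      have h3 : fderiv ℝ (fun x => (φ x : ℂ)) x e = ((fderiv ℝ φ x e : ℝ) : ℂ) := by
        have := (Complex.ofRealCLM.hasFDerivAt (x := φ x)).comp x
          (h1.differentiable (by simp) x).hasFDerivAt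
        rw [show (fun x => (φ x : ℂ)) = Complex.ofRealCLM ∘ φ from rfl, this.fderiv]; rfl
      rw [fderiv_fun_mul (hφC.differentiable (by simp) x) ((hs n).differentiable (by simp) x)]
      simp only [add_apply, smul_apply, smul_eq_mul, h3, hfd]
      simp only [hWn]
      ring
    simp only [e1] at h
    have k1 : Integrable fun x => ((fderiv ℝ φ x e : ℝ) : ℂ) * U x *
        mollify (approxDelta d n) W x := m1.integrable_mul (hmm n hW2)
    have k2 : Integrable fun x => (φ x : ℂ) * U x *
        mollify (approxDelta d n) (fun t => H t e) x := m2.integrable_mul (hmm n hHe)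
    rw [integral_add k1 k2] at h
    rw [eq_sub_iff_add_eq, eq_neg_iff_add_eq_zero, add_right_comm, h]
    rw [neg_add_eq_zero]
    refine integral_congr_ae (Eventually.of_forall fun x => ?_)
    simp only [hWn]; ring
  have hlim := tendsto_nhds_unique l1 ((l2.neg.sub l3).congr fun n => (hkey n).symm)
  calc ∫ x, (fderiv ℝ φ x e) • (U x * W x) = ∫ x, ((fderiv ℝ φ x e : ℝ) : ℂ) * U x * W x := by
        refine integral_congr_ae (Eventually.of_forall fun x => ?_)
        simp only [Complex.real_smul, mul_assoc]
    _ = -((∫ x, (φ x : ℂ) * U x * H x e) + ∫ x, (φ x : ℂ) * G x e * W x) := by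
        rw [hlim]; ring
    _ = _ := by
        have k1 : Integrable fun x => (φ x : ℂ) * U x * H x e := m2.integrable_mul hHe
        have k2 : Integrable fun x => (φ x : ℂ) * G x e * W x := m3.integrable_mul hW2
        rw [← integral_add k1 k2]
        congr 1
        refine integral_congr_ae (Eventually.of_forall fun x => ?_)
        simp only [add_apply, smul_apply, smul_eq_mul, Complex.real_smul]
        ring

end SquareIntegrable

/-! ### L¹ bounds for `uv` and its gradient on a ball -/

section ProductOfSolutions

variable {d : ℕ}

theorem integral_norm_mul_le {E F : Type*} [NormedAddCommGroup E] [NormedAddCommGroup F]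
    {f : Rd d → E} {g : Rd d → F} (hf : MemLp f 2 volume) (hg : MemLp g 2 volume) {a b : ℝ}
    (ha : 0 ≤ a) (hb : 0 ≤ b) (hfa : eLpNorm f 2 volume ≤ ENNReal.ofReal a)
    (hgb : eLpNorm g 2 volume ≤ ENNReal.ofReal b) :
    Integrable (fun x => ‖f x‖ * ‖g x‖) ∧ ∫ x, ‖f x‖ * ‖g x‖ ≤ a * b := by
  have hint : Integrable (fun x => ‖f x‖ * ‖g x‖) := hf.norm.integrable_mul hg.norm
  refine ⟨hint, ?_⟩
  rw [integral_eq_lintegral_of_nonneg_ae (Eventually.of_forall fun x => by positivity) hint.1]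
  refine ENNReal.toReal_le_of_le_ofReal (mul_nonneg ha hb) ?_
  refine (ENNReal.pow_le_pow_left_iff two_ne_zero).1 ?_
  have h1 : ∀ x, ENNReal.ofReal (‖f x‖ * ‖g x‖) = ‖f x‖ₑ * ‖g x‖ₑ := fun x => by
    rw [ENNReal.ofReal_mul (norm_nonneg _), ofReal_norm, ofReal_norm]
  simp only [h1]
  refine (lintegral_mul_sq_le hf.1.enorm hg.1.enorm).trans ?_
  rw [← eLpNorm_two_sq, ← eLpNorm_two_sq, ENNReal.ofReal_mul ha, mul_pow]
  gcongr

theorem exists_testSchwartz_eq_one (K : Set (Rd d)) (hK : Bornology.IsBounded K) :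
    ∃ φ : 𝓢(Rd d, ℂ), ∀ x ∈ K, φ x = 1 := by
  obtain ⟨φ, h1, h2, h3, -⟩ := exists_cutoff K hK
  exact ⟨testSchwartz φ h1 h2, fun x hx => by rw [testSchwartz_apply, h3 x hx, Complex.ofReal_one]⟩

theorem exists_hasWeakFDeriv_mul (hd : 3 ≤ d) {s : ℝ} (hs : 0 < s)
    {ζ₁ ζ₂ : EuclideanSpace ℂ (Fin d)} (hζ₁ : IsPhase s ζ₁) (hζ₂ : IsPhase s ζ₂) {u v : Rd d → ℂ}
    (hu : dotXNorm ζ₁ (1 / 2) u < ⊤) (hv : dotXNorm ζ₂ (1 / 2) v < ⊤) :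
    ∃ W', HasWeakFDeriv (fun x => u x * v x) W' := by
  refine exists_hasWeakFDeriv_of_local fun n => ?_
  obtain ⟨φ, hφ⟩ := exists_testSchwartz_eq_one (Metric.ball (0 : Rd d) n) Metric.isBounded_ball
  obtain ⟨C, -, h⟩ := exists_local_bounds d hd φ
  obtain ⟨hu2, -, G, hG, hG2, -⟩ := h s hs ζ₁ hζ₁ u hu
  obtain ⟨hv2, -, H, hH, hH2, -⟩ := h s hs ζ₂ hζ₂ v hv
  refine ⟨_, _, hG.mul_of_memLp hH hu2 hG2 hv2 hH2, fun x hx => ?_⟩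
  rw [hφ x hx, mul_one, mul_one]

/-- On a fixed ball, `uv` and its gradient are controlled in `L¹` by the norms of `u` and `v`, with
a gain of `s⁻¹` for `uv`. -/
theorem exists_product_bounds (d : ℕ) (hd : 3 ≤ d) (x₀ : Rd d) (R : ℝ) :
    ∃ C : ℝ, 0 ≤ C ∧ ∀ s : ℝ, 0 < s → ∀ ζ₁ ζ₂ : EuclideanSpace ℂ (Fin d),
      IsPhase s ζ₁ → IsPhase s ζ₂ → ∀ u v : Rd d → ℂ,
      dotXNorm ζ₁ (1 / 2) u < ⊤ → dotXNorm ζ₂ (1 / 2) v < ⊤ →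
      ∃ W', HasWeakFDeriv (fun x => u x * v x) W' ∧
        ∫ x in Metric.ball x₀ R, ‖u x * v x‖ ≤
          C * min 1 s⁻¹ * (dotXNorm ζ₁ (1 / 2) u).toReal * (dotXNorm ζ₂ (1 / 2) v).toReal ∧
        ∫ x in Metric.ball x₀ R, ‖W' x‖ ≤
          C * (dotXNorm ζ₁ (1 / 2) u).toReal * (dotXNorm ζ₂ (1 / 2) v).toReal := by
  obtain ⟨φ, hφ⟩ := exists_testSchwartz_eq_one (Metric.ball x₀ R) Metric.isBounded_ball
  obtain ⟨C, hC, h⟩ := exists_local_bounds d hd φ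
  refine ⟨2 * C ^ 2, by positivity, fun s hs ζ₁ ζ₂ hζ₁ hζ₂ u v hu hv => ?_⟩
  obtain ⟨hu2, hub, G, hG, hG2, hGb⟩ := h s hs ζ₁ hζ₁ u hu
  obtain ⟨hv2, hvb, H, hH, hH2, hHb⟩ := h s hs ζ₂ hζ₂ v hv
  obtain ⟨W', hW'⟩ := exists_hasWeakFDeriv_mul hd hs hζ₁ hζ₂ hu hv
  set a := (dotXNorm ζ₁ (1 / 2) u).toReal
  set b := (dotXNorm ζ₂ (1 / 2) v).toReal
  have ha : 0 ≤ a := ENNReal.toReal_nonneg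
  have hb : 0 ≤ b := ENNReal.toReal_nonneg
  rw [← ENNReal.ofReal_toReal hu.ne, ← ENNReal.ofReal_mul (by positivity)] at hub hGb
  rw [← ENNReal.ofReal_toReal hv.ne, ← ENNReal.ofReal_mul (by positivity)] at hvb hHb
  have hm : 0 ≤ min 1 s⁻¹ := le_min zero_le_one (inv_nonneg.2 hs.le)
  have hM : 0 ≤ max 1 s := zero_le_one.trans (le_max_left _ _)
  -- The gain from one undifferentiated factor exactly cancels the loss from differentiating the
  -- other.
  have hmM : √(min 1 s⁻¹) * √(max 1 s) = 1 := by
    rw [← Real.sqrt_mul hm]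
    rcases le_total 1 s with h1 | h1
    · rw [min_eq_right (inv_le_one_of_one_le₀ h1), max_eq_right h1, inv_mul_cancel₀ hs.ne',
        Real.sqrt_one]
    · rw [min_eq_left ((one_le_inv₀ hs).2 h1), max_eq_left h1, one_mul, Real.sqrt_one]
  have hmm : √(min 1 s⁻¹) * √(min 1 s⁻¹) = min 1 s⁻¹ := Real.mul_self_sqrt hm
  have huv := integral_norm_mul_le hu2 hv2 (by positivity) (by positivity) hub hvb
  have huH := integral_norm_mul_le hu2 hH2 (by positivity) (by positivity) hub hHb
  have hvG := integral_norm_mul_le hv2 hG2 (by positivity) (by positivity) hvb hGb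
  have hball : MeasurableSet (Metric.ball x₀ R) := Metric.isOpen_ball.measurableSet
  -- On the ball the cutoff equals 1, so by local uniqueness the global gradient of uv is given
  -- there by the product rule for φu and φv.
  have hloc := hW'.ae_eq_on (hG.mul_of_memLp hH hu2 hG2 hv2 hH2) (Metric.isOpen_ball (x := x₀)
    (ε := R)) (Eventually.of_forall fun x hx => by rw [hφ x hx, mul_one, mul_one])
  refine ⟨W', hW', ?_, ?_⟩
  · calc ∫ x in Metric.ball x₀ R, ‖u x * v x‖
        = ∫ x in Metric.ball x₀ R, ‖u x * φ x‖ * ‖v x * φ x‖ :=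
          setIntegral_congr_fun hball fun x hx => by
            simp only [hφ x hx, mul_one, norm_mul]
      _ ≤ ∫ x, ‖u x * φ x‖ * ‖v x * φ x‖ :=
          setIntegral_le_integral huv.1 (Eventually.of_forall fun x => by positivity)
      _ ≤ _ := huv.2
      _ = C ^ 2 * (√(min 1 s⁻¹) * √(min 1 s⁻¹)) * a * b := by ring
      _ ≤ 2 * C ^ 2 * min 1 s⁻¹ * a * b := by
          rw [hmm]
          gcongr
          exact le_mul_of_one_le_left (sq_nonneg C) one_le_two
  · calc ∫ x in Metric.ball x₀ R, ‖W' x‖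
        ≤ ∫ x in Metric.ball x₀ R, (‖u x * φ x‖ * ‖H x‖ + ‖v x * φ x‖ * ‖G x‖) := by
          refine integral_mono_of_nonneg (Eventually.of_forall fun x => norm_nonneg _)
            (huH.1.add hvG.1).integrableOn ?_
          filter_upwards [ae_restrict_of_ae hloc, ae_restrict_mem hball] with x hx hxb
          rw [hx hxb, ← norm_smul, ← norm_smul]
          exact norm_add_le _ _
      _ ≤ ∫ x, (‖u x * φ x‖ * ‖H x‖ + ‖v x * φ x‖ * ‖G x‖) :=
          setIntegral_le_integral (huH.1.add hvG.1) (Eventually.of_forall fun x => by positivity)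
      _ ≤ C * √(min 1 s⁻¹) * a * (C * √(max 1 s) * b) +
          C * √(min 1 s⁻¹) * b * (C * √(max 1 s) * a) := by
          rw [integral_add huH.1 hvG.1]; exact add_le_add huH.2 hvG.2
      _ = 2 * C ^ 2 * (√(min 1 s⁻¹) * √(max 1 s)) * a * b := by ring
      _ = 2 * C ^ 2 * a * b := by rw [hmM, mul_one]

end ProductOfSolutions

/-! ### Integration by parts against a mollified rough function -/

section Oscillation

variable {d : ℕ}

/-- Smooth nonnegative kernels of mass one at scale `s⁻¹`, with gradients of mass `O(s)`. -/
theorem exists_scaled_kernel (d : ℕ) : ∃ A : ℝ, 0 ≤ A ∧ ∀ s : ℝ, 0 < s → ∃ ρ : Rd d → ℝ,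
    ContDiff ℝ ∞ ρ ∧ HasCompactSupport ρ ∧ (∀ x, 0 ≤ ρ x) ∧ ∫ x, ρ x = 1 ∧
    tsupport ρ ⊆ Metric.closedBall 0 s⁻¹ ∧ ∫ x, ‖fderiv ℝ ρ x‖ ≤ A * s := by
  -- This kernel lives in the unit ball; its mass-preserving dilation to scale s⁻¹ multiplies the
  -- mass of the gradient by s.
  set ρ₀ := approxDelta d 0 with hρ₀
  have h1 : ContDiff ℝ ∞ ρ₀ := contDiff_approxDelta d 0
  refine ⟨∫ x, ‖fderiv ℝ ρ₀ x‖, integral_nonneg fun x => norm_nonneg _, fun s hs => ?_⟩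
  have hsupp : tsupport (fun x => s ^ d * ρ₀ (s • x)) ⊆ Metric.closedBall (0 : Rd d) s⁻¹ := by
    refine closure_minimal (fun x hx => ?_) Metric.isClosed_closedBall
    have hx0 : ρ₀ (s • x) ≠ 0 := right_ne_zero_of_mul hx
    have hx1 : s • x ∈ Metric.ball (0 : Rd d) (shrinkingBump d 0).rOut := by
      rw [← (shrinkingBump d 0).support_normed_eq (μ := volume)]; exact hx0
    rw [mem_ball_zero_iff, norm_smul, Real.norm_of_nonneg hs.le] at hx1
    have hx2 : s * ‖x‖ < 1 := by simpa [shrinkingBump] using hx1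
    rw [mem_closedBall_zero_iff, ← one_div, le_div_iff₀ hs, mul_comm]
    exact hx2.le
  refine ⟨fun x => s ^ d * ρ₀ (s • x), contDiff_const.mul (h1.comp (contDiff_const_smul s)),
    (isCompact_closedBall _ _).of_isClosed_subset (isClosed_tsupport _) hsupp,
    fun x => mul_nonneg (by positivity) (approxDelta_nonneg d 0 _), ?_, hsupp, ?_⟩
  · rw [integral_const_mul, Measure.integral_comp_smul, hρ₀, integral_approxDelta, finrank_euclideanSpace_fin,
      abs_of_pos (by positivity), smul_eq_mul, mul_one, mul_inv_cancel₀ (by positivity)]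
  · have hfd : ∀ x, ‖fderiv ℝ (fun x => s ^ d * ρ₀ (s • x)) x‖ =
        s ^ d * (s * ‖fderiv ℝ ρ₀ (s • x)‖) := by
      intro x
      have hdiff : DifferentiableAt ℝ (fun x => ρ₀ (s • x)) x :=
        (h1.comp (contDiff_const_smul s)).differentiable (by simp) x
      rw [fderiv_const_mul hdiff, fderiv_comp_smul, norm_smul, norm_smul,
        Real.norm_of_nonneg (by positivity), Real.norm_of_nonneg hs.le]
    simp only [hfd]
    rw [integral_const_mul, integral_const_mul, Measure.integral_comp_smul volume (fun x => ‖fderiv ℝ ρ₀ x‖),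
      finrank_euclideanSpace_fin, abs_of_pos (by positivity), smul_eq_mul]
    refine le_of_eq ?_
    have : s ^ d ≠ 0 := by positivity
    field_simp

theorem integral_fderiv_apply_eq_zero {ρ : Rd d → ℝ} (h1 : ContDiff ℝ ∞ ρ)
    (h2 : HasCompactSupport ρ) (e : Rd d) : ∫ x, fderiv ℝ ρ x e = 0 := by
  have h := (hasWeakFDeriv_of_contDiff (contDiff_const (c := (1 : ℝ)))).integral_eq ρ h1 h2 e
  simpa using h

variable {ρ : Rd d → ℝ} {ℓ : Rd d → ℝ} {r δ : ℝ}

theorem norm_sub_mollify_le (h1 : ContDiff ℝ ∞ ρ) (h2 : HasCompactSupport ρ) (h0 : ∀ x, 0 ≤ ρ x)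
    (hi : ∫ x, ρ x = 1) (hr : tsupport ρ ⊆ Metric.closedBall 0 r) (hℓ : LocallyIntegrable ℓ volume)
    {x : Rd d} (hx : ∀ᵐ y, ‖x - y‖ ≤ r → ‖ℓ x - ℓ y‖ ≤ δ) : ‖ℓ x - mollify ρ ℓ x‖ ≤ δ := by
  have h3 := contDiff_comp_const_sub h1 x
  have h4 := hasCompactSupport_comp_const_sub h2 x
  have i1 : Integrable fun t => ρ (x - t) := h3.continuous.integrable_of_hasCompactSupport h4
  have i2 := hℓ.integrable_smul_left_of_hasCompactSupport h3.continuous h4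
  have e1 : ℓ x - mollify ρ ℓ x = ∫ t, ρ (x - t) * (ℓ x - ℓ t) := by
    simp only [smul_eq_mul] at i2
    simp only [mul_sub]
    rw [integral_sub (i1.mul_const _) i2, integral_mul_const, integral_comp_const_sub, hi, one_mul]
    rfl
  rw [e1]
  refine (norm_integral_le_of_norm_le (i1.mul_const δ) ?_).trans (le_of_eq ?_)
  · filter_upwards [hx] with t ht
    rw [norm_mul, Real.norm_of_nonneg (h0 _)]
    by_cases htr : ‖x - t‖ ≤ r
    · exact mul_le_mul_of_nonneg_left (ht htr) (h0 _)
    · have : ρ (x - t) = 0 := image_eq_zero_of_notMem_tsupport fun h =>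
        htr (mem_closedBall_zero_iff.1 (hr h))
      simp [this]
  · rw [integral_mul_const, integral_comp_const_sub, hi, one_mul]

/-- The derivative of the kernel has integral zero, so ℓ(x) may be subtracted under the integral;
only the oscillation of ℓ remains. -/
theorem norm_fderiv_mollify_le (h1 : ContDiff ℝ ∞ ρ) (h2 : HasCompactSupport ρ)
    (hr : tsupport ρ ⊆ Metric.closedBall 0 r) (hℓ : LocallyIntegrable ℓ volume)
    {x : Rd d} (hx : ∀ᵐ y, ‖x - y‖ ≤ r → ‖ℓ x - ℓ y‖ ≤ δ) {e : Rd d} (he : ‖e‖ ≤ 1) :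
    ‖fderiv ℝ (mollify ρ ℓ) x e‖ ≤ (∫ t, ‖fderiv ℝ ρ t‖) * δ := by
  have h3c : Continuous (fderiv ℝ ρ) := h1.continuous_fderiv (by simp)
  have h3 : Continuous fun t => fderiv ℝ ρ (x - t) e :=
    (h3c.comp (continuous_const.sub continuous_id)).clm_apply continuous_const
  have h4 : HasCompactSupport fun t => fderiv ℝ ρ (x - t) e :=
    (h2.fderiv_apply (𝕜 := ℝ) e).comp_homeomorph (Homeomorph.subLeft x)
  have i1 : Integrable fun t => fderiv ℝ ρ (x - t) e := h3.integrable_of_hasCompactSupport h4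
  have i2 := hℓ.integrable_smul_left_of_hasCompactSupport h3 h4
  have i3 : Integrable fun t => ‖fderiv ℝ ρ t‖ :=
    (h3c.integrable_of_hasCompactSupport (h2.fderiv (𝕜 := ℝ))).norm
  have e0 : ∫ t, fderiv ℝ ρ (x - t) e = 0 := by
    rw [integral_comp_const_sub (fun t => fderiv ℝ ρ t e), integral_fderiv_apply_eq_zero h1 h2]
  have e1 : fderiv ℝ (mollify ρ ℓ) x e = ∫ t, fderiv ℝ ρ (x - t) e * (ℓ t - ℓ x) := by
    simp only [smul_eq_mul] at i2
    simp only [mul_sub]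
    rw [integral_sub i2 (i1.mul_const _), integral_mul_const, e0, zero_mul, sub_zero,
      fderiv_mollify_apply h1 h2 hℓ]
    rfl
  rw [e1]
  refine (norm_integral_le_of_norm_le ((i3.comp_sub_left x).mul_const δ) ?_).trans (le_of_eq ?_)
  · filter_upwards [hx] with t ht
    rw [norm_mul]
    by_cases htr : ‖x - t‖ ≤ r
    · refine mul_le_mul ?_ ?_ (norm_nonneg _) (norm_nonneg _)
      · exact (ContinuousLinearMap.le_opNorm _ _).trans (mul_le_of_le_one_right (norm_nonneg _) he)
      · rw [norm_sub_rev]; exact ht htr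
    · have : fderiv ℝ ρ (x - t) = 0 := fderiv_eq_zero_of_notMem_tsupport fun h =>
        htr (mem_closedBall_zero_iff.1 (hr h))
      simp [this]
  · rw [integral_mul_const, integral_comp_const_sub (fun t => ‖fderiv ℝ ρ t‖)]

theorem integrableOn_ball_of_locallyIntegrable {E : Type*} [NormedAddCommGroup E] {f : Rd d → E}
    (hf : LocallyIntegrable f volume) (x₀ : Rd d) (R : ℝ) : IntegrableOn f (Metric.ball x₀ R) :=
  (hf.integrableOn_isCompact (isCompact_closedBall x₀ R)).mono_set Metric.ball_subset_closedBall

theorem norm_integral_le_of_eq_zero_outside {E F : Type*} [NormedAddCommGroup E] [NormedSpace ℝ E]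
    [NormedAddCommGroup F] {f : Rd d → E} {g : Rd d → F} {x₀ : Rd d} {R c : ℝ}
    (hg : LocallyIntegrable g volume) (h0 : ∀ᵐ x, x ∉ Metric.ball x₀ R → f x = 0)
    (h : ∀ᵐ x, x ∈ Metric.ball x₀ R → ‖f x‖ ≤ c * ‖g x‖) :
    ‖∫ x, f x‖ ≤ c * ∫ x in Metric.ball x₀ R, ‖g x‖ := by
  have hball : MeasurableSet (Metric.ball x₀ R) := Metric.isOpen_ball.measurableSet
  rw [← integral_const_mul, ← integral_indicator hball]
  refine norm_integral_le_of_norm_le ?_ ?_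
  · exact (integrable_indicator_iff hball).2
      ((integrableOn_ball_of_locallyIntegrable hg x₀ R).norm.const_mul c)
  · filter_upwards [h0, h] with x hx hx'
    by_cases hxb : x ∈ Metric.ball x₀ R
    · rw [Set.indicator_of_mem hxb]; exact hx' hxb
    · rw [Set.indicator_of_notMem hxb, hx hxb, norm_zero]

theorem integrable_smul_of_bounded {E : Type*} [NormedAddCommGroup E] [NormedSpace ℝ E]
    {g : Rd d → E} {x₀ : Rd d} {R M : ℝ}
    (hg : LocallyIntegrable g volume) (hℓ : AEStronglyMeasurable ℓ volume)
    (hM : ∀ᵐ x, ‖ℓ x‖ ≤ M) (h0 : ∀ᵐ x, x ∉ Metric.ball x₀ R → ℓ x = 0) :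
    Integrable fun x => ℓ x • g x := by
  have hball : MeasurableSet (Metric.ball x₀ R) := Metric.isOpen_ball.measurableSet
  have h1 : Integrable ((Metric.ball x₀ R).indicator g) := (integrable_indicator_iff hball).2
    (integrableOn_ball_of_locallyIntegrable hg x₀ R)
  have h2 : Integrable fun x => ℓ x • (Metric.ball x₀ R).indicator g x := h1.bdd_smul M hℓ hM
  refine h2.congr ?_
  filter_upwards [h0] with x hx
  by_cases hxb : x ∈ Metric.ball x₀ R
  · rw [Set.indicator_of_mem hxb]
  · rw [hx hxb, zero_smul, zero_smul]

/-- Integration by parts against a rough function: its mollification at scale `s⁻¹` can be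
differentiated, and the difference is controlled by the oscillation. -/
theorem exists_norm_integral_smul_fderiv_le (d : ℕ) : ∃ A : ℝ, 0 ≤ A ∧ ∀ (x₀ : Rd d) (R M δ s : ℝ)
    (ℓ : Rd d → ℝ), 1 ≤ s → 0 ≤ δ → AEStronglyMeasurable ℓ volume → (∀ᵐ x, ‖ℓ x‖ ≤ M) →
    (∀ᵐ x, x ∉ Metric.ball x₀ R → ℓ x = 0) →
    (∀ᵐ x, ∀ᵐ y, ‖x - y‖ ≤ s⁻¹ → ‖ℓ x - ℓ y‖ ≤ δ) →
    ∀ (W : Rd d → ℂ) (W' : Rd d → Rd d →L[ℝ] ℂ), HasWeakFDeriv W W' → ∀ e : Rd d, ‖e‖ ≤ 1 →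
    ‖∫ x, ℓ x • W' x e‖ ≤ δ * (∫ x in Metric.ball x₀ (R + 2), ‖W' x‖) +
      A * δ * s * ∫ x in Metric.ball x₀ (R + 2), ‖W x‖ := by
  obtain ⟨A, hA, hker⟩ := exists_scaled_kernel d
  refine ⟨A, hA, fun x₀ R M δ s ℓ hs hδ hm hM h0 hosc W W' hW e he => ?_⟩
  obtain ⟨ρ, h1, h2, hpos, hi, hr, hgrad⟩ := hker s (zero_lt_one.trans_le hs)
  have hs1 : s⁻¹ ≤ 1 := inv_le_one_of_one_le₀ hs
  have hℓ : LocallyIntegrable ℓ volume :=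
    locallyIntegrable_of_norm_le (locallyIntegrable_const (1 : ℝ)) hm (M := M)
      (by simpa using hM)
  have hψ : ContDiff ℝ ∞ (mollify ρ ℓ) := contDiff_mollify h1 h2 hℓ
  have hψ0 : ∀ x, x ∉ Metric.closedBall x₀ (R + 1) → mollify ρ ℓ x = 0 := by
    intro x hx
    refine integral_eq_zero_of_ae ?_
    filter_upwards [h0] with t ht
    by_cases htb : t ∈ Metric.ball x₀ R
    · have : ρ (x - t) = 0 := image_eq_zero_of_notMem_tsupport fun h => by
        have h3 := mem_closedBall_zero_iff.1 (hr h)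
        rw [Metric.mem_ball] at htb
        refine hx (Metric.mem_closedBall.2 ((dist_triangle x t x₀).trans ?_))
        rw [dist_eq_norm x t]; linarith
      simp [this]
    · simp [ht htb]
  have hψs : HasCompactSupport (mollify ρ ℓ) :=
    HasCompactSupport.intro (isCompact_closedBall x₀ (R + 1)) hψ0
  -- As s⁻¹ ≤ 1, the mollified function is supported in the closed ball of radius R + 1; the further
  -- unit gives room for an open ball.
  have hsub : Metric.closedBall x₀ (R + 1) ⊆ Metric.ball x₀ (R + 2) :=
    Metric.closedBall_subset_ball (by linarith)
  have hts : tsupport (mollify ρ ℓ) ⊆ Metric.closedBall x₀ (R + 1) :=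
    closure_minimal (fun x hx => by_contra fun h => hx (hψ0 x h)) Metric.isClosed_closedBall
  have hW'e : LocallyIntegrable (fun x => W' x e) volume :=
    locallyIntegrable_of_norm_le hW.locallyIntegrable_deriv (M := ‖e‖)
      (hW.locallyIntegrable_deriv.aestronglyMeasurable.apply_continuousLinearMap e)
      (Eventually.of_forall fun x => (ContinuousLinearMap.le_opNorm _ _).trans_eq (mul_comm _ _))
  have i1 : Integrable fun x => ℓ x • W' x e := integrable_smul_of_bounded hW'e hm hM h0
  have i2 : Integrable fun x => mollify ρ ℓ x • W' x e :=
    integrable_smul_clm_apply hW.locallyIntegrable_deriv hψ.continuous hψs e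
  -- The rough remainder keeps the derivative on W, while the mollified part moves it off W.
  have e1 : ∫ x, ℓ x • W' x e = (∫ x, (ℓ x - mollify ρ ℓ x) • W' x e) +
      -∫ x, (fderiv ℝ (mollify ρ ℓ) x e) • W x := by
    rw [hW.integral_eq _ hψ hψs e, neg_neg]
    simp only [sub_smul]
    rw [integral_sub i1 i2, sub_add_cancel]
  rw [e1]
  refine (norm_add_le _ _).trans (add_le_add ?_ ?_)
  · refine norm_integral_le_of_eq_zero_outside hW.locallyIntegrable_deriv ?_ ?_
    · filter_upwards [h0] with x hx hxb
      rw [hx fun h => hxb (Metric.ball_subset_ball (by linarith) h), hψ0 x fun h => hxb (hsub h),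
        sub_zero, zero_smul]
    · filter_upwards [hosc] with x hx _
      rw [norm_smul]
      refine mul_le_mul (norm_sub_mollify_le h1 h2 hpos hi hr hℓ hx) ?_ (norm_nonneg _) hδ
      exact (ContinuousLinearMap.le_opNorm _ _).trans (mul_le_of_le_one_right (norm_nonneg _) he)
  · rw [norm_neg]
    refine norm_integral_le_of_eq_zero_outside hW.locallyIntegrable ?_ ?_
    · refine Eventually.of_forall fun x hxb => ?_
      rw [fderiv_eq_zero_of_notMem_tsupport fun h => hxb (hsub (hts h)), zero_apply, zero_smul]
    · filter_upwards [hosc] with x hx _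
      rw [norm_smul]
      refine mul_le_mul_of_nonneg_right ((norm_fderiv_mollify_le h1 h2 hr hℓ hx he).trans ?_)
        (norm_nonneg _)
      calc _ ≤ (A * s) * δ := mul_le_mul_of_nonneg_right hgrad hδ
        _ = A * δ * s := by ring

end Oscillation

/-! ### The form in terms of ∇ log γ, and the main estimate -/

section Conductivity

variable {d : ℕ}

theorem ae_norm_le_toReal_eLpNorm_top {α E : Type*} [MeasurableSpace α] {μ : Measure α}
    [NormedAddCommGroup E] {f : α → E} (h : eLpNorm f ⊤ μ < ⊤) :
    ∀ᵐ x ∂μ, ‖f x‖ ≤ (eLpNorm f ⊤ μ).toReal := by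
  rw [eLpNorm_exponent_top] at h ⊢
  filter_upwards [ae_le_eLpNormEssSup (f := f) (μ := μ)] with x hx
  rw [← toReal_enorm]
  exact ENNReal.toReal_mono h.ne hx

/-- On the open complement of the closed ball γ agrees with a constant, and weak derivatives are
local. -/
theorem IsConductivity.weakDeriv_eq_zero {x₀ : Rd d} {R : ℝ} {γ : Rd d → ℝ}
    {γ' : Rd d → Rd d →L[ℝ] ℝ} (h : IsConductivity (Metric.ball x₀ R) γ)
    (hγ' : HasWeakFDeriv γ γ') : ∀ᵐ x, x ∉ Metric.closedBall x₀ R → γ' x = 0 := by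
  obtain ⟨k, hk⟩ := h.2
  have h1 := hγ'.ae_eq_on (hasWeakFDeriv_of_contDiff (contDiff_const (c := k)))
    (O := (Metric.closedBall x₀ R)ᶜ) Metric.isClosed_closedBall.isOpen_compl
    (hk.mono fun x hx hxb => hx fun h => hxb (Metric.ball_subset_closedBall h))
  filter_upwards [h1] with x hx hxb
  rw [hx hxb]
  simp

/-- A conductivity in `L^∞` with a bounded weak derivative. -/
structure IsLipschitzConductivity (x₀ : Rd d) (R : ℝ) (γ : Rd d → ℝ) (γ' : Rd d → Rd d →L[ℝ] ℝ) :
    Prop where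
  isConductivity : IsConductivity (Metric.ball x₀ R) γ
  memLp : MemLp γ ⊤ volume
  hasWeakFDeriv : HasWeakFDeriv γ γ'
  eLpNorm_lt_top : eLpNorm γ' ⊤ volume < ⊤

variable {x₀ : Rd d} {R : ℝ} {γ : Rd d → ℝ} {γ' : Rd d → Rd d →L[ℝ] ℝ}

theorem IsLipschitzConductivity.hasWeakFDeriv_comp (h : IsLipschitzConductivity x₀ R γ γ')
    {Φ Φ' : ℝ → ℝ} (hΦ : ContDiffOn ℝ 1 Φ (Set.Ioi 0))
    (hΦ' : ∀ t, 0 < t → HasDerivAt Φ (Φ' t) t) :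
    HasWeakFDeriv (fun x => Φ (γ x)) (fun x => Φ' (γ x) • γ' x) ∧
      (∃ A, ∀ᵐ x, ‖Φ (γ x)‖ ≤ A) ∧ ∃ A, ∀ᵐ x, ‖Φ' (γ x) • γ' x‖ ≤ A := by
  obtain ⟨c, hc, hcγ⟩ := h.isConductivity.1
  have hM := ae_norm_le_toReal_eLpNorm_top h.memLp.2
  have hM' := ae_norm_le_toReal_eLpNorm_top h.eLpNorm_lt_top
  have hΦ'c : ContinuousOn Φ' (Set.Ioi 0) :=
    (hΦ.continuousOn_deriv_of_isOpen isOpen_Ioi le_rfl).congr fun t ht => (hΦ' t ht).deriv.symm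
  set M := (eLpNorm γ ⊤ volume).toReal
  have hIcc : Set.Icc c M ⊆ Set.Ioi 0 := fun t ht => hc.trans_le ht.1
  have hmem : ∀ᵐ x, γ x ∈ Set.Icc c M := by
    filter_upwards [hcγ, hM] with x h1 h2 using ⟨h1, (le_abs_self _).trans h2⟩
  obtain ⟨A, hA⟩ := isCompact_Icc.exists_bound_of_continuousOn (hΦ.continuousOn.mono hIcc)
  obtain ⟨A', hA'⟩ := isCompact_Icc.exists_bound_of_continuousOn (hΦ'c.mono hIcc)
  refine ⟨h.hasWeakFDeriv.comp_of_bounded hc hcγ hM hM' hΦ hΦ', ⟨A, hmem.mono fun x hx => hA _ hx⟩,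
    A' * (eLpNorm γ' ⊤ volume).toReal, ?_⟩
  filter_upwards [hmem, hM'] with x h1 h2
  rw [norm_smul]
  exact mul_le_mul (hA' _ h1) h2 (norm_nonneg _) ((norm_nonneg _).trans (hA' _ h1))

theorem IsLipschitzConductivity.log (h : IsLipschitzConductivity x₀ R γ γ') :
    HasWeakFDeriv (fun x => Real.log (γ x)) (fun x => (γ x)⁻¹ • γ' x) ∧
      ∃ A, ∀ᵐ x, ‖(γ x)⁻¹ • γ' x‖ ≤ A := by
  have h1 := h.hasWeakFDeriv_comp (Φ := Real.log) (Φ' := fun t => t⁻¹)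
    (Real.contDiffOn_log.mono fun _ ht => (Set.mem_Ioi.1 ht).ne')
    (fun _ ht => Real.hasDerivAt_log ht.ne')
  exact ⟨h1.1, h1.2.2⟩

theorem IsLipschitzConductivity.sqrt (h : IsLipschitzConductivity x₀ R γ γ') :
    HasWeakFDeriv (fun x => √(γ x)) (fun x => (1 / (2 * √(γ x))) • γ' x) :=
  (h.hasWeakFDeriv_comp (Φ := Real.sqrt) (Φ' := fun t => 1 / (2 * √t))
    (fun _ ht => (Real.contDiffAt_sqrt (Set.mem_Ioi.1 ht).ne').contDiffWithinAt)
    (fun _ ht => Real.hasDerivAt_sqrt ht.ne')).1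

theorem IsLipschitzConductivity.testProduct (h : IsLipschitzConductivity x₀ R γ γ')
    {u v : Rd d → ℂ} {W' : Rd d → Rd d →L[ℝ] ℂ} (hW : HasWeakFDeriv (fun x => u x * v x) W') :
    HasWeakFDeriv (testProduct γ u v) (fun x => (√(γ x))⁻¹ • W' x +
      ((-(1 / (2 * √(γ x))) / √(γ x) ^ 2) • γ' x).smulRight (u x * v x)) := by
  obtain ⟨h1, ⟨A, hA⟩, A', hA'⟩ := h.hasWeakFDeriv_comp (Φ := fun t => (√t)⁻¹)
    (Φ' := fun t => -(1 / (2 * √t)) / √t ^ 2)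
    (fun t ht => ((Real.contDiffAt_sqrt (Set.mem_Ioi.1 ht).ne').inv
      (Real.sqrt_pos.2 ht).ne').contDiffWithinAt)
    (fun t ht => (Real.hasDerivAt_sqrt ht.ne').inv (Real.sqrt_pos.2 ht).ne')
  exact (h1.smul_of_bounded hW hA hA').congr_ae
    (Eventually.of_forall fun x => Complex.real_smul) EventuallyEq.rfl

/-- The chain rule for √γ and the product rule for γ^(-½)·uv express everything through ∇log γ =
γ⁻¹∇γ. The powers of √γ cancel, and the chosen weak derivatives coincide with these formulas by
uniqueness. -/
theorem IsLipschitzConductivity.formIntegrand_ae_eq (h : IsLipschitzConductivity x₀ R γ γ')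
    {u v : Rd d → ℂ} {W' : Rd d → Rd d →L[ℝ] ℂ} (hW : HasWeakFDeriv (fun x => u x * v x) W') :
    formIntegrand γ u v =ᵐ[volume] fun x => ∑ j,
      ((1 / 2 : ℂ) * (((γ x)⁻¹ • γ' x) (EuclideanSpace.single j 1) •
          W' x (EuclideanSpace.single j 1)) -
        (1 / 4 : ℂ) * ((((γ x)⁻¹ • γ' x) (EuclideanSpace.single j 1)) ^ 2 • (u x * v x))) := by
  obtain ⟨c, hc, hcγ⟩ := h.isConductivity.1
  filter_upwards [h.sqrt.weakFDeriv_ae_eq, (h.testProduct hW).weakFDeriv_ae_eq, hcγ] with x h1 h2 h3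
  have hr : 0 < √(γ x) := Real.sqrt_pos.2 (hc.trans_le h3)
  have hγr : γ x = √(γ x) ^ 2 := (Real.sq_sqrt (hc.trans_le h3).le).symm
  rw [formIntegrand, h1, h2]
  refine Finset.sum_congr rfl fun j _ => ?_
  simp only [add_apply, smul_apply, ContinuousLinearMap.smulRight_apply, smul_eq_mul,
    Complex.real_smul]
  generalize γ' x (EuclideanSpace.single j 1) = p
  generalize W' x (EuclideanSpace.single j 1) = q
  have hinv : (γ x)⁻¹ = (√(γ x) ^ 2)⁻¹ := by rw [← hγr]
  rw [hinv]
  generalize √(γ x) = r at hr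
  have hrC : (r : ℂ) ≠ 0 := by exact_mod_cast hr.ne'
  push_cast
  field_simp
  ring

theorem IsLipschitzConductivity.component (h : IsLipschitzConductivity x₀ R γ γ') {M : ℝ}
    (hM : ∀ᵐ x, ‖(γ x)⁻¹ • γ' x‖ ≤ M) (j : Fin d) :
    AEStronglyMeasurable (fun x => ((γ x)⁻¹ • γ' x) (EuclideanSpace.single j 1)) volume ∧
    (∀ᵐ x, ‖((γ x)⁻¹ • γ' x) (EuclideanSpace.single j 1)‖ ≤ M) ∧
    ∀ᵐ x, x ∉ Metric.ball x₀ (R + 1) → ((γ x)⁻¹ • γ' x) (EuclideanSpace.single j 1) = 0 := by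
  refine ⟨h.log.1.locallyIntegrable_deriv.aestronglyMeasurable.apply_continuousLinearMap _, ?_, ?_⟩
  · filter_upwards [hM] with x hx
    refine ((ContinuousLinearMap.le_opNorm _ _).trans (le_of_eq ?_)).trans hx
    rw [PiLp.norm_single, norm_one, mul_one]
  · filter_upwards [h.isConductivity.weakDeriv_eq_zero h.hasWeakFDeriv] with x hx hxb
    rw [hx fun hx' => hxb (Metric.closedBall_subset_ball (by linarith) hx'), smul_zero, zero_apply]

theorem IsLipschitzConductivity.mqForm_eq (h : IsLipschitzConductivity x₀ R γ γ')
    {u v : Rd d → ℂ} {W' : Rd d → Rd d →L[ℝ] ℂ} (hW : HasWeakFDeriv (fun x => u x * v x) W') :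
    FormDefined γ u v ∧ mqForm γ u v = ∑ j,
      ((1 / 4 : ℂ) * (∫ x, (((γ x)⁻¹ • γ' x) (EuclideanSpace.single j 1)) ^ 2 • (u x * v x)) -
        (1 / 2 : ℂ) * ∫ x, ((γ x)⁻¹ • γ' x) (EuclideanSpace.single j 1) •
          W' x (EuclideanSpace.single j 1)) := by
  obtain ⟨M, hM⟩ := h.log.2
  have i1 : ∀ j : Fin d, Integrable fun x => ((γ x)⁻¹ • γ' x) (EuclideanSpace.single j 1) •
      W' x (EuclideanSpace.single j 1) := by
    intro j
    obtain ⟨hm, hb, h0⟩ := h.component hM j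
    refine integrable_smul_of_bounded (g := fun x => W' x (EuclideanSpace.single j 1)) ?_ hm hb h0
    exact locallyIntegrable_of_norm_le hW.locallyIntegrable_deriv
      (M := ‖EuclideanSpace.single j (1 : ℝ)‖)
      (hW.locallyIntegrable_deriv.aestronglyMeasurable.apply_continuousLinearMap _)
      (Eventually.of_forall fun x => (ContinuousLinearMap.le_opNorm _ _).trans_eq (mul_comm _ _))
  have i2 : ∀ j : Fin d, Integrable fun x =>
      (((γ x)⁻¹ • γ' x) (EuclideanSpace.single j 1)) ^ 2 • (u x * v x) := by
    intro j
    obtain ⟨hm, hb, h0⟩ := h.component hM j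
    refine integrable_smul_of_bounded (M := M ^ 2) hW.locallyIntegrable (hm.pow 2) ?_
      (h0.mono fun x hx hxb => by rw [hx hxb, zero_pow two_ne_zero])
    filter_upwards [hb] with x hx
    rw [norm_pow]
    gcongr
  have i3 : ∀ j : Fin d, Integrable fun x =>
      ((1 / 2 : ℂ) * (((γ x)⁻¹ • γ' x) (EuclideanSpace.single j 1) •
          W' x (EuclideanSpace.single j 1)) -
        (1 / 4 : ℂ) * ((((γ x)⁻¹ • γ' x) (EuclideanSpace.single j 1)) ^ 2 • (u x * v x))) :=
    fun j => ((i1 j).const_mul _).sub ((i2 j).const_mul _)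
  have hae := h.formIntegrand_ae_eq hW
  refine ⟨⟨⟨_, h.sqrt⟩, ⟨_, h.testProduct hW⟩, ?_⟩, ?_⟩
  · exact (integrable_finsetSum Finset.univ fun j _ => i3 j).congr hae.symm
  · rw [mqForm, integral_congr_ae hae, integral_finsetSum Finset.univ fun j _ => i3 j,
      ← Finset.sum_neg_distrib]
    refine Finset.sum_congr rfl fun j _ => ?_
    rw [integral_sub ((i1 j).const_mul _) ((i2 j).const_mul _), integral_const_mul,
      integral_const_mul, neg_sub]

/-- The main estimate of the form by the size and the oscillation at scale `s⁻¹` of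
`∇ log γ`. -/
theorem exists_norm_mqForm_le (d : ℕ) (hd : 3 ≤ d) (x₀ : Rd d) (R : ℝ) : ∃ C : ℝ, 0 ≤ C ∧
    ∀ (γ : Rd d → ℝ) (γ' : Rd d → Rd d →L[ℝ] ℝ), IsLipschitzConductivity x₀ R γ γ' →
    ∀ s : ℝ, 0 < s → ∀ ζ₁ ζ₂ : EuclideanSpace ℂ (Fin d), IsPhase s ζ₁ → IsPhase s ζ₂ →
    ∀ u v : Rd d → ℂ, dotXNorm ζ₁ (1 / 2) u < ⊤ → dotXNorm ζ₂ (1 / 2) v < ⊤ →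
    FormDefined γ u v ∧ ∀ M : ℝ, (∀ᵐ x, ‖(γ x)⁻¹ • γ' x‖ ≤ M) →
      ‖mqForm γ u v‖ ≤ C * (M + M ^ 2) * (dotXNorm ζ₁ (1 / 2) u).toReal *
        (dotXNorm ζ₂ (1 / 2) v).toReal ∧
      ∀ δ : ℝ, 1 ≤ s → 0 ≤ δ → (∀ᵐ x, ∀ᵐ y, ‖x - y‖ ≤ s⁻¹ →
        ‖(γ x)⁻¹ • γ' x - (γ y)⁻¹ • γ' y‖ ≤ δ) →
      ‖mqForm γ u v‖ ≤ C * (δ + M ^ 2 * s⁻¹) * (dotXNorm ζ₁ (1 / 2) u).toReal *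
        (dotXNorm ζ₂ (1 / 2) v).toReal := by
  -- One unit is for an open ball containing the support of ∇log γ, two more for the mollification.
  obtain ⟨C, hC, hprod⟩ := exists_product_bounds d hd x₀ (R + 1 + 2)
  obtain ⟨A, hA, hosc⟩ := exists_norm_integral_smul_fderiv_le d
  refine ⟨d * (C * (1 + A)), by positivity, fun γ γ' h s hs ζ₁ ζ₂ hζ₁ hζ₂ u v hu hv => ?_⟩
  obtain ⟨W', hW, hb1, hb2⟩ := hprod s hs ζ₁ ζ₂ hζ₁ hζ₂ u v hu hv
  obtain ⟨hdef, heq⟩ := h.mqForm_eq hW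
  refine ⟨hdef, fun M hM => ?_⟩
  set a := (dotXNorm ζ₁ (1 / 2) u).toReal
  set b := (dotXNorm ζ₂ (1 / 2) v).toReal
  have ha : 0 ≤ a := ENNReal.toReal_nonneg
  have hb : 0 ≤ b := ENNReal.toReal_nonneg
  have hM0 : 0 ≤ M := by
    obtain ⟨x, hx⟩ := hM.exists
    exact (norm_nonneg _).trans hx
  have hN : 0 ≤ C * a * b := by positivity
  have hCA : C * a * b ≤ C * (1 + A) * a * b := by
    rw [show C * (1 + A) * a * b = C * a * b + C * a * b * A by ring]
    exact le_add_of_nonneg_right (mul_nonneg hN hA)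
  -- The quadratic term is bounded alike in both estimates; `K` is left open for the linear one.
  have hsum : ∀ K : ℝ, (∀ j : Fin d, ‖∫ x, ((γ x)⁻¹ • γ' x) (EuclideanSpace.single j 1) •
      W' x (EuclideanSpace.single j 1)‖ ≤ K) →
      ‖mqForm γ u v‖ ≤ d * (M ^ 2 * (C * min 1 s⁻¹ * a * b) + K) := by
    intro K hK
    rw [heq]
    refine (norm_sum_le_of_le (Finset.univ : Finset (Fin d)) (n := fun _ => M ^ 2 * (C * min 1 s⁻¹ * a * b) + K)
      fun j _ => ?_).trans (by
        rw [Finset.sum_const, Finset.card_univ, Fintype.card_fin, nsmul_eq_mul])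
    obtain ⟨hm, hMj, h0⟩ := h.component hM j
    have hsq := norm_integral_le_of_eq_zero_outside (c := M ^ 2) (x₀ := x₀) (R := R + 1 + 2)
      (f := fun x => (((γ x)⁻¹ • γ' x) (EuclideanSpace.single j 1)) ^ 2 • (u x * v x))
      hW.locallyIntegrable (h0.mono fun x hx hxb => by
        rw [hx fun h => hxb (Metric.ball_subset_ball (by linarith) h), zero_pow two_ne_zero,
          zero_smul]) (by
        filter_upwards [hMj] with x hx _
        rw [norm_smul, norm_pow]
        gcongr)
    have hsq' := hsq.trans (mul_le_mul_of_nonneg_left hb1 (sq_nonneg M))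
    have hKj := hK j
    refine (norm_sub_le _ _).trans ?_
    rw [norm_mul, norm_mul]
    refine add_le_add (le_trans ?_ hsq') (le_trans ?_ hKj)
    · exact mul_le_of_le_one_left (norm_nonneg _) (by norm_num)
    · exact mul_le_of_le_one_left (norm_nonneg _) (by norm_num)
  refine ⟨?_, fun δ hs1 hδ hosc' => ?_⟩
  · refine (hsum (M * (C * a * b)) fun j => ?_).trans ?_
    · obtain ⟨hm, hMj, h0⟩ := h.component hM j
      refine (norm_integral_le_of_eq_zero_outside (c := M) (x₀ := x₀) (R := R + 1 + 2)
        hW.locallyIntegrable_deriv (h0.mono fun x hx hxb => by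
          rw [hx fun h => hxb (Metric.ball_subset_ball (by linarith) h), zero_smul]) ?_).trans
        (mul_le_mul_of_nonneg_left hb2 hM0)
      filter_upwards [hMj] with x hx _
      rw [norm_smul]
      refine mul_le_mul hx ((ContinuousLinearMap.le_opNorm _ _).trans (le_of_eq ?_))
        (norm_nonneg _) hM0
      rw [PiLp.norm_single, norm_one, mul_one]
    · have h1 : C * min 1 s⁻¹ * a * b ≤ C * a * b := by
        have : C * min 1 s⁻¹ ≤ C := mul_le_of_le_one_right hC (min_le_left _ _)
        gcongr
      calc (d : ℝ) * (M ^ 2 * (C * min 1 s⁻¹ * a * b) + M * (C * a * b))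
          ≤ d * (M ^ 2 * (C * (1 + A) * a * b) + M * (C * (1 + A) * a * b)) := by
            exact mul_le_mul_of_nonneg_left (add_le_add
              (mul_le_mul_of_nonneg_left (h1.trans hCA) (sq_nonneg M))
              (mul_le_mul_of_nonneg_left hCA hM0)) (Nat.cast_nonneg d)
        _ = _ := by ring
  · refine (hsum (C * (1 + A) * a * b * δ) fun j => ?_).trans ?_
    · obtain ⟨hm, hMj, h0⟩ := h.component hM j
      have hnorm : ‖EuclideanSpace.single j (1 : ℝ)‖ ≤ 1 := by
        rw [PiLp.norm_single, norm_one]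
      refine (hosc x₀ (R + 1) M δ s _ hs1 hδ hm hMj h0 ?_ _ W' hW _ hnorm).trans ?_
      · filter_upwards [hosc'] with x hx
        filter_upwards [hx] with y hy hxy
        rw [← sub_apply]
        exact ((ContinuousLinearMap.le_opNorm _ _).trans
          (mul_le_of_le_one_right (norm_nonneg _) hnorm)).trans (hy hxy)
      · have h1 : C * min 1 s⁻¹ * a * b = C * a * b * s⁻¹ := by
          rw [min_eq_right (inv_le_one_of_one_le₀ hs1)]; ring
        rw [h1] at hb1
        calc _ ≤ δ * (C * a * b) + A * δ * s * (C * a * b * s⁻¹) := by gcongr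
          _ = C * (1 + A) * a * b * δ := by field_simp
    · rw [min_eq_right (inv_le_one_of_one_le₀ hs1)]
      have hs0 : 0 ≤ s⁻¹ := inv_nonneg.2 hs.le
      calc (d : ℝ) * (M ^ 2 * (C * s⁻¹ * a * b) + C * (1 + A) * a * b * δ)
          = d * (M ^ 2 * s⁻¹ * (C * a * b) + C * (1 + A) * a * b * δ) := by ring
        _ ≤ d * (M ^ 2 * s⁻¹ * (C * (1 + A) * a * b) + C * (1 + A) * a * b * δ) := by gcongr
        _ = _ := by ring

end Conductivity

/-! ### The W^{θ,∞} norm and oscillation -/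

section SobolevNorm

variable {d : ℕ} {V : Type*} [NormedAddCommGroup V] [NormedSpace ℝ V]

theorem sobolevSeminorm_zero (F : Rd d → V) : sobolevSeminorm 0 F = 0 := if_pos rfl

theorem sobolevSeminorm_one (F : Rd d → V) : sobolevSeminorm 1 F =
    ⨅ (F' : Rd d → Rd d →L[ℝ] V) (_ : HasWeakFDeriv F F'), eLpNorm F' ⊤ volume := by
  rw [sobolevSeminorm, if_neg one_ne_zero, if_pos rfl]

theorem sobolevSeminorm_of_ne {θ : ℝ} (h0 : θ ≠ 0) (h1 : θ ≠ 1) (F : Rd d → V) :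
    sobolevSeminorm θ F = eLpNorm (fun p : Rd d × Rd d => ‖F p.1 - F p.2‖ / ‖p.1 - p.2‖ ^ θ) ⊤
      ((volume : Measure (Rd d)).prod volume) := by
  rw [sobolevSeminorm, if_neg h0, if_neg h1]

theorem exists_hasWeakFDeriv_of_sobolevSeminorm_one {F : Rd d → V}
    (h : sobolevSeminorm 1 F < ⊤) : ∃ F', HasWeakFDeriv F F' ∧ eLpNorm F' ⊤ volume < ⊤ := by
  rw [sobolevSeminorm_one] at h
  obtain ⟨F', h⟩ := iInf_lt_iff.1 h
  obtain ⟨hF', h⟩ := iInf_lt_iff.1 h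
  exact ⟨F', hF', h⟩

theorem HasWeakFDeriv.sobolevSeminorm_one_eq [CompleteSpace V] {F : Rd d → V}
    {F' : Rd d → Rd d →L[ℝ] V} (h : HasWeakFDeriv F F') :
    sobolevSeminorm 1 F = eLpNorm F' ⊤ volume := by
  rw [sobolevSeminorm_one]
  refine le_antisymm (iInf₂_le F' h) (le_iInf₂ fun G hG => le_of_eq (eLpNorm_congr_ae ?_))
  filter_upwards [h.ae_eq_on hG isOpen_univ (by simp)] with x hx using hx trivial

/-- The oscillation of a function in `W^{θ,∞}` at scale `r` is at most of order `r ^ θ`. -/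
theorem ae_norm_sub_le_of_sobolevNorm [CompleteSpace V] {θ : ℝ} (h0 : 0 ≤ θ) {F : Rd d → V}
    (h : sobolevNorm θ F < ⊤) {r : ℝ} (hr : 0 < r) :
    ∀ᵐ x, ∀ᵐ y, ‖x - y‖ ≤ r → ‖F x - F y‖ ≤ 2 * (sobolevNorm θ F).toReal * r ^ θ := by
  set M := (sobolevNorm θ F).toReal with hM
  have hM0 : 0 ≤ M := ENNReal.toReal_nonneg
  have hsemi : sobolevSeminorm θ F < ⊤ := lt_of_le_of_lt le_add_self h
  have hsemiM : (sobolevSeminorm θ F).toReal ≤ M := ENNReal.toReal_mono h.ne le_add_self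
  -- The factor 2 is needed only for θ = 0, where the oscillation is bounded by twice the supremum.
  have hle : ∀ t : ℝ, 0 ≤ t → t ≤ M * r ^ θ → t ≤ 2 * M * r ^ θ := fun t _ ht => by
    have : 0 ≤ M * r ^ θ := by positivity
    linarith
  by_cases hθ0 : θ = 0
  · subst hθ0
    have hb : ∀ᵐ x, ‖F x‖ ≤ M := by
      filter_upwards [ae_norm_le_toReal_eLpNorm_top (lt_of_le_of_lt le_self_add h)] with x hx
      exact hx.trans (ENNReal.toReal_mono h.ne le_self_add)
    filter_upwards [hb] with x hx
    filter_upwards [hb] with y hy _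
    rw [Real.rpow_zero]
    linarith [norm_sub_le (F x) (F y)]
  by_cases hθ1 : θ = 1
  · subst hθ1
    obtain ⟨F', hF', hF'b⟩ := exists_hasWeakFDeriv_of_sobolevSeminorm_one hsemi
    have hb := ae_norm_le_toReal_eLpNorm_top hF'b
    rw [← hF'.sobolevSeminorm_one_eq] at hb
    obtain ⟨S, hS, hlip⟩ := hF'.exists_lipschitz hb
    filter_upwards [hS] with x hx
    filter_upwards [hS] with y hy hxy
    refine hle _ (norm_nonneg _) ((hlip x hx y hy).trans ?_)
    rw [Real.rpow_one]
    exact mul_le_mul hsemiM hxy (norm_nonneg _) hM0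
  · rw [sobolevSeminorm_of_ne hθ0 hθ1] at hsemi hsemiM
    have hb := Measure.ae_ae_of_ae_prod (ae_norm_le_toReal_eLpNorm_top hsemi)
    filter_upwards [hb] with x hx
    filter_upwards [hx] with y hy hxy
    refine hle _ (norm_nonneg _) ?_
    rcases (norm_nonneg (x - y)).eq_or_lt with h1 | h1
    · have : x = y := sub_eq_zero.1 (norm_eq_zero.1 h1.symm)
      rw [this, sub_self, norm_zero]
      positivity
    · rw [norm_div, norm_norm, Real.norm_of_nonneg (by positivity), div_le_iff₀ (by positivity)] at hy
      exact hy.trans (mul_le_mul hsemiM (Real.rpow_le_rpow h1.le hxy h0) (by positivity) hM0)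

theorem sobolevNorm_congr_ae [CompleteSpace V] {θ : ℝ} {F G : Rd d → V} (h : F =ᵐ[volume] G) :
    sobolevNorm θ F = sobolevNorm θ G := by
  rw [sobolevNorm, sobolevNorm, eLpNorm_congr_ae h]
  congr 1
  by_cases hθ0 : θ = 0
  · rw [hθ0, sobolevSeminorm_zero, sobolevSeminorm_zero]
  by_cases hθ1 : θ = 1
  · rw [hθ1, sobolevSeminorm_one, sobolevSeminorm_one]
    exact iInf_congr fun F' => iInf_congr_Prop ⟨fun h' => h'.congr_ae h EventuallyEq.rfl,
      fun h' => h'.congr_ae h.symm EventuallyEq.rfl⟩ fun _ => rfl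
  · rw [sobolevSeminorm_of_ne hθ0 hθ1, sobolevSeminorm_of_ne hθ0 hθ1]
    refine eLpNorm_congr_ae ?_
    filter_upwards [Measure.quasiMeasurePreserving_fst.ae h,
      Measure.quasiMeasurePreserving_snd.ae h] with p h1 h2
    rw [h1, h2]

end SobolevNorm

/-! ### Finiteness of the W^{θ,∞} norm of ∇ log γ -/

section LogDerivative

variable {d : ℕ} {x₀ : Rd d} {R : ℝ} {γ : Rd d → ℝ} {γ' : Rd d → Rd d →L[ℝ] ℝ}

theorem IsLipschitzConductivity.inv (h : IsLipschitzConductivity x₀ R γ γ') :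
    HasWeakFDeriv (fun x => (γ x)⁻¹) (fun x => (-(γ x ^ 2)⁻¹) • γ' x) ∧
      (∃ A, ∀ᵐ x, ‖(γ x)⁻¹‖ ≤ A) ∧ ∃ A, ∀ᵐ x, ‖(-(γ x ^ 2)⁻¹) • γ' x‖ ≤ A :=
  h.hasWeakFDeriv_comp (Φ := fun t => t⁻¹) (Φ' := fun t => -(t ^ 2)⁻¹)
    (fun _ ht => (contDiffAt_inv ℝ (Set.mem_Ioi.1 ht).ne').contDiffWithinAt)
    (fun _ ht => hasDerivAt_inv ht.ne')

theorem eLpNorm_top_lt_top_of_bound {α E : Type*} [MeasurableSpace α] {μ : Measure α}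
    [NormedAddCommGroup E] {f : α → E} {A : ℝ} (h : ∀ᵐ x ∂μ, ‖f x‖ ≤ A) : eLpNorm f ⊤ μ < ⊤ := by
  rw [eLpNorm_exponent_top]
  exact eLpNormEssSup_lt_top_of_ae_bound h

/-- The function γ⁻¹ is bounded and Lipschitz, hence Hölder of every exponent θ ≤ 1; a product of
bounded Hölder functions is again Hölder. -/
theorem IsLipschitzConductivity.holder_log (h : IsLipschitzConductivity x₀ R γ γ') {θ : ℝ}
    (hθ0 : 0 ≤ θ) (hθ1 : θ ≤ 1) {A : ℝ}
    (hA : ∀ᵐ p : Rd d × Rd d ∂((volume : Measure (Rd d)).prod volume),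
      ‖γ' p.1 - γ' p.2‖ ≤ A * ‖p.1 - p.2‖ ^ θ) :
    ∃ B, 0 ≤ B ∧ ∀ᵐ p : Rd d × Rd d ∂((volume : Measure (Rd d)).prod volume),
      ‖(γ p.1)⁻¹ • γ' p.1 - (γ p.2)⁻¹ • γ' p.2‖ ≤ B * ‖p.1 - p.2‖ ^ θ := by
  obtain ⟨hw, ⟨a, ha⟩, K, hK⟩ := h.inv
  obtain ⟨S, hS, hlip⟩ := hw.exists_lipschitz hK
  have hb := ae_norm_le_toReal_eLpNorm_top h.eLpNorm_lt_top
  set M := (eLpNorm γ' ⊤ volume).toReal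
  have hM0 : 0 ≤ M := ENNReal.toReal_nonneg
  have ha0 : 0 ≤ a := by
    obtain ⟨x, hx⟩ := ha.exists
    exact (norm_nonneg _).trans hx
  have hK0 : 0 ≤ K := by
    obtain ⟨x, hx⟩ := hK.exists
    exact (norm_nonneg _).trans hx
  refine ⟨a * |A| + (K + 2 * a) * M, by positivity, ?_⟩
  have hq1 := Measure.quasiMeasurePreserving_fst (μ := (volume : Measure (Rd d)))
    (ν := (volume : Measure (Rd d)))
  have hq2 := Measure.quasiMeasurePreserving_snd (μ := (volume : Measure (Rd d)))
    (ν := (volume : Measure (Rd d)))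
  filter_upwards [hA, hq1.ae hS, hq2.ae hS, hq1.ae ha, hq2.ae ha, hq2.ae hb] with p h1 s1 s2 a1 a2 b2
  have hr : 0 ≤ ‖p.1 - p.2‖ := norm_nonneg _
  have hrθ : 0 ≤ ‖p.1 - p.2‖ ^ θ := Real.rpow_nonneg hr θ
  -- At distance at most 1 the Lipschitz constant K serves, beyond it the trivial bound 2a.
  have hinv : ‖(γ p.1)⁻¹ - (γ p.2)⁻¹‖ ≤ (K + 2 * a) * ‖p.1 - p.2‖ ^ θ := by
    rcases le_total ‖p.1 - p.2‖ 1 with h2 | h2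
    · have h3 : ‖p.1 - p.2‖ ≤ ‖p.1 - p.2‖ ^ θ := by
        rcases hr.eq_or_lt with h4 | h4
        · exact h4 ▸ hrθ
        · simpa using Real.rpow_le_rpow_of_exponent_ge h4 h2 hθ1
      refine (hlip _ s1 _ s2).trans (mul_le_mul ?_ h3 hr (by positivity))
      linarith
    · have h3 : 1 ≤ ‖p.1 - p.2‖ ^ θ := Real.one_le_rpow h2 hθ0
      calc ‖(γ p.1)⁻¹ - (γ p.2)⁻¹‖ ≤ a + a := (norm_sub_le _ _).trans (add_le_add a1 a2)
        _ ≤ (K + 2 * a) * 1 := by linarith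
        _ ≤ _ := by gcongr
  calc ‖(γ p.1)⁻¹ • γ' p.1 - (γ p.2)⁻¹ • γ' p.2‖
      = ‖(γ p.1)⁻¹ • (γ' p.1 - γ' p.2) + ((γ p.1)⁻¹ - (γ p.2)⁻¹) • γ' p.2‖ := by
        congr 1; module
    _ ≤ ‖(γ p.1)⁻¹‖ * ‖γ' p.1 - γ' p.2‖ + ‖(γ p.1)⁻¹ - (γ p.2)⁻¹‖ * ‖γ' p.2‖ := by
        refine (norm_add_le _ _).trans (le_of_eq ?_)
        rw [norm_smul, norm_smul]
    _ ≤ a * (|A| * ‖p.1 - p.2‖ ^ θ) + (K + 2 * a) * ‖p.1 - p.2‖ ^ θ * M := by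
        refine add_le_add (mul_le_mul a1 (h1.trans ?_) (norm_nonneg _) ha0)
          (mul_le_mul hinv b2 (norm_nonneg _) (by positivity))
        exact mul_le_mul_of_nonneg_right (le_abs_self A) hrθ
    _ = _ := by ring

theorem IsLipschitzConductivity.sobolevNorm_log_lt_top (h : IsLipschitzConductivity x₀ R γ γ')
    {θ : ℝ} (hθ0 : 0 ≤ θ) (hθ1 : θ ≤ 1) (hγ' : sobolevNorm θ γ' < ⊤) :
    sobolevNorm θ (fun x => (γ x)⁻¹ • γ' x) < ⊤ := by
  obtain ⟨hlog, A, hA⟩ := h.log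
  have hsemi : sobolevSeminorm θ γ' < ⊤ := lt_of_le_of_lt le_add_self hγ'
  have hM' := ae_norm_le_toReal_eLpNorm_top h.eLpNorm_lt_top
  refine ENNReal.add_lt_top.2 ⟨eLpNorm_top_lt_top_of_bound hA, ?_⟩
  by_cases h0 : θ = 0
  · rw [h0, sobolevSeminorm_zero]; exact ENNReal.zero_lt_top
  by_cases h1 : θ = 1
  · subst h1
    obtain ⟨γ'', hγ'', hb⟩ := exists_hasWeakFDeriv_of_sobolevSeminorm_one hsemi
    have hM'' := ae_norm_le_toReal_eLpNorm_top hb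
    obtain ⟨hw, ⟨a, ha⟩, K, hK⟩ := h.inv
    rw [(hw.smul_of_bounded hγ'' ha hK).sobolevSeminorm_one_eq]
    refine eLpNorm_top_lt_top_of_bound (A := a * (eLpNorm γ'' ⊤ volume).toReal +
      K * (eLpNorm γ' ⊤ volume).toReal) ?_
    filter_upwards [ha, hK, hM', hM''] with x k1 k2 k3 k4
    refine (norm_add_le _ _).trans (add_le_add ?_ ?_)
    · rw [norm_smul]
      exact mul_le_mul k1 k4 (norm_nonneg _) ((norm_nonneg _).trans k1)
    · rw [ContinuousLinearMap.norm_smulRight_apply]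
      exact mul_le_mul k2 k3 (norm_nonneg _) ((norm_nonneg _).trans k2)
  · rw [sobolevSeminorm_of_ne h0 h1] at hsemi ⊢
    obtain ⟨B, hB0, hB⟩ := h.holder_log hθ0 hθ1
      (A := (eLpNorm (fun p : Rd d × Rd d => ‖γ' p.1 - γ' p.2‖ / ‖p.1 - p.2‖ ^ θ) ⊤
        ((volume : Measure (Rd d)).prod volume)).toReal) (by
      filter_upwards [ae_norm_le_toReal_eLpNorm_top hsemi] with p hp
      rcases (norm_nonneg (p.1 - p.2)).eq_or_lt with h2 | h2
      · rw [sub_eq_zero.1 (norm_eq_zero.1 h2.symm), sub_self, norm_zero, sub_self, norm_zero]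
        positivity
      · rwa [norm_div, norm_norm, Real.norm_of_nonneg (by positivity),
          div_le_iff₀ (by positivity)] at hp)
    refine eLpNorm_top_lt_top_of_bound (A := B) ?_
    filter_upwards [hB] with p hp
    rw [norm_div, norm_norm, Real.norm_of_nonneg (by positivity)]
    exact div_le_of_le_mul₀ (by positivity) hB0 hp

end LogDerivative

/-! ### Continuously differentiable conductivities -/

section ContinuouslyDifferentiable

variable {d : ℕ} {x₀ : Rd d} {R : ℝ} {γ : Rd d → ℝ}

theorem isLipschitzConductivity_of_contDiff (h : IsConductivity (Metric.ball x₀ R) γ)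
    (hγ : ContDiff ℝ 1 γ) : IsLipschitzConductivity x₀ R γ (fderiv ℝ γ) := by
  have hw := hasWeakFDeriv_of_contDiff hγ
  refine ⟨h, ⟨hγ.continuous.aestronglyMeasurable, ?_⟩, hw, ?_⟩
  · obtain ⟨k, hk⟩ := h.2
    obtain ⟨A, hA⟩ := (isCompact_closedBall x₀ R).exists_bound_of_continuousOn
      hγ.continuous.continuousOn
    refine eLpNorm_top_lt_top_of_bound (A := max A ‖k‖) ?_
    filter_upwards [hk] with x hx
    by_cases hxb : x ∈ Metric.ball x₀ R
    · exact (hA x (Metric.ball_subset_closedBall hxb)).trans (le_max_left _ _)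
    · rw [hx hxb]; exact le_max_right _ _
  · obtain ⟨A, hA⟩ := (isCompact_closedBall x₀ R).exists_bound_of_continuousOn
      (hγ.continuous_fderiv (by simp)).continuousOn
    refine eLpNorm_top_lt_top_of_bound (A := max A 0) ?_
    filter_upwards [h.weakDeriv_eq_zero hw] with x hx
    by_cases hxb : x ∈ Metric.closedBall x₀ R
    · exact (hA x hxb).trans (le_max_left _ _)
    · rw [hx hxb, norm_zero]; exact le_max_right _ _

/-- The lower bound on γ and the vanishing of its derivative are known almost everywhere. They
define closed sets, which being of full measure are dense and so everything. -/
theorem IsConductivity.continuous_log_deriv (h : IsConductivity (Metric.ball x₀ R) γ)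
    (hγ : ContDiff ℝ 1 γ) : Continuous (fun x => (γ x)⁻¹ • fderiv ℝ γ x) ∧
      HasCompactSupport fun x => (γ x)⁻¹ • fderiv ℝ γ x := by
  obtain ⟨c, hc, hcγ⟩ := h.1
  have hpos : ∀ x, c ≤ γ x := by
    intro x
    have h1 : IsClosed {x | c ≤ γ x} := isClosed_le continuous_const hγ.continuous
    have h2 := (Measure.dense_of_ae hcγ).closure_eq
    rw [h1.closure_eq] at h2
    have h3 : x ∈ {x | c ≤ γ x} := h2 ▸ Set.mem_univ x
    exact h3
  have hcont : Continuous (fun x => (γ x)⁻¹ • fderiv ℝ γ x) :=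
    (hγ.continuous.inv₀ fun x => (hc.trans_le (hpos x)).ne').smul (hγ.continuous_fderiv (by simp))
  refine ⟨hcont, HasCompactSupport.intro (isCompact_closedBall x₀ R) fun x hx => ?_⟩
  have h1 : IsClosed (Metric.closedBall x₀ R ∪ {x | fderiv ℝ γ x = 0}) :=
    Metric.isClosed_closedBall.union (isClosed_eq (hγ.continuous_fderiv (by simp))
      continuous_const)
  have h2 : ∀ᵐ x, x ∈ Metric.closedBall x₀ R ∪ {x | fderiv ℝ γ x = 0} := by
    filter_upwards [h.weakDeriv_eq_zero (hasWeakFDeriv_of_contDiff hγ)] with y hy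
    exact or_iff_not_imp_left.2 hy
  have h3 := (Measure.dense_of_ae h2).closure_eq
  have h4 : x ∈ closure {x | x ∈ Metric.closedBall x₀ R ∪ {x | fderiv ℝ γ x = 0}} :=
    h3 ▸ Set.mem_univ x
  have h5 : fderiv ℝ γ x = 0 := (h1.closure_eq ▸ h4 : x ∈ Metric.closedBall x₀ R ∪
    {x | fderiv ℝ γ x = 0}).resolve_left hx
  rw [h5, smul_zero]

/-- A continuous compactly supported function has a modulus of continuity. -/
theorem exists_modulus {E : Type*} [NormedAddCommGroup E] {f : Rd d → E} (hf : Continuous f)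
    (hf2 : HasCompactSupport f) : ∃ δ : ℝ → ℝ, Tendsto δ atTop (𝓝 0) ∧ (∀ s, 0 ≤ δ s) ∧
      ∀ s x y, ‖x - y‖ ≤ s⁻¹ → ‖f x - f y‖ ≤ δ s := by
  obtain ⟨M, hM⟩ := hf2.exists_bound_of_continuous hf
  have hbdd : ∀ s : ℝ, BddAbove ((fun p : Rd d × Rd d => ‖f p.1 - f p.2‖) ''
      {p | ‖p.1 - p.2‖ ≤ s⁻¹}) := by
    rintro s
    refine ⟨M + M, ?_⟩
    rintro _ ⟨p, -, rfl⟩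
    exact (norm_sub_le _ _).trans (add_le_add (hM _) (hM _))
  -- For s < 0 the set is empty and the supremum takes its default value 0, so nonnegativity holds
  -- for every s.
  have hnn : ∀ s : ℝ, 0 ≤ sSup ((fun p : Rd d × Rd d => ‖f p.1 - f p.2‖) ''
      {p | ‖p.1 - p.2‖ ≤ s⁻¹}) := fun s => Real.sSup_nonneg (by
    rintro _ ⟨p, -, rfl⟩
    exact norm_nonneg _)
  refine ⟨fun s => sSup ((fun p : Rd d × Rd d => ‖f p.1 - f p.2‖) '' {p | ‖p.1 - p.2‖ ≤ s⁻¹}),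
    ?_, hnn, fun s x y hxy => le_csSup (hbdd s) ⟨(x, y), hxy, rfl⟩⟩
  rw [Metric.tendsto_atTop]
  intro ε hε
  obtain ⟨η, hη, hunif⟩ := Metric.uniformContinuous_iff.1 (hf2.uniformContinuous_of_continuous hf)
    (ε / 2) (half_pos hε)
  refine ⟨2 / η, fun s hs => ?_⟩
  rw [Real.dist_eq, sub_zero, abs_of_nonneg (hnn s)]
  refine lt_of_le_of_lt (Real.sSup_le ?_ (half_pos hε).le) (half_lt_self hε)
  rintro _ ⟨p, hp, rfl⟩
  have hsη : s⁻¹ < η := by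
    have h1 : s⁻¹ ≤ (2 / η)⁻¹ := inv_anti₀ (by positivity) hs
    rw [inv_div] at h1
    linarith
  have := hunif (a := p.1) (b := p.2) (by rw [dist_eq_norm]; exact lt_of_le_of_lt hp hsη)
  rw [dist_eq_norm] at this
  exact this.le

end ContinuouslyDifferentiable

end CalderonLip

/-! ### The theorem -/

theorem mainTheorem2 (d : ℕ) (hd : 3 ≤ d) :
    -- the Sobolev bound: `om` depends on nothing but `d`, and `C` on nothing but `d` and the ball
    (∃ om : ℝ → ℝ, Tendsto om (𝓝[≥] 0) (𝓝 0) ∧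
      ∀ (x₀ : CalderonLip.Rd d) (R : ℝ), ∃ C : ℝ,
        ∀ θ : ℝ, 0 ≤ θ → θ ≤ 1 →
        ∀ γ : CalderonLip.Rd d → ℝ, CalderonLip.IsConductivity (Metric.ball x₀ R) γ →
          CalderonLip.MemSobolevOneAdd θ γ →
        CalderonLip.sobolevNorm θ (CalderonLip.weakFDeriv (fun x => Real.log (γ x))) < ⊤ ∧
        ∀ s : ℝ, 0 < s →
        ∀ ζ₁ ζ₂ : EuclideanSpace ℂ (Fin d),
          CalderonLip.IsPhase s ζ₁ → CalderonLip.IsPhase s ζ₂ →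
        ∀ u v : CalderonLip.Rd d → ℂ,
          CalderonLip.dotXNorm ζ₁ (1 / 2) u < ⊤ → CalderonLip.dotXNorm ζ₂ (1 / 2) v < ⊤ →
          CalderonLip.FormDefined γ u v ∧
          ‖CalderonLip.mqForm γ u v‖ ≤
            C * om (CalderonLip.sobolevNorm θ
                (CalderonLip.weakFDeriv (fun x => Real.log (γ x)))).toReal * s ^ (-θ) *
              (CalderonLip.dotXNorm ζ₁ (1 / 2) u).toReal *
              (CalderonLip.dotXNorm ζ₂ (1 / 2) v).toReal) ∧
    -- the case of continuously differentiable `γ`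
    (∀ (x₀ : CalderonLip.Rd d) (R : ℝ) (γ : CalderonLip.Rd d → ℝ),
      CalderonLip.IsConductivity (Metric.ball x₀ R) γ → ContDiff ℝ 1 γ →
      ∃ o : ℝ → ℝ, Tendsto o atTop (𝓝 0) ∧
        ∀ s : ℝ, 0 < s →
        ∀ ζ₁ ζ₂ : EuclideanSpace ℂ (Fin d),
          CalderonLip.IsPhase s ζ₁ → CalderonLip.IsPhase s ζ₂ →
        ∀ u v : CalderonLip.Rd d → ℂ,
          CalderonLip.dotXNorm ζ₁ (1 / 2) u < ⊤ → CalderonLip.dotXNorm ζ₂ (1 / 2) v < ⊤ →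
          CalderonLip.FormDefined γ u v ∧
          ‖CalderonLip.mqForm γ u v‖ ≤
            o s * (CalderonLip.dotXNorm ζ₁ (1 / 2) u).toReal *
              (CalderonLip.dotXNorm ζ₂ (1 / 2) v).toReal) := by
  -- The linear and the quadratic term in ∇log γ give t + t², whatever θ is.
  refine ⟨⟨fun t => t + t ^ 2, ?_, fun x₀ R => ?_⟩, fun x₀ R γ hγ hγ1 => ?_⟩
  · have h : Continuous fun t : ℝ => t + t ^ 2 := by fun_prop
    have h0 := (h.tendsto 0).mono_left (nhdsWithin_le_nhds (s := Set.Ici 0))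
    simpa using h0
  · obtain ⟨C, hC, hmain⟩ := CalderonLip.exists_norm_mqForm_le d hd x₀ R
    -- The 2 is the one in the oscillation bound δ ≤ 2M s^(-θ).
    refine ⟨2 * C, fun θ hθ0 hθ1 γ hγ hmem => ?_⟩
    obtain ⟨hγ2, γ', hγ', hnorm⟩ := hmem
    have h : CalderonLip.IsLipschitzConductivity x₀ R γ γ' :=
      ⟨hγ, hγ2, hγ', lt_of_le_of_lt le_self_add hnorm⟩
    rw [CalderonLip.sobolevNorm_congr_ae h.log.1.weakFDeriv_ae_eq]
    have hfin := h.sobolevNorm_log_lt_top hθ0 hθ1 hnorm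
    refine ⟨hfin, fun s hs ζ₁ ζ₂ hζ₁ hζ₂ u v hu hv => ?_⟩
    obtain ⟨hdef, hbound⟩ := hmain γ γ' h s hs ζ₁ ζ₂ hζ₁ hζ₂ u v hu hv
    refine ⟨hdef, ?_⟩
    set M := (CalderonLip.sobolevNorm θ fun x => (γ x)⁻¹ • γ' x).toReal with hM
    have hM0 : 0 ≤ M := ENNReal.toReal_nonneg
    have hL : ∀ᵐ x, ‖(γ x)⁻¹ • γ' x‖ ≤ M := by
      filter_upwards [CalderonLip.ae_norm_le_toReal_eLpNorm_top
        (lt_of_le_of_lt le_self_add hfin)] with x hx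
      exact hx.trans (ENNReal.toReal_mono hfin.ne le_self_add)
    obtain ⟨hb1, hb2⟩ := hbound M hL
    have ha : 0 ≤ (CalderonLip.dotXNorm ζ₁ (1 / 2) u).toReal := ENNReal.toReal_nonneg
    have hb : 0 ≤ (CalderonLip.dotXNorm ζ₂ (1 / 2) v).toReal := ENNReal.toReal_nonneg
    -- For s ≤ 1 the crude bound suffices as s^(-θ) ≥ 1; for s ≥ 1 the oscillation bound is used,
    -- with s⁻¹ ≤ s^(-θ).
    rcases le_total s 1 with hs1 | hs1
    · have h1 : 1 ≤ s ^ (-θ) :=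
        Real.one_le_rpow_of_pos_of_le_one_of_nonpos hs hs1 (neg_nonpos.2 hθ0)
      refine hb1.trans ?_
      have h2 : C * (M + M ^ 2) ≤ 2 * C * (M + M ^ 2) * s ^ (-θ) := by
        have h3 : 0 ≤ C * (M + M ^ 2) := by positivity
        calc C * (M + M ^ 2) ≤ 2 * (C * (M + M ^ 2)) * 1 := by linarith
          _ ≤ 2 * (C * (M + M ^ 2)) * s ^ (-θ) := by gcongr
          _ = _ := by ring
      gcongr
    · have hosc := CalderonLip.ae_norm_sub_le_of_sobolevNorm hθ0 hfin (inv_pos.2 hs)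
      rw [← hM, Real.inv_rpow hs.le, ← Real.rpow_neg hs.le] at hosc
      refine (hb2 _ hs1 (by positivity) hosc).trans ?_
      have h1 : s⁻¹ ≤ s ^ (-θ) := by
        rw [← Real.rpow_neg_one]
        exact Real.rpow_le_rpow_of_exponent_le hs1 (neg_le_neg hθ1)
      have h2 : C * (2 * M * s ^ (-θ) + M ^ 2 * s⁻¹) ≤ 2 * C * (M + M ^ 2) * s ^ (-θ) := by
        have h3 : 0 ≤ C * (M ^ 2 * s ^ (-θ)) := by positivity
        calc C * (2 * M * s ^ (-θ) + M ^ 2 * s⁻¹)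
            ≤ C * (2 * M * s ^ (-θ) + M ^ 2 * s ^ (-θ)) := by gcongr
          _ ≤ C * (2 * M * s ^ (-θ) + M ^ 2 * s ^ (-θ)) + C * (M ^ 2 * s ^ (-θ)) :=
            le_add_of_nonneg_right h3
          _ = _ := by ring
      gcongr
  · obtain ⟨C, hC, hmain⟩ := CalderonLip.exists_norm_mqForm_le d hd x₀ R
    have h := CalderonLip.isLipschitzConductivity_of_contDiff hγ hγ1
    obtain ⟨hcont, hsupp⟩ := hγ.continuous_log_deriv hγ1
    obtain ⟨M, hM⟩ := hsupp.exists_bound_of_continuous hcont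
    obtain ⟨δ, hδ, hδ0, hosc⟩ := CalderonLip.exists_modulus hcont hsupp
    -- The oscillation estimate holds only for s ≥ 1; below that the crude bound is inserted,
    -- without effect on the limit.
    refine ⟨fun s => if 1 ≤ s then C * (δ s + M ^ 2 * s⁻¹) else C * (M + M ^ 2), ?_,
      fun s hs ζ₁ ζ₂ hζ₁ hζ₂ u v hu hv => ?_⟩
    · have h1 : Tendsto (fun s => C * (δ s + M ^ 2 * s⁻¹)) atTop (𝓝 0) := by
        simpa using (hδ.add (tendsto_inv_atTop_zero.const_mul (M ^ 2))).const_mul C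
      refine h1.congr' ?_
      filter_upwards [eventually_ge_atTop (1 : ℝ)] with s hs
      rw [if_pos hs]
    · obtain ⟨hdef, hbound⟩ := hmain γ _ h s hs ζ₁ ζ₂ hζ₁ hζ₂ u v hu hv
      obtain ⟨hb1, hb2⟩ := hbound M (Eventually.of_forall hM)
      refine ⟨hdef, ?_⟩
      dsimp only
      split_ifs with hs1
      · exact hb2 _ hs1 (hδ0 s)
          (Eventually.of_forall fun x => Eventually.of_forall fun y => hosc s x y)
      · exact hb1
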